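/- Let $\mathcal Q_h$ be a finite mesh of nondegenerate convex quadrilaterals in $\mathbb R^2$ which is conforming (two distinct closed quadrilaterals are disjoint, or meet exactly in a common vertex, or meet exactly in a common edge). Let $\Omega$ be the interior of the union of the closed quadrilaterals, and suppose that $\Omega$ is a contractible Lipschitz domain. Split every $Q\in\mathcal Q_h$ by its two diagonals into four triangles; let $\mathcal T_h^Q$ be the set of these triangles and $\mathcal T_h=\bigcup_{Q}\mathcal T_h^Q$ (a criss-cross mesh). Let $k\in\{2,3\}$ and define: - $\Sigma_h^{k+1}(Q)=\{u\in H^2(Q): u|_T\in P_{k+1}(T)\ \text{for all } T\in\mathcal T_h^Q\}$ for $Q\in\mathcal Q_h$, and $\Sigma_h^{k+1}$ as the space of all $u\in L^2(\Omega)$ with $u|_Q\in\Sigma_h^{k+1}(Q)$ for all $Q\in\mathcal Q_h$ for which the following quantities take the same value when computed from any of the quadrilaterals that contain the vertex $v$, respectively the edge $e$: $u(v)$, $\partial_xu(v)$, $\partial_yu(v)$ for every vertex $v$ of $\mathcal Q_h$; and, for every edge $e$ of $\mathcal Q_h$ with a fixed unit normal $n_e$, the moments $\int_e\partial_{n_e}u\,q\,ds$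 for $q\in P_{k-2}(e)$ and $\frac1{|e|}\int_e u\,q\,ds$ for $q\in P_{k-3}(e)$ (where $P_{-1}(e)=\{0\}$); - $V_h^k=\{u\in H^1(\Omega)^2: u|_T\in P_k(T)^2\ \text{for all } T\in\mathcal T_h\}$; - $W_h^{k-1}=\operatorname{div}V_h^k\subset L^2(\Omega)$. Let $\operatorname{curl}\varphi=(\partial_y\varphi,-\partial_x\varphi)$, with all derivatives taken in the weak sense on $\Omega$. Then $$0\to\mathbb R\xrightarrow{\ \subset\ }\Sigma_h^{k+1}\xrightarrow{\ \operatorname{curl}\ }V_h^k\xrightarrow{\ \operatorname{div}\ }W_h^{k-1}\to0$$ is an exact complex: the constants lie in $\Sigma_h^{k+1}$; $\operatorname{curl}$ and $\operatorname{div}$ are well-defined linear maps between the indicated spaces; a function in $\Sigma_h^{k+1}$ has zero curl if and only if it is constant; a field $u\in V_h^k$ satisfies $\operatorname{div}u=0$ if and only if $u=\operatorname{curl}\varphi$ for some $\varphi\in\Sigma_h^{k+1}$; and $\operatorname{div}:V_h^k\to W_h^{k-1}$ is onto. -/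

import Mathlib

open MeasureTheory
open scoped ContDiff NNReal

noncomputable section

namespace CrissCross

/-- The Euclidean plane. -/
abbrev Pt := EuclideanSpace ℝ (Fin 2)

/-! ### Sobolev spaces through weak derivatives -/

/-- `g` is the weak partial derivative of `f` in the `i`-th coordinate direction on `U`. -/
def IsWeakPartial (U : Set Pt) (i : Fin 2) (f g : Pt → ℝ) : Prop :=
  ∀ φ : Pt → ℝ, ContDiff ℝ ∞ φ → HasCompactSupport φ → tsupport φ ⊆ U →
    ∫ x in U, f x * fderiv ℝ φ x (EuclideanSpace.single i 1) = - ∫ x in U, g x * φ x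

/-- `f ∈ H¹(U)`. -/
def MemH1 (U : Set Pt) (f : Pt → ℝ) : Prop :=
  MemLp f 2 (volume.restrict U) ∧
    ∀ i, ∃ g, MemLp g 2 (volume.restrict U) ∧ IsWeakPartial U i f g

/-- `f ∈ H²(U)`: `f ∈ L²(U)` and both first weak derivatives lie in `H¹(U)`. -/
def MemH2 (U : Set Pt) (f : Pt → ℝ) : Prop :=
  MemLp f 2 (volume.restrict U) ∧ ∀ i, ∃ g, MemH1 U g ∧ IsWeakPartial U i f g

/-- The space `L²(U)`. -/
abbrev L2 (U : Set Pt) := Lp ℝ 2 (volume.restrict U : Measure Pt)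

theorem integrable_mul_of_test {U : Set Pt} {f ψ : Pt → ℝ}
    (hf : MemLp f 2 (volume.restrict U)) (hψ : Continuous ψ) (hc : HasCompactSupport ψ) :
    Integrable (fun x => f x * ψ x) (volume.restrict U) :=
  hf.integrable_mul (p := 2) (q := 2) ((hψ.memLp_of_hasCompactSupport hc).restrict U)

theorem continuous_partial {φ : Pt → ℝ} (h : ContDiff ℝ ∞ φ) (i : Fin 2) :
    Continuous (fun x => fderiv ℝ φ x (EuclideanSpace.single i 1)) :=
  (h.continuous_fderiv (by simp)).clm_apply continuous_const

theorem hasCompactSupport_partial {φ : Pt → ℝ} (h : HasCompactSupport φ) (i : Fin 2) :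
    HasCompactSupport (fun x => fderiv ℝ φ x (EuclideanSpace.single i 1)) :=
  (h.fderiv ℝ).comp_left (g := fun L : Pt →L[ℝ] ℝ => L (EuclideanSpace.single i 1)) rfl

theorem IsWeakPartial.congr {U : Set Pt} {i : Fin 2} {f f' g g' : Pt → ℝ}
    (h : IsWeakPartial U i f g) (hf : f =ᵐ[volume.restrict U] f')
    (hg : g =ᵐ[volume.restrict U] g') : IsWeakPartial U i f' g' := by
  intro φ h1 h2 h3
  have e1 : ∫ x in U, f' x * fderiv ℝ φ x (EuclideanSpace.single i 1)
      = ∫ x in U, f x * fderiv ℝ φ x (EuclideanSpace.single i 1) :=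
    integral_congr_ae (by filter_upwards [hf] with x hx; rw [hx])
  have e2 : ∫ x in U, g' x * φ x = ∫ x in U, g x * φ x :=
    integral_congr_ae (by filter_upwards [hg] with x hx; rw [hx])
  rw [e1, e2]; exact h φ h1 h2 h3

theorem IsWeakPartial.add {U : Set Pt} {i : Fin 2} {f f' g g' : Pt → ℝ}
    (h : IsWeakPartial U i f g) (h' : IsWeakPartial U i f' g')
    (hf : MemLp f 2 (volume.restrict U)) (hf' : MemLp f' 2 (volume.restrict U))
    (hg : MemLp g 2 (volume.restrict U)) (hg' : MemLp g' 2 (volume.restrict U)) :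
    IsWeakPartial U i (f + f') (g + g') := by
  intro φ h1 h2 h3
  have c1 := continuous_partial h1 i
  have c2 := hasCompactSupport_partial h2 i
  simp only [Pi.add_apply, add_mul]
  rw [integral_add (integrable_mul_of_test hf c1 c2) (integrable_mul_of_test hf' c1 c2),
    integral_add (integrable_mul_of_test hg h1.continuous h2)
      (integrable_mul_of_test hg' h1.continuous h2), h φ h1 h2 h3, h' φ h1 h2 h3]
  ring

theorem IsWeakPartial.smul {U : Set Pt} {i : Fin 2} {f g : Pt → ℝ} (c : ℝ)
    (h : IsWeakPartial U i f g) : IsWeakPartial U i (c • f) (c • g) := by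
  intro φ h1 h2 h3
  simp only [Pi.smul_apply, smul_eq_mul, mul_assoc]
  rw [integral_const_mul, integral_const_mul, h φ h1 h2 h3]
  ring

theorem IsWeakPartial.zero {U : Set Pt} {i : Fin 2} : IsWeakPartial U i 0 0 := by
  intro φ _ _ _
  simp

theorem MemH1.congr {U : Set Pt} {f f' : Pt → ℝ} (h : MemH1 U f)
    (e : f =ᵐ[volume.restrict U] f') : MemH1 U f' := by
  refine ⟨(memLp_congr_ae e).1 h.1, fun i => ?_⟩
  obtain ⟨g, hg, hw⟩ := h.2 i
  exact ⟨g, hg, hw.congr e Filter.EventuallyEq.rfl⟩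

theorem MemH1.add {U : Set Pt} {f f' : Pt → ℝ} (h : MemH1 U f) (h' : MemH1 U f') :
    MemH1 U (f + f') := by
  refine ⟨h.1.add h'.1, fun i => ?_⟩
  obtain ⟨g, hg, hw⟩ := h.2 i
  obtain ⟨g', hg', hw'⟩ := h'.2 i
  exact ⟨g + g', hg.add hg', hw.add hw' h.1 h'.1 hg hg'⟩

theorem MemH1.smul {U : Set Pt} {f : Pt → ℝ} (c : ℝ) (h : MemH1 U f) : MemH1 U (c • f) := by
  refine ⟨h.1.const_smul c, fun i => ?_⟩
  obtain ⟨g, hg, hw⟩ := h.2 i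
  exact ⟨c • g, hg.const_smul c, hw.smul c⟩

theorem MemH1.zero {U : Set Pt} : MemH1 U 0 :=
  ⟨MemLp.zero, fun _ => ⟨0, MemLp.zero, IsWeakPartial.zero⟩⟩

theorem MemH2.congr {U : Set Pt} {f f' : Pt → ℝ} (h : MemH2 U f)
    (e : f =ᵐ[volume.restrict U] f') : MemH2 U f' := by
  refine ⟨(memLp_congr_ae e).1 h.1, fun i => ?_⟩
  obtain ⟨g, hg, hw⟩ := h.2 i
  exact ⟨g, hg, hw.congr e Filter.EventuallyEq.rfl⟩

theorem MemH2.add {U : Set Pt} {f f' : Pt → ℝ} (h : MemH2 U f) (h' : MemH2 U f') :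
    MemH2 U (f + f') := by
  refine ⟨h.1.add h'.1, fun i => ?_⟩
  obtain ⟨g, hg, hw⟩ := h.2 i
  obtain ⟨g', hg', hw'⟩ := h'.2 i
  exact ⟨g + g', hg.add hg', hw.add hw' h.1 h'.1 hg.1 hg'.1⟩

theorem MemH2.smul {U : Set Pt} {f : Pt → ℝ} (c : ℝ) (h : MemH2 U f) : MemH2 U (c • f) := by
  refine ⟨h.1.const_smul c, fun i => ?_⟩
  obtain ⟨g, hg, hw⟩ := h.2 i
  exact ⟨c • g, hg.smul c, hw.smul c⟩

theorem MemH2.zero {U : Set Pt} : MemH2 U 0 :=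
  ⟨MemLp.zero, fun _ => ⟨0, MemH1.zero, IsWeakPartial.zero⟩⟩

/-- `u = curl φ = (∂φ/∂y, -∂φ/∂x)` in the weak sense. -/
def IsCurl {U : Set Pt} (φ : L2 U) (u : L2 U × L2 U) : Prop :=
  IsWeakPartial U 1 φ u.1 ∧ IsWeakPartial U 0 φ (-u.2 : L2 U)

/-- `w = div u = ∂u₁/∂x + ∂u₂/∂y` with weak partial derivatives in `L²`. -/
def IsDiv {U : Set Pt} (u : L2 U × L2 U) (w : L2 U) : Prop :=
  ∃ a b : L2 U, IsWeakPartial U 0 u.1 a ∧ IsWeakPartial U 1 u.2 b ∧ w = a + b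

/-! ### Meshes of convex quadrilaterals and their criss-cross refinement -/

/-- The signed area of the parallelogram spanned by two plane vectors. -/
def cross (u v : Pt) : ℝ := u 0 * v 1 - u 1 * v 0

/-- The closed quadrilateral with the given vertices. -/
def quad (a : Fin 4 → Pt) : Set Pt := convexHull ℝ (Set.range a)

/-- The `j`-th edge as an unordered pair of vertices (indices are cyclic). -/
def quadEdge (a : Fin 4 → Pt) (j : Fin 4) : Sym2 Pt := s(a j, a (j + 1))

/-- The intersection of the diagonals `[a₀, a₂]` and `[a₁, a₃]`. -/
def quadCenter (a : Fin 4 → Pt) : Pt :=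
  a 0 + (cross (a 1 - a 0) (a 3 - a 1) / cross (a 2 - a 0) (a 3 - a 1)) • (a 2 - a 0)

/-- A finite conforming mesh of nondegenerate convex quadrilaterals. -/
structure QuadMesh (ι : Type*) where
  /-- the vertices of each quadrilateral, in counterclockwise order -/
  vert : ι → Fin 4 → Pt
  /-- the boundary polygon of each quadrilateral turns strictly left at every vertex -/
  convex : ∀ Q j, 0 < cross (vert Q (j + 1) - vert Q j) (vert Q (j + 2) - vert Q (j + 1))
  /-- two distinct closed quadrilaterals are disjoint or share exactly a vertex or an edge -/
  conforming : ∀ Q Q', Q ≠ Q' →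
    quad (vert Q) ∩ quad (vert Q') = ∅ ∨
    (∃ j j', vert Q j = vert Q' j' ∧ quad (vert Q) ∩ quad (vert Q') = {vert Q j}) ∨
    (∃ j j', quadEdge (vert Q) j = quadEdge (vert Q') j' ∧
      quad (vert Q) ∩ quad (vert Q') = segment ℝ (vert Q j) (vert Q (j + 1)))

/-- Near each of its boundary points the set is, in suitable orthonormal coordinates, the region
strictly above the graph of a Lipschitz function. -/
def HasLipschitzBoundary (U : Set Pt) : Prop :=
  ∀ x ∈ frontier U, ∃ (R : Pt ≃ₗᵢ[ℝ] Pt) (γ : ℝ → ℝ) (L : ℝ≥0) (r : ℝ), 0 < r ∧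
    LipschitzWith L γ ∧ ∀ y ∈ Metric.ball x r, y ∈ U ↔ γ (R y 0) < R y 1

/-- The integral of `g` over the segment from `a` to `b` with respect to arc length. -/
def edgeIntegral (a b : Pt) (g : Pt → ℝ) : ℝ :=
  ‖b - a‖ * ∫ t in (0 : ℝ)..1, g (a + t • (b - a))

/-- Value of a polynomial at a point of the plane. -/
def pval (p : MvPolynomial (Fin 2) ℝ) (x : Pt) : ℝ := MvPolynomial.eval (fun i => x i) p

/-- The derivative of a polynomial normal to the edge from `a` to `b`. -/
def normalDeriv (a b : Pt) (p : MvPolynomial (Fin 2) ℝ) (x : Pt) : ℝ :=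
  ((b - a) 1 / ‖b - a‖) * pval (MvPolynomial.pderiv 0 p) x
    - ((b - a) 0 / ‖b - a‖) * pval (MvPolynomial.pderiv 1 p) x

theorem continuous_pval (p : MvPolynomial (Fin 2) ℝ) : Continuous (pval p) := by
  unfold pval
  exact (MvPolynomial.continuous_eval p).comp (by fun_prop)

theorem continuous_normalDeriv (a b : Pt) (p : MvPolynomial (Fin 2) ℝ) :
    Continuous (normalDeriv a b p) := by
  unfold normalDeriv
  have h0 := continuous_pval (MvPolynomial.pderiv 0 p)
  have h1 := continuous_pval (MvPolynomial.pderiv 1 p)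
  fun_prop

theorem edgeIntegral_add (a b : Pt) {g h : Pt → ℝ} (hg : Continuous g) (hh : Continuous h) :
    edgeIntegral a b (fun x => g x + h x) = edgeIntegral a b g + edgeIntegral a b h := by
  unfold edgeIntegral
  rw [intervalIntegral.integral_add, mul_add]
  · exact (hg.comp (by fun_prop)).intervalIntegrable _ _
  · exact (hh.comp (by fun_prop)).intervalIntegrable _ _

theorem edgeIntegral_smul (a b : Pt) (c : ℝ) (g : Pt → ℝ) :
    edgeIntegral a b (fun x => c * g x) = c * edgeIntegral a b g := by
  unfold edgeIntegral
  rw [intervalIntegral.integral_const_mul]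
  ring

/-- The moment `∫ₑ (∂p/∂nₑ) q ds` over the edge from `a` to `b`. -/
def normalMoment (a b : Pt) (q p : MvPolynomial (Fin 2) ℝ) : ℝ :=
  edgeIntegral a b (fun x => normalDeriv a b p x * pval q x)

/-- The moment `|e|⁻¹ ∫ₑ p q ds` over the edge from `a` to `b`. -/
def valueMoment (a b : Pt) (q p : MvPolynomial (Fin 2) ℝ) : ℝ :=
  ‖b - a‖⁻¹ * edgeIntegral a b (fun x => pval p x * pval q x)

theorem pval_add (p q : MvPolynomial (Fin 2) ℝ) (x : Pt) :
    pval (p + q) x = pval p x + pval q x := by simp [pval]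

theorem pderiv_smul' (i : Fin 2) (c : ℝ) (p : MvPolynomial (Fin 2) ℝ) :
    MvPolynomial.pderiv i (c • p) = c • MvPolynomial.pderiv i p :=
  (MvPolynomial.pderiv i).map_smul c p

theorem pval_smul (c : ℝ) (p : MvPolynomial (Fin 2) ℝ) (x : Pt) :
    pval (c • p) x = c * pval p x := by simp [pval]

theorem normalMoment_add (a b : Pt) (q p p' : MvPolynomial (Fin 2) ℝ) :
    normalMoment a b q (p + p') = normalMoment a b q p + normalMoment a b q p' := by
  unfold normalMoment
  refine Eq.trans ?_ (edgeIntegral_add a b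
    ((continuous_normalDeriv a b p).mul (continuous_pval q))
    ((continuous_normalDeriv a b p').mul (continuous_pval q)))
  congr 1
  funext x
  simp only [normalDeriv, map_add, pval_add]
  ring

theorem normalMoment_smul (a b : Pt) (c : ℝ) (q p : MvPolynomial (Fin 2) ℝ) :
    normalMoment a b q (c • p) = c * normalMoment a b q p := by
  unfold normalMoment
  rw [← edgeIntegral_smul]
  congr 1
  funext x
  simp only [normalDeriv, pderiv_smul', pval_smul]
  ring

theorem valueMoment_add (a b : Pt) (q p p' : MvPolynomial (Fin 2) ℝ) :
    valueMoment a b q (p + p') = valueMoment a b q p + valueMoment a b q p' := by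
  unfold valueMoment
  rw [← mul_add]
  congr 1
  refine Eq.trans ?_ (edgeIntegral_add a b ((continuous_pval p).mul (continuous_pval q))
    ((continuous_pval p').mul (continuous_pval q)))
  congr 1
  funext x
  simp only [pval_add]
  ring

theorem valueMoment_smul (a b : Pt) (c : ℝ) (q p : MvPolynomial (Fin 2) ℝ) :
    valueMoment a b q (c • p) = c * valueMoment a b q p := by
  unfold valueMoment
  rw [mul_left_comm]
  congr 1
  rw [← edgeIntegral_smul]
  congr 1
  funext x
  simp only [pval_smul]
  ring

namespace QuadMesh

variable {ι : Type*} (M : QuadMesh ι)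

/-- The domain `Ω` partitioned by the mesh: the interior of the union of the closed cells. -/
def domain : Set Pt := interior (⋃ Q, quad (M.vert Q))

/-- The open quadrilateral `Q`. -/
def cell (Q : ι) : Set Pt := interior (quad (M.vert Q))

/-- The open triangle of the criss-cross split of `Q` that lies on the `j`-th edge. -/
def tri (Q : ι) (j : Fin 4) : Set Pt :=
  interior (convexHull ℝ {M.vert Q j, M.vert Q (j + 1), quadCenter (M.vert Q)})

theorem cell_subset_domain (Q : ι) : M.cell Q ⊆ M.domain :=
  interior_mono (Set.subset_iUnion (fun Q => quad (M.vert Q)) Q)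

theorem ae_cell (Q : ι) {f g : Pt → ℝ} (h : f =ᵐ[volume.restrict M.domain] g) :
    f =ᵐ[volume.restrict (M.cell Q)] g :=
  ae_restrict_of_ae_restrict_of_subset (M.cell_subset_domain Q) h

/-- A choice of one polynomial for each triangle of the mesh. -/
abbrev PolyFamily (ι : Type*) := ι → Fin 4 → MvPolynomial (Fin 2) ℝ

/-- `f` coincides on every triangle with the polynomial `p`, whose degree there is at most `m`. -/
def IsPiecewise (m : ℕ) (f : Pt → ℝ) (p : PolyFamily ι) : Prop :=
  ∀ Q j, (p Q j).totalDegree ≤ m ∧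
    ∀ᵐ x ∂(volume.restrict M.domain), x ∈ M.tri Q j → f x = pval (p Q j) x

theorem IsPiecewise.add {m : ℕ} {f g : L2 M.domain} {p q : PolyFamily ι}
    (hf : M.IsPiecewise m f p) (hg : M.IsPiecewise m g q) :
    M.IsPiecewise m (f + g : L2 M.domain) (p + q) := by
  intro Q j
  refine ⟨(MvPolynomial.totalDegree_add _ _).trans (max_le (hf Q j).1 (hg Q j).1), ?_⟩
  filter_upwards [(hf Q j).2, (hg Q j).2, Lp.coeFn_add f g] with x h1 h2 h3 hx
  rw [h3, Pi.add_apply, h1 hx, h2 hx]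
  exact (pval_add _ _ _).symm

theorem IsPiecewise.smul {m : ℕ} {f : L2 M.domain} {p : PolyFamily ι} (c : ℝ)
    (hf : M.IsPiecewise m f p) : M.IsPiecewise m (c • f : L2 M.domain) (c • p) := by
  intro Q j
  refine ⟨(MvPolynomial.totalDegree_smul_le _ _).trans (hf Q j).1, ?_⟩
  filter_upwards [(hf Q j).2, Lp.coeFn_smul c f] with x h1 h3 hx
  rw [h3, Pi.smul_apply, h1 hx]
  exact (pval_smul _ _ _).symm

theorem IsPiecewise.zero {m : ℕ} : M.IsPiecewise m (0 : L2 M.domain) (0 : PolyFamily ι) := by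
  intro Q j
  refine ⟨by simp, ?_⟩
  filter_upwards [Lp.coeFn_zero ℝ 2 (volume.restrict M.domain)] with x h _
  rw [h]
  simp [pval]

/-- The degrees of freedom attached to common vertices and edges of the cells are single valued:
at each vertex the value and both first partial derivatives; on each edge `e` the moments of the
normal derivative against `P_{k-2}(e)` and of the value against `P_{k-3}(e)` (no condition for
`k = 2`). On the cell `Q` the vertex `vert Q j` and the `j`-th edge belong to the closure of
`tri Q j`, so the functionals are evaluated on the polynomial given there. -/
def SingleValuedDOFs (k : ℕ) (p : PolyFamily ι) : Prop :=
  (∀ Q Q' j j', M.vert Q j = M.vert Q' j' →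
    pval (p Q j) (M.vert Q j) = pval (p Q' j') (M.vert Q j) ∧
    ∀ i, pval (MvPolynomial.pderiv i (p Q j)) (M.vert Q j)
      = pval (MvPolynomial.pderiv i (p Q' j')) (M.vert Q j)) ∧
  (∀ Q Q' j j', quadEdge (M.vert Q) j = quadEdge (M.vert Q') j' →
    (∀ q : MvPolynomial (Fin 2) ℝ, q.totalDegree + 2 ≤ k →
      normalMoment (M.vert Q j) (M.vert Q (j + 1)) q (p Q j)
        = normalMoment (M.vert Q j) (M.vert Q (j + 1)) q (p Q' j')) ∧
    (∀ q : MvPolynomial (Fin 2) ℝ, q.totalDegree + 3 ≤ k →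
      valueMoment (M.vert Q j) (M.vert Q (j + 1)) q (p Q j)
        = valueMoment (M.vert Q j) (M.vert Q (j + 1)) q (p Q' j')))

/-- The space `Σ_h^{k+1}`: functions whose restriction to every cell `Q` lies in
`Σ_h^{k+1}(Q) = {u ∈ H²(Q) : u|_T ∈ P_{k+1}(T)}`, glued together by the degrees of freedom. -/
def sigmaSpace (k : ℕ) : Submodule ℝ (L2 M.domain) where
  carrier := {f | (∀ Q, MemH2 (M.cell Q) f) ∧
    ∃ p : PolyFamily ι, M.IsPiecewise (k + 1) f p ∧ M.SingleValuedDOFs k p}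
  zero_mem' := by
    refine ⟨fun Q => MemH2.zero.congr ?_, 0, IsPiecewise.zero M, ?_, ?_⟩
    · exact M.ae_cell Q (Lp.coeFn_zero ℝ 2 (volume.restrict M.domain)).symm
    · intros; simp
    · intros; simp
  add_mem' := by
    rintro f g ⟨hf, p, hp, hp1, hp2⟩ ⟨hg, q, hq, hq1, hq2⟩
    refine ⟨fun Q => ((hf Q).add (hg Q)).congr ?_, p + q, hp.add M hq, ?_, ?_⟩
    · exact M.ae_cell Q (Lp.coeFn_add f g).symm
    · intro Q Q' j j' h
      simp only [Pi.add_apply, map_add, pval_add]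
      exact ⟨by rw [(hp1 Q Q' j j' h).1, (hq1 Q Q' j j' h).1],
        fun i => by rw [(hp1 Q Q' j j' h).2 i, (hq1 Q Q' j j' h).2 i]⟩
    · intro Q Q' j j' h
      simp only [Pi.add_apply, normalMoment_add, valueMoment_add]
      exact ⟨fun r hr => by rw [(hp2 Q Q' j j' h).1 r hr, (hq2 Q Q' j j' h).1 r hr],
        fun r hr => by rw [(hp2 Q Q' j j' h).2 r hr, (hq2 Q Q' j j' h).2 r hr]⟩
  smul_mem' := by
    rintro c f ⟨hf, p, hp, hp1, hp2⟩
    refine ⟨fun Q => ((hf Q).smul c).congr ?_, c • p, hp.smul M c, ?_, ?_⟩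
    · exact M.ae_cell Q (Lp.coeFn_smul c f).symm
    · intro Q Q' j j' h
      simp only [Pi.smul_apply, pderiv_smul', pval_smul]
      exact ⟨by rw [(hp1 Q Q' j j' h).1], fun i => by rw [(hp1 Q Q' j j' h).2 i]⟩
    · intro Q Q' j j' h
      simp only [Pi.smul_apply, normalMoment_smul, valueMoment_smul]
      exact ⟨fun r hr => by rw [(hp2 Q Q' j j' h).1 r hr],
        fun r hr => by rw [(hp2 Q Q' j j' h).2 r hr]⟩

/-- The scalar space `{f ∈ H¹(Ω) : f|_T ∈ P_k(T)}`. -/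
def lagrangeSpace (k : ℕ) : Submodule ℝ (L2 M.domain) where
  carrier := {f | MemH1 M.domain f ∧ ∃ p : PolyFamily ι, M.IsPiecewise k f p}
  zero_mem' := ⟨MemH1.zero.congr (Lp.coeFn_zero ℝ 2 (volume.restrict M.domain)).symm,
    0, IsPiecewise.zero M⟩
  add_mem' := by
    rintro f g ⟨hf, p, hp⟩ ⟨hg, q, hq⟩
    exact ⟨(hf.add hg).congr (Lp.coeFn_add f g).symm, p + q, hp.add M hq⟩
  smul_mem' := by
    rintro c f ⟨hf, p, hp⟩
    exact ⟨(hf.smul c).congr (Lp.coeFn_smul c f).symm, c • p, hp.smul M c⟩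

/-- The vector space `V_h^k = {u ∈ H¹(Ω)² : u|_T ∈ P_k(T)²}`. -/
def velocitySpace (k : ℕ) : Submodule ℝ (L2 M.domain × L2 M.domain) :=
  (M.lagrangeSpace k).prod (M.lagrangeSpace k)

/-- The space `W_h^{k-1} = div V_h^k`. -/
def divSpace (k : ℕ) : Submodule ℝ (L2 M.domain) where
  carrier := {w | ∃ u ∈ M.velocitySpace k, IsDiv u w}
  zero_mem' := by
    have z := Lp.coeFn_zero ℝ 2 (volume.restrict M.domain)
    exact ⟨0, Submodule.zero_mem _, 0, 0, IsWeakPartial.zero.congr z.symm z.symm,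
      IsWeakPartial.zero.congr z.symm z.symm, by simp⟩
  add_mem' := by
    rintro w w' ⟨u, hu, a, b, ha, hb, rfl⟩ ⟨u', hu', a', b', ha', hb', rfl⟩
    refine ⟨u + u', Submodule.add_mem _ hu hu', a + a', b + b', ?_, ?_, by abel⟩
    · exact (ha.add ha' (Lp.memLp _) (Lp.memLp _) (Lp.memLp _) (Lp.memLp _)).congr
        (Lp.coeFn_add _ _).symm (Lp.coeFn_add _ _).symm
    · exact (hb.add hb' (Lp.memLp _) (Lp.memLp _) (Lp.memLp _) (Lp.memLp _)).congr
        (Lp.coeFn_add _ _).symm (Lp.coeFn_add _ _).symm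
  smul_mem' := by
    rintro c w ⟨u, hu, a, b, ha, hb, rfl⟩
    refine ⟨c • u, Submodule.smul_mem _ c hu, c • a, c • b, ?_, ?_, by simp⟩
    · exact (ha.smul c).congr (Lp.coeFn_smul _ _).symm (Lp.coeFn_smul _ _).symm
    · exact (hb.smul c).congr (Lp.coeFn_smul _ _).symm (Lp.coeFn_smul _ _).symm

end QuadMesh

end CrissCross

end

noncomputable section

namespace CrissCross

/-! ### Polynomials as functions on the plane -/

/-! A piecewise polynomial function lies in `H¹(Ω)` exactly when the polynomials on the two sides of
every interface (a portion of a half diagonal or of a common edge) agree along it; this is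
`Matched`. If they agree, the gradient taken piece by piece is the weak gradient
(`Matched.isWeakPartial`): the divergence theorem on a half plane treats the interfaces, and the
finitely many nodes are removable because points have zero capacity in the plane. Conversely, a jump
is incompatible with a weak gradient in `L²` (`IsTwoSided.no_jump`).

That `curl` maps `Σ` into `V` means that functions in `Σ` are globally `C¹`: they and their
gradients match everywhere (`matched_of_mem_sigmaSpace`). Across the diagonals of a cell this is the
`H²` condition. Across a common edge, let `d` be the difference of the two polynomials. On the edge
`d` has degree at most `k+1` and satisfies four Hermite conditions and `k-2` moment conditions,
while its normal derivative has degree at most `k` and satisfies two endpoint conditions and `k-1`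
moment conditions. Both counts equal the dimension of the polynomial space, and the conditions are
unisolvent (`edge_dofs_unisolvent`). Then `div curl = 0` because second derivatives of polynomials
commute, and `curl φ = 0` forces `φ` to be constant by mollification and connectedness of `Ω`.

Conversely, let `u` in `V` have zero divergence. On each triangle `(-u₂, u₁)` is a closed polynomial
field and has a polynomial primitive of degree at most `k+1`, unique up to a constant. The jumps of
the primitives are constant along interfaces, and the additive constants that remove all jumps exist
because a locally constant cocycle on a simply connected space is a coboundary (`exists_coboundary`,
`exists_matched_add_const`). The resulting potential matches together with its gradient. Its edge
functionals are then single valued at once. At a vertex the Lipschitz condition is needed: it makes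
the triangles around a boundary vertex communicate through `Ω`
(`HasLipschitzBoundary.exists_isPreconnected`, `Matched.eq_at_vertex`).

Surjectivity of `div` holds by the definition of `W` as its image. -/

theorem pval_C (c : ℝ) (x : Pt) : pval (MvPolynomial.C c) x = c := by simp [pval]

theorem pval_zero (x : Pt) : pval 0 x = 0 := by simp [pval]

theorem pval_sub (p q : MvPolynomial (Fin 2) ℝ) (x : Pt) :
    pval (p - q) x = pval p x - pval q x := by simp [pval]

theorem pval_mul (p q : MvPolynomial (Fin 2) ℝ) (x : Pt) :
    pval (p * q) x = pval p x * pval q x := by simp [pval]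

theorem pval_X (i : Fin 2) (x : Pt) : pval (MvPolynomial.X i) x = x i := by simp [pval]

theorem hasFDerivAt_pval (p : MvPolynomial (Fin 2) ℝ) (x : Pt) :
    HasFDerivAt (pval p)
      (pval (MvPolynomial.pderiv 0 p) x • (EuclideanSpace.proj 0 : Pt →L[ℝ] ℝ) +
        pval (MvPolynomial.pderiv 1 p) x • (EuclideanSpace.proj 1 : Pt →L[ℝ] ℝ)) x := by
  induction p using MvPolynomial.induction_on with
  | C a =>
    have : pval (MvPolynomial.C a) = fun _ : Pt => a := funext (pval_C a)
    rw [this]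
    simpa [pval_zero] using hasFDerivAt_const a x
  | add p q hp hq =>
    have : pval (p + q) = pval p + pval q := funext (pval_add p q)
    rw [this]
    refine (hp.add hq).congr_fderiv ?_
    simp only [map_add, pval_add]
    module
  | mul_X p n hp =>
    have : pval (p * MvPolynomial.X n) = pval p * fun x : Pt => x n := by
      funext y
      simp [pval_mul, pval_X]
    rw [this]
    have hX : HasFDerivAt (fun x : Pt => x n) (EuclideanSpace.proj n : Pt →L[ℝ] ℝ) x :=
      (EuclideanSpace.proj n : Pt →L[ℝ] ℝ).hasFDerivAt
    refine (hp.mul hX).congr_fderiv ?_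
    fin_cases n <;>
    · ext v
      simp [MvPolynomial.pderiv_X, pval]
      ring

theorem contDiff_pval (p : MvPolynomial (Fin 2) ℝ) {n : WithTop ℕ∞} : ContDiff ℝ n (pval p) := by
  induction p using MvPolynomial.induction_on with
  | C a =>
    have : pval (MvPolynomial.C a) = fun _ : Pt => a := funext (pval_C a)
    rw [this]
    exact contDiff_const
  | add p q hp hq =>
    have : pval (p + q) = pval p + pval q := funext (pval_add p q)
    rw [this]
    exact hp.add hq
  | mul_X p i hp =>
    have : pval (p * MvPolynomial.X i) = pval p * fun x : Pt => x i := by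
      funext y
      simp [pval_mul, pval_X]
    rw [this]
    exact hp.mul (EuclideanSpace.proj i : Pt →L[ℝ] ℝ).contDiff

theorem fderiv_pval (p : MvPolynomial (Fin 2) ℝ) (x : Pt) (i : Fin 2) :
    fderiv ℝ (pval p) x (EuclideanSpace.single i 1) = pval (MvPolynomial.pderiv i p) x := by
  rw [(hasFDerivAt_pval p x).fderiv]
  fin_cases i <;> simp

theorem totalDegree_pderiv_le {m : ℕ} {p : MvPolynomial (Fin 2) ℝ} (hp : p.totalDegree ≤ m + 1)
    (i : Fin 2) : (MvPolynomial.pderiv i p).totalDegree ≤ m := by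
  refine Finset.sup_le fun s hs => ?_
  rw [MvPolynomial.mem_support_iff, MvPolynomial.coeff_pderiv] at hs
  have := (MvPolynomial.le_totalDegree
    (MvPolynomial.mem_support_iff.2 (left_ne_zero_of_mul hs))).trans hp
  simp only [Finsupp.sum_fintype, Fin.sum_univ_two, implies_true, Finsupp.add_apply] at this ⊢
  fin_cases i <;> simp at this <;> omega

/-- An open set contains a product of intervals, and a polynomial vanishing on a product of infinite
sets is zero. -/
theorem eq_zero_of_pval_eq_zero {U : Set Pt} (hU : IsOpen U) (hne : U.Nonempty)
    {p : MvPolynomial (Fin 2) ℝ} (h : ∀ x ∈ U, pval p x = 0) : p = 0 := by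
  obtain ⟨x, hx⟩ := hne
  have hU' : IsOpen ((WithLp.toLp 2 : (Fin 2 → ℝ) → Pt) ⁻¹' U) :=
    hU.preimage (PiLp.continuous_toLp 2 _)
  obtain ⟨ε, hε, hb⟩ := Metric.isOpen_iff.1 hU' (WithLp.ofLp x) (by simpa using hx)
  refine MvPolynomial.funext_set (fun i => Metric.ball (x i) ε)
    (fun i => by rw [Real.ball_eq_Ioo]; exact Set.Ioo_infinite (by linarith)) fun y hy => ?_
  have : y ∈ Metric.ball (WithLp.ofLp x) ε := by
    rw [Metric.mem_ball, dist_pi_lt_iff hε]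
    exact fun i => hy i (Set.mem_univ i)
  simpa [pval] using h _ (hb this)

theorem eq_of_pval_ae_eq {U : Set Pt} (hU : IsOpen U) (hne : U.Nonempty)
    {p q : MvPolynomial (Fin 2) ℝ} (h : pval p =ᵐ[volume.restrict U] pval q) : p = q := by
  have := Measure.eqOn_open_of_ae_eq h hU (continuous_pval p).continuousOn
    (continuous_pval q).continuousOn
  refine sub_eq_zero.1 (eq_zero_of_pval_eq_zero hU hne fun x hx => ?_)
  rw [pval_sub, this hx, sub_self]

/-! ### Restriction of a polynomial to a line -/

/-- The polynomial `t ↦ p (a + t (b - a))`. -/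
def lineRestr (a b : Pt) (p : MvPolynomial (Fin 2) ℝ) : Polynomial ℝ :=
  MvPolynomial.aeval (fun i => Polynomial.C (a i) + Polynomial.C ((b - a) i) * Polynomial.X) p

theorem eval_lineRestr (a b : Pt) (p : MvPolynomial (Fin 2) ℝ) (t : ℝ) :
    (lineRestr a b p).eval t = pval p (a + t • (b - a)) := by
  rw [lineRestr, pval, ← Polynomial.coe_evalRingHom, MvPolynomial.aeval_def,
    MvPolynomial.hom_eval₂, ← MvPolynomial.eval₂_id]
  congr 1
  · ext; simp
  · ext i; simp; ring

theorem natDegree_lineRestr_le (a b : Pt) {p : MvPolynomial (Fin 2) ℝ} {m : ℕ}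
    (hp : p.totalDegree ≤ m) : (lineRestr a b p).natDegree ≤ m := by
  have := MvPolynomial.aeval_natDegree_le (n := 1) p hp
    (fun i => Polynomial.C (a i) + Polynomial.C ((b - a) i) * Polynomial.X) fun i => by
      compute_degree
  simpa [lineRestr] using this

theorem hasDerivAt_pval_line (a b : Pt) (p : MvPolynomial (Fin 2) ℝ) (t : ℝ) :
    HasDerivAt (fun t : ℝ => pval p (a + t • (b - a)))
      ((b - a) 0 * pval (MvPolynomial.pderiv 0 p) (a + t • (b - a))
        + (b - a) 1 * pval (MvPolynomial.pderiv 1 p) (a + t • (b - a))) t := by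
  have h1 : HasDerivAt (fun t : ℝ => a + t • (b - a)) (b - a) t := by
    simpa using ((hasDerivAt_id t).smul_const (b - a)).const_add a
  refine ((hasFDerivAt_pval p (a + t • (b - a))).comp_hasDerivAt t h1).congr_deriv ?_
  change _ * (b - a) 0 + _ * (b - a) 1 = _
  ring

theorem derivative_lineRestr (a b : Pt) (p : MvPolynomial (Fin 2) ℝ) :
    (lineRestr a b p).derivative
      = Polynomial.C ((b - a) 0) * lineRestr a b (MvPolynomial.pderiv 0 p)
        + Polynomial.C ((b - a) 1) * lineRestr a b (MvPolynomial.pderiv 1 p) := by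
  refine Polynomial.funext fun t => ?_
  have h1 := (lineRestr a b p).hasDerivAt t
  have h2 := hasDerivAt_pval_line a b p t
  simp only [← eval_lineRestr] at h2
  simpa using h1.unique h2

/-! ### Primitives of closed polynomial fields -/

/-- The linear map dividing the coefficient of each monomial `m` by `|m| + s`. -/
def degDiv (s : ℕ) : MvPolynomial (Fin 2) ℝ →ₗ[ℝ] MvPolynomial (Fin 2) ℝ :=
  (MvPolynomial.basisMonomials (Fin 2) ℝ).constr ℝ
    fun m => MvPolynomial.monomial m ((m 0 + m 1 + s : ℝ)⁻¹)

theorem degDiv_monomial (s : ℕ) (m : Fin 2 →₀ ℕ) (c : ℝ) :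
    degDiv s (MvPolynomial.monomial m c)
      = MvPolynomial.monomial m (c * (m 0 + m 1 + s : ℝ)⁻¹) := by
  have : MvPolynomial.monomial m c = c • MvPolynomial.basisMonomials (Fin 2) ℝ m := by
    simp [MvPolynomial.smul_monomial]
  rw [this, map_smul, degDiv, Module.Basis.constr_basis, MvPolynomial.smul_monomial, smul_eq_mul]

theorem coeff_degDiv (s : ℕ) (m : Fin 2 →₀ ℕ) (p : MvPolynomial (Fin 2) ℝ) :
    (degDiv s p).coeff m = p.coeff m * (m 0 + m 1 + s : ℝ)⁻¹ := by
  induction p using MvPolynomial.induction_on' with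
  | monomial u a =>
    rw [degDiv_monomial, MvPolynomial.coeff_monomial, MvPolynomial.coeff_monomial]
    split_ifs with h
    · rw [h]
    · simp
  | add p q hp hq => rw [map_add, MvPolynomial.coeff_add, hp, hq, MvPolynomial.coeff_add]; ring

/-- Differentiation lowers the degree of a monomial by one, so the same divisor is reached with a
shift larger by one. -/
theorem pderiv_degDiv (s : ℕ) (i : Fin 2) (p : MvPolynomial (Fin 2) ℝ) :
    MvPolynomial.pderiv i (degDiv s p) = degDiv (s + 1) (MvPolynomial.pderiv i p) := by
  ext m
  rw [MvPolynomial.coeff_pderiv, coeff_degDiv, coeff_degDiv, MvPolynomial.coeff_pderiv]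
  have : ((m + fun₀ | i => 1) 0 + (m + fun₀ | i => 1) 1 + s : ℝ) = m 0 + m 1 + (s + 1 : ℕ) := by
    fin_cases i <;> simp <;> ring
  rw [← this]
  push_cast
  ring

theorem totalDegree_degDiv_le (s : ℕ) (p : MvPolynomial (Fin 2) ℝ) :
    (degDiv s p).totalDegree ≤ p.totalDegree := by
  refine Finset.sup_le fun m hm => ?_
  rw [MvPolynomial.mem_support_iff, coeff_degDiv] at hm
  exact MvPolynomial.le_totalDegree (MvPolynomial.mem_support_iff.2 (left_ne_zero_of_mul hm))

/-- Here `degDiv 1 p` is `x ↦ ∫₀¹ p(tx) dt`. On a monomial of degree `n`, Euler's operator `1 + x·∇`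
multiplies by `n + 1` and undoes the division. -/
theorem euler_degDiv (p : MvPolynomial (Fin 2) ℝ) :
    degDiv 1 p + MvPolynomial.X 0 * MvPolynomial.pderiv 0 (degDiv 1 p)
      + MvPolynomial.X 1 * MvPolynomial.pderiv 1 (degDiv 1 p) = p := by
  induction p using MvPolynomial.induction_on' with
  | monomial u a =>
    rw [degDiv_monomial, MvPolynomial.X_mul_pderiv_monomial, MvPolynomial.X_mul_pderiv_monomial,
      MvPolynomial.smul_monomial, MvPolynomial.smul_monomial, ← map_add, ← map_add]
    congr 1
    have : (u 0 + u 1 + (1 : ℕ) : ℝ) ≠ 0 := by positivity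
    simp only [nsmul_eq_mul]
    push_cast at this ⊢
    field_simp
    ring
  | add p q hp hq =>
    simp only [map_add]
    linear_combination hp + hq

/-- Poincaré's lemma with the cone from the origin: the primitive is `∫₀¹ x·w(tx) dt`. Closedness
turns its gradient into the expression of `euler_degDiv`. -/
theorem exists_primitive {m : ℕ} {w₀ w₁ : MvPolynomial (Fin 2) ℝ} (h₀ : w₀.totalDegree ≤ m)
    (h₁ : w₁.totalDegree ≤ m) (h : MvPolynomial.pderiv 1 w₀ = MvPolynomial.pderiv 0 w₁) :
    ∃ P : MvPolynomial (Fin 2) ℝ, P.totalDegree ≤ m + 1 ∧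
      MvPolynomial.pderiv 0 P = w₀ ∧ MvPolynomial.pderiv 1 P = w₁ := by
  have hc : MvPolynomial.pderiv 1 (degDiv 1 w₀) = MvPolynomial.pderiv 0 (degDiv 1 w₁) := by
    rw [pderiv_degDiv, pderiv_degDiv, h]
  have hd : ∀ (i : Fin 2) (w : MvPolynomial (Fin 2) ℝ), w.totalDegree ≤ m →
      (MvPolynomial.X i * degDiv 1 w).totalDegree ≤ m + 1 := fun i w hw => by
    refine (MvPolynomial.totalDegree_mul _ _).trans ?_
    have := totalDegree_degDiv_le 1 w
    rw [MvPolynomial.totalDegree_X]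
    omega
  refine ⟨MvPolynomial.X 0 * degDiv 1 w₀ + MvPolynomial.X 1 * degDiv 1 w₁,
    (MvPolynomial.totalDegree_add _ _).trans (max_le (hd 0 w₀ h₀) (hd 1 w₁ h₁)), ?_, ?_⟩
  · nth_rewrite 2 [← euler_degDiv w₀]
    rw [hc]
    simp [MvPolynomial.pderiv_X]
    ring
  · nth_rewrite 2 [← euler_degDiv w₁]
    rw [← hc]
    simp [MvPolynomial.pderiv_X]
    ring

/-! ### Unisolvence of the degrees of freedom on an edge -/

theorem polynomial_eq_of_natDegree_le_four {f : Polynomial ℝ} (hf : f.natDegree ≤ 4) :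
    f = Polynomial.C (f.coeff 0) + Polynomial.C (f.coeff 1) * Polynomial.X
      + Polynomial.C (f.coeff 2) * Polynomial.X ^ 2 + Polynomial.C (f.coeff 3) * Polynomial.X ^ 3
      + Polynomial.C (f.coeff 4) * Polynomial.X ^ 4 := by
  nth_rewrite 1 [f.as_sum_range_C_mul_X_pow' (n := 5) (by omega)]
  simp [Finset.sum_range_succ]

theorem integral_eval_of_natDegree_le_four {f : Polynomial ℝ} (hf : f.natDegree ≤ 4) :
    ∫ t in (0 : ℝ)..1, f.eval t
      = f.coeff 0 + f.coeff 1 / 2 + f.coeff 2 / 3 + f.coeff 3 / 4 + f.coeff 4 / 5 := by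
  have h : ∀ t, HasDerivAt (fun t : ℝ => f.coeff 0 * t + f.coeff 1 / 2 * t ^ 2
      + f.coeff 2 / 3 * t ^ 3 + f.coeff 3 / 4 * t ^ 4 + f.coeff 4 / 5 * t ^ 5) (f.eval t) t := by
    intro t
    have hp : ∀ n : ℕ, HasDerivAt (fun t : ℝ => t ^ n) (n * t ^ (n - 1)) t :=
      fun n => hasDerivAt_pow n t
    refine ((((((hasDerivAt_id t).const_mul (f.coeff 0)).add ((hp 2).const_mul _)).add
      ((hp 3).const_mul _)).add ((hp 4).const_mul _)).add ((hp 5).const_mul _)).congr_deriv ?_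
    symm
    conv_lhs => rw [polynomial_eq_of_natDegree_le_four hf]
    simp
    ring
  rw [intervalIntegral.integral_eq_sub_of_hasDerivAt (fun t _ => h t)
    (f.continuous.intervalIntegrable _ _)]
  ring

theorem coeff_eq_zero_of_natDegree_le {f : Polynomial ℝ} {m n : ℕ} (hf : f.natDegree ≤ m)
    (h : m < n) : f.coeff n = 0 := Polynomial.coeff_eq_zero_of_natDegree_lt (hf.trans_lt h)

/-- The four Hermite conditions leave only multiples of `t²(1-t)²`, which is excluded by the degree
for `k = 2` and by its positive mean for `k = 3`. The proof solves the linear system for the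
coefficients. -/
theorem hermite_eq_zero {k : ℕ} (hk : k = 2 ∨ k = 3) {f : Polynomial ℝ}
    (hf : f.natDegree ≤ k + 1) (h0 : f.eval 0 = 0) (h1 : f.eval 1 = 0)
    (h0' : f.derivative.eval 0 = 0) (h1' : f.derivative.eval 1 = 0)
    (hi : k = 3 → ∫ t in (0 : ℝ)..1, f.eval t = 0) : f = 0 := by
  have h4 : f.natDegree ≤ 4 := by omega
  have hc4 : k = 2 → f.coeff 4 = 0 := fun h => coeff_eq_zero_of_natDegree_le hf (by omega)
  have e := polynomial_eq_of_natDegree_le_four h4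
  rw [integral_eval_of_natDegree_le_four h4] at hi
  rw [e] at h0 h1 h0' h1'
  simp at h0 h1 h0' h1'
  rw [e]
  have : f.coeff 4 = 0 := by
    rcases hk with hk | hk
    · exact hc4 hk
    · have := hi hk
      linarith
  have h3 : f.coeff 3 = 0 := by linarith
  have h2 : f.coeff 2 = 0 := by linarith
  simp [h0, h0', h2, h3, this]

/-- Such an `f` is `t(1-t)g` with `g` of degree at most `k-2`, and it is orthogonal to all
polynomials of that degree, in particular to `g`. -/
theorem moments_eq_zero {k : ℕ} (hk : k = 2 ∨ k = 3) {f : Polynomial ℝ}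
    (hf : f.natDegree ≤ k) (h0 : f.eval 0 = 0) (h1 : f.eval 1 = 0)
    (hi : ∫ t in (0 : ℝ)..1, f.eval t = 0)
    (hi' : k = 3 → ∫ t in (0 : ℝ)..1, f.eval t * t = 0) : f = 0 := by
  have h4 : f.natDegree ≤ 4 := by omega
  have hX : (f * Polynomial.X).natDegree ≤ 4 := by
    refine Polynomial.natDegree_mul_le.trans ?_
    simp
    omega
  have hc3 : k = 2 → f.coeff 3 = 0 := fun h => coeff_eq_zero_of_natDegree_le hf (by omega)
  have hc4 : f.coeff 4 = 0 := coeff_eq_zero_of_natDegree_le hf (by omega)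
  have hx := integral_eval_of_natDegree_le_four hX
  simp [Polynomial.coeff_mul_X, -Polynomial.coeff_mul_X_pow] at hx
  rw [hx] at hi'
  have e := polynomial_eq_of_natDegree_le_four h4
  rw [integral_eval_of_natDegree_le_four h4] at hi
  rw [e] at h0 h1
  simp at h0 h1
  rw [e]
  have h3 : f.coeff 3 = 0 := by
    rcases hk with hk | hk
    · exact hc3 hk
    · have := hi' hk
      linarith
  have h2 : f.coeff 2 = 0 := by linarith
  have h1' : f.coeff 1 = 0 := by linarith
  simp [h0, h1', h2, h3, hc4]

theorem sq_norm_eq (v : Pt) : ‖v‖ ^ 2 = v 0 ^ 2 + v 1 ^ 2 := by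
  simp [EuclideanSpace.norm_sq_eq, Fin.sum_univ_two]

/-- Edge moments are tested with polynomials of the plane; this one provides the arc parameter
itself, as required for the first moment when `k = 3`. -/
theorem exists_linear_coordinate {a b : Pt} (hab : a ≠ b) :
    ∃ q : MvPolynomial (Fin 2) ℝ, q.totalDegree ≤ 1 ∧
      ∀ t : ℝ, pval q (a + t • (b - a)) = t := by
  have hn : (b - a) 0 ^ 2 + (b - a) 1 ^ 2 ≠ 0 := by
    rw [← sq_norm_eq]
    exact pow_ne_zero 2 (norm_ne_zero_iff.2 (sub_ne_zero.2 hab.symm))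
  refine ⟨((b - a) 0 ^ 2 + (b - a) 1 ^ 2)⁻¹ •
    (MvPolynomial.C ((b - a) 0) * (MvPolynomial.X 0 - MvPolynomial.C (a 0))
      + MvPolynomial.C ((b - a) 1) * (MvPolynomial.X 1 - MvPolynomial.C (a 1))), ?_, fun t => ?_⟩
  · have h : ∀ (i : Fin 2) (c d : ℝ), (MvPolynomial.C c * (MvPolynomial.X i -
        MvPolynomial.C d) : MvPolynomial (Fin 2) ℝ).totalDegree ≤ 1 := fun i c d => by
      refine (MvPolynomial.totalDegree_mul _ _).trans ?_
      rw [MvPolynomial.totalDegree_C, zero_add]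
      refine (MvPolynomial.totalDegree_sub _ _).trans ?_
      simp
    exact (MvPolynomial.totalDegree_smul_le _ _).trans
      ((MvPolynomial.totalDegree_add _ _).trans (max_le (h _ _ _) (h _ _ _)))
  · rw [pval_smul]
    simp only [pval_add, pval_mul, pval_sub, pval_C, pval_X, PiLp.add_apply, PiLp.smul_apply,
      smul_eq_mul]
    field_simp
    ring

/-- The trace of `d` on the edge dies by `hermite_eq_zero`, hence so does its tangential derivative;
the normal derivative dies by `moments_eq_zero`. Together they give the full gradient. The
conclusion holds for every real `t`, on the whole line. -/
theorem edge_dofs_unisolvent {k : ℕ} (hk : k = 2 ∨ k = 3) {a b : Pt} (hab : a ≠ b)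
    {d : MvPolynomial (Fin 2) ℝ} (hd : d.totalDegree ≤ k + 1) (ha : pval d a = 0)
    (hb : pval d b = 0) (ha' : ∀ i, pval (MvPolynomial.pderiv i d) a = 0)
    (hb' : ∀ i, pval (MvPolynomial.pderiv i d) b = 0)
    (hn : ∀ q : MvPolynomial (Fin 2) ℝ, q.totalDegree + 2 ≤ k → normalMoment a b q d = 0)
    (hv : ∀ q : MvPolynomial (Fin 2) ℝ, q.totalDegree + 3 ≤ k → valueMoment a b q d = 0)
    (t : ℝ) : pval d (a + t • (b - a)) = 0 ∧
      ∀ i, pval (MvPolynomial.pderiv i d) (a + t • (b - a)) = 0 := by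
  have hnorm : ‖b - a‖ ≠ 0 := norm_ne_zero_iff.2 (sub_ne_zero.2 hab.symm)
  have e1 : a + (1 : ℝ) • (b - a) = b := by simp
  have e0 : a + (0 : ℝ) • (b - a) = a := by simp
  have hf : lineRestr a b d = 0 := by
    refine hermite_eq_zero hk (natDegree_lineRestr_le a b hd) ?_ ?_ ?_ ?_ ?_
    · rw [eval_lineRestr, e0, ha]
    · rw [eval_lineRestr, e1, hb]
    · simp [derivative_lineRestr, eval_lineRestr, ha']
    · simp only [derivative_lineRestr, Polynomial.eval_add, Polynomial.eval_mul,
        Polynomial.eval_C, eval_lineRestr, e1, hb', mul_zero, add_zero]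
    · intro h3
      have := hv (MvPolynomial.C 1) (by simp [h3])
      simp only [valueMoment, edgeIntegral, pval_C, mul_one] at this
      rw [← mul_assoc, inv_mul_cancel₀ hnorm, one_mul] at this
      simpa only [eval_lineRestr] using this
  have hd' : ∀ i, (MvPolynomial.pderiv i d).totalDegree ≤ k := totalDegree_pderiv_le hd
  -- The normal derivative as a polynomial of the plane, so that its degree on the edge can be
  -- bounded.
  set N : MvPolynomial (Fin 2) ℝ := ((b - a) 1 / ‖b - a‖) • MvPolynomial.pderiv 0 d
    - ((b - a) 0 / ‖b - a‖) • MvPolynomial.pderiv 1 d with hN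
  have hNd : N.totalDegree ≤ k := (MvPolynomial.totalDegree_sub _ _).trans
    (max_le ((MvPolynomial.totalDegree_smul_le _ _).trans (hd' 0))
      ((MvPolynomial.totalDegree_smul_le _ _).trans (hd' 1)))
  have hNv : ∀ x, pval N x = normalDeriv a b d x := fun x => by
    rw [hN, pval_sub, pval_smul, pval_smul, normalDeriv]
  have hg : lineRestr a b N = 0 := by
    refine moments_eq_zero hk (natDegree_lineRestr_le a b hNd) ?_ ?_ ?_ ?_
    · rw [eval_lineRestr, e0, hNv, normalDeriv, ha', ha']; simp
    · rw [eval_lineRestr, e1, hNv, normalDeriv, hb', hb']; simp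
    · have := hn (MvPolynomial.C 1) (by rw [MvPolynomial.totalDegree_C]; omega)
      simp only [normalMoment, edgeIntegral, pval_C, mul_one] at this
      simpa only [eval_lineRestr, hNv] using (mul_eq_zero.1 this).resolve_left hnorm
    · intro h3
      obtain ⟨q, hq, hqt⟩ := exists_linear_coordinate hab
      have := hn q (by omega)
      simp only [normalMoment, edgeIntegral, hqt] at this
      simpa only [eval_lineRestr, hNv] using (mul_eq_zero.1 this).resolve_left hnorm
  have h1 := eval_lineRestr a b d t
  rw [hf, Polynomial.eval_zero] at h1
  refine ⟨h1.symm, ?_⟩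
  have h2 := eval_lineRestr a b N t
  rw [hg, Polynomial.eval_zero, hNv, normalDeriv] at h2
  have h3 := congrArg (Polynomial.eval t) (derivative_lineRestr a b d)
  simp only [hf, Polynomial.derivative_zero, Polynomial.eval_zero, Polynomial.eval_add,
    Polynomial.eval_mul, Polynomial.eval_C, eval_lineRestr] at h3
  have hs := sq_norm_eq (b - a)
  set x := pval (MvPolynomial.pderiv 0 d) (a + t • (b - a))
  set y := pval (MvPolynomial.pderiv 1 d) (a + t • (b - a))
  -- Normal component `h2'` and tangential component `h3` vanish; rotating back recovers both
  -- partial derivatives, up to the factor `‖b - a‖²`.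
  have h2' : (b - a) 1 * x - (b - a) 0 * y = 0 := by
    field_simp at h2
    linarith
  have hx : ‖b - a‖ ^ 2 * x = 0 := by
    rw [hs]
    linear_combination (b - a) 1 * h2' - (b - a) 0 * h3
  have hy : ‖b - a‖ ^ 2 * y = 0 := by
    rw [hs]
    linear_combination -(b - a) 0 * h2' - (b - a) 1 * h3
  intro i
  fin_cases i
  · exact (mul_eq_zero.1 hx).resolve_left (pow_ne_zero 2 hnorm)
  · exact (mul_eq_zero.1 hy).resolve_left (pow_ne_zero 2 hnorm)

/-! ### Weak partial derivatives -/

theorem setIntegral_mul_of_tsupport {U : Set Pt} (f : Pt → ℝ) {ψ : Pt → ℝ}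
    (h : tsupport ψ ⊆ U) : ∫ x in U, f x * ψ x = ∫ x, f x * ψ x :=
  setIntegral_eq_integral_of_forall_compl_eq_zero fun x hx => by
    rw [image_eq_zero_of_notMem_tsupport fun h' => hx (h h'), mul_zero]

theorem tsupport_partial (φ : Pt → ℝ) (i : Fin 2) :
    tsupport (fun x => fderiv ℝ φ x (EuclideanSpace.single i 1)) ⊆ tsupport φ :=
  (closure_mono fun x hx => by
    rw [Function.mem_support] at hx ⊢
    intro h
    exact hx (by rw [h]; rfl)).trans (tsupport_fderiv_subset ℝ)

theorem IsWeakPartial.mono {U V : Set Pt} {i : Fin 2} {f g : Pt → ℝ} (h : IsWeakPartial U i f g)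
    (hVU : V ⊆ U) : IsWeakPartial V i f g := by
  intro φ h1 h2 h3
  have := h φ h1 h2 (h3.trans hVU)
  have hd := (tsupport_partial φ i).trans h3
  rwa [setIntegral_mul_of_tsupport f (hd.trans hVU), setIntegral_mul_of_tsupport g (h3.trans hVU),
    ← setIntegral_mul_of_tsupport f hd, ← setIntegral_mul_of_tsupport g h3] at this

theorem integral_mul_partial {f φ : Pt → ℝ} (hf : ContDiff ℝ 1 f) (hφ : ContDiff ℝ 1 φ)
    (hc : HasCompactSupport φ) (v : Pt) :
    ∫ x, f x * fderiv ℝ φ x v = -∫ x, fderiv ℝ f x v * φ x := by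
  have cf : Continuous fun x => fderiv ℝ f x v :=
    (hf.continuous_fderiv one_ne_zero).clm_apply continuous_const
  have cφ : Continuous fun x => fderiv ℝ φ x v :=
    (hφ.continuous_fderiv one_ne_zero).clm_apply continuous_const
  have sφ : HasCompactSupport fun x => fderiv ℝ φ x v :=
    (hc.fderiv ℝ).comp_left (g := fun L : Pt →L[ℝ] ℝ => L v) rfl
  exact integral_mul_fderiv_eq_neg_fderiv_mul_of_integrable
    ((cf.mul hφ.continuous).integrable_of_hasCompactSupport hc.mul_left)
    ((hf.continuous.mul cφ).integrable_of_hasCompactSupport sφ.mul_left)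
    ((hf.continuous.mul hφ.continuous).integrable_of_hasCompactSupport hc.mul_left)
    (fun x _ => hf.differentiable one_ne_zero x) (fun x _ => hφ.differentiable one_ne_zero x)

theorem isWeakPartial_pval (U : Set Pt) (i : Fin 2) (p : MvPolynomial (Fin 2) ℝ) :
    IsWeakPartial U i (pval p) (pval (MvPolynomial.pderiv i p)) := by
  intro φ h1 h2 h3
  rw [setIntegral_mul_of_tsupport _ ((tsupport_partial φ i).trans h3),
    setIntegral_mul_of_tsupport _ h3,
    integral_mul_partial (contDiff_pval p) (h1.of_le (by exact_mod_cast le_top)) h2]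
  simp only [fderiv_pval]

theorem IsWeakPartial.unique {U : Set Pt} (hU : IsOpen U) {i : Fin 2} {f g g' : Pt → ℝ}
    (h : IsWeakPartial U i f g) (h' : IsWeakPartial U i f g')
    (hg : MemLp g 2 (volume.restrict U)) (hg' : MemLp g' 2 (volume.restrict U)) :
    g =ᵐ[volume.restrict U] g' := by
  have hl : LocallyIntegrableOn (g - g') U volume :=
    locallyIntegrableOn_of_locallyIntegrable_restrict
      ((hg.sub hg').locallyIntegrable (by norm_num))
  have := hU.ae_eq_zero_of_integral_contDiff_smul_eq_zero hl fun φ h1 h2 h3 => by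
    have e := h φ h1 h2 h3
    rw [h' φ h1 h2 h3, neg_inj] at e
    have i1 := integrable_mul_of_test hg h1.continuous h2
    have i2 := integrable_mul_of_test hg' h1.continuous h2
    have e3 : ∫ x in U, (g - g') x * φ x = 0 := by
      simp only [Pi.sub_apply, sub_mul]
      rw [integral_sub i1 i2, e, sub_self]
    rw [setIntegral_mul_of_tsupport _ h3] at e3
    simpa only [smul_eq_mul, mul_comm] using e3
  rw [Filter.EventuallyEq, ae_restrict_iff' hU.measurableSet]
  filter_upwards [this] with x hx hxU
  exact sub_eq_zero.1 (hx hxU)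

/-- A test function is split by a partition of unity subordinate to finitely many of the sets `W`
covering its compact support. -/
theorem IsWeakPartial.of_local {U : Set Pt} {i : Fin 2} {f g : Pt → ℝ}
    (hf : MemLp f 2 (volume.restrict U)) (hg : MemLp g 2 (volume.restrict U))
    (h : ∀ y ∈ U, ∃ W, IsOpen W ∧ y ∈ W ∧ IsWeakPartial W i f g) : IsWeakPartial U i f g := by
  intro φ h1 h2 h3
  choose! W hWo hyW hW using h
  obtain ⟨t, ht⟩ := h2.isCompact.elim_nhds_subcover' (fun y _ => W y)
    fun y hy => (hWo y (h3 hy)).mem_nhds (hyW y (h3 hy))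
  obtain ⟨ρ, hρ⟩ := SmoothPartitionOfUnity.exists_isSubordinate (modelWithCornersSelf ℝ Pt)
    (isClosed_tsupport φ) (fun y : t => W y.1) (fun y => hWo _ (h3 y.1.2)) (fun x hx => by
      obtain ⟨y, hy, hxy⟩ := Set.mem_iUnion₂.1 (ht hx)
      exact Set.mem_iUnion.2 ⟨⟨y, hy⟩, hxy⟩)
  have hsm : ∀ j, ContDiff ℝ ∞ (ρ j) := fun j => (ρ j).contMDiff.contDiff
  have e : ∀ x, φ x = ∑ j, ρ j x * φ x := by
    intro x
    by_cases hx : x ∈ tsupport φ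
    · rw [← Finset.sum_mul, ← finsum_eq_sum_of_fintype, ρ.sum_eq_one hx, one_mul]
    · simp [image_eq_zero_of_notMem_tsupport hx]
  have hd : ∀ j, ContDiff ℝ ∞ fun x => ρ j x * φ x := fun j => (hsm j).mul h1
  have hcs : ∀ j, HasCompactSupport fun x => ρ j x * φ x := fun j => h2.mul_left
  have e' : ∀ x, fderiv ℝ φ x (EuclideanSpace.single i 1)
      = ∑ j, fderiv ℝ (fun x => ρ j x * φ x) x (EuclideanSpace.single i 1) := by
    intro x
    have : φ = fun x => ∑ j, ρ j x * φ x := funext e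
    conv_lhs => rw [this]
    rw [fderiv_fun_sum fun j _ => ((hd j).differentiable (by simp)).differentiableAt]
    simp
  have hsU : ∀ j, tsupport (fun x => ρ j x * φ x) ⊆ U := fun j =>
    (tsupport_mul_subset_right).trans h3
  have hsW : ∀ j, tsupport (fun x => ρ j x * φ x) ⊆ W j.1 := fun j =>
    (tsupport_mul_subset_left).trans (hρ j)
  have eq1 : ∫ x in U, f x * fderiv ℝ φ x (EuclideanSpace.single i 1)
      = ∑ j, ∫ x in U, f x * fderiv ℝ (fun x => ρ j x * φ x) x (EuclideanSpace.single i 1) := by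
    rw [← integral_finsetSum _ fun j _ => integrable_mul_of_test hf (continuous_partial (hd j) i)
      (hasCompactSupport_partial (hcs j) i)]
    exact integral_congr_ae (Filter.Eventually.of_forall fun x => by
      simp only [e' x, Finset.mul_sum])
  have eq2 : ∫ x in U, g x * φ x = ∑ j, ∫ x in U, g x * (ρ j x * φ x) := by
    rw [← integral_finsetSum _ fun j _ => integrable_mul_of_test hg (hd j).continuous (hcs j)]
    refine integral_congr_ae (Filter.Eventually.of_forall fun x => ?_)
    simp only [← Finset.mul_sum, ← e x]
  rw [eq1, eq2, ← Finset.sum_neg_distrib]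
  refine Finset.sum_congr rfl fun j _ => ?_
  have := hW j.1 (h3 j.1.2) _ (hd j) (hcs j) (hsW j)
  have t1 := tsupport_partial (fun x => ρ j x * φ x) i
  rwa [setIntegral_mul_of_tsupport f (t1.trans (hsW j)), setIntegral_mul_of_tsupport g (hsW j),
    ← setIntegral_mul_of_tsupport f (t1.trans (hsU j)),
    ← setIntegral_mul_of_tsupport g (hsU j)] at this

/-! ### Functions with vanishing weak gradient -/

theorem clm_ext {L L' : Pt →L[ℝ] ℝ}
    (h : ∀ i, L (EuclideanSpace.single i 1) = L' (EuclideanSpace.single i 1)) : L = L' := by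
  refine ContinuousLinearMap.coe_injective
    ((EuclideanSpace.basisFun (Fin 2) ℝ).toBasis.ext fun i => ?_)
  simpa using h i

/-- Mollifications of `f` have zero gradient on the ball, hence are constant there, and they
converge to `f` almost everywhere. -/
theorem IsWeakPartial.ae_const_ball {U : Set Pt} (hU : IsOpen U) {f : Pt → ℝ}
    (hf : MemLp f 2 (volume.restrict U)) (h : ∀ i, IsWeakPartial U i f 0) {x : Pt} {r : ℝ}
    (hr : 0 < r) (hb : Metric.ball x (2 * r) ⊆ U) :
    ∃ c, f =ᵐ[volume.restrict (Metric.ball x r)] fun _ => c := by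
  have hF : LocallyIntegrable (U.indicator f) volume :=
    ((memLp_indicator_iff_restrict hU.measurableSet).2 hf).locallyIntegrable (by norm_num)
  -- Outer radius at most `r` keeps the translated supports inside the ball of radius `2r`; the
  -- ratio 2 of outer to inner radius is the bound required for almost everywhere convergence.
  let β : ℕ → ContDiffBump (0 : Pt) := fun n =>
    ⟨r / (n + 1) / 2, r / (n + 1), by positivity, half_lt_self (by positivity)⟩
  have hlim : Filter.Tendsto (fun n => (β n).rOut) Filter.atTop (nhds 0) :=
    by
    simpa [β, div_eq_mul_inv] using
      (tendsto_one_div_add_atTop_nhds_zero_nat (𝕜 := ℝ)).const_mul r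
  have hconv := ContDiffBump.ae_convolution_tendsto_right_of_locallyIntegrable
    (μ := (volume : Measure Pt)) (K := 2) hlim
    (Filter.Eventually.of_forall fun n => by change r / (n + 1) ≤ 2 * (r / (n + 1) / 2); linarith)
    hF
  set G : ℕ → Pt → ℝ := fun n => convolution ((β n).normed volume) (U.indicator f)
    (ContinuousLinearMap.lsmul ℝ ℝ) volume with hG
  have hconst : ∀ n, ∀ y ∈ Metric.ball x r, ∀ z ∈ Metric.ball x r, G n y = G n z := by
    intro n
    set b : Pt → ℝ := (β n).normed volume with hbdef
    have hbc : ContDiff ℝ ∞ b := (β n).contDiff_normed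
    have hGn : G n = convolution (U.indicator f) b (ContinuousLinearMap.lsmul ℝ ℝ).flip volume :=
      (convolution_flip _).symm
    have hder : ∀ y, HasFDerivAt (G n) _ y := fun y => hGn ▸
      HasCompactSupport.hasFDerivAt_convolution_right (ContinuousLinearMap.lsmul ℝ ℝ).flip
        (β n).hasCompactSupport_normed hF (hbc.of_le (by exact_mod_cast le_top)) y
    -- The derivative of the convolution at `y` is the integral of `f` against a derivative of `t ↦
    -- b (y - t)`, up to sign; this is an admissible test function.
    have hz : ∀ y ∈ Metric.ball x r, fderiv ℝ (G n) y = 0 := by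
      intro y hy
      rw [(hder y).fderiv]
      refine clm_ext fun i => ?_
      rw [convolution_precompR_apply _ hF ((β n).hasCompactSupport_normed.fderiv ℝ)
        (hbc.continuous_fderiv (by simp)), convolution_def]
      have hφ : ContDiff ℝ ∞ fun t => b (y - t) := hbc.comp (contDiff_const.sub contDiff_id)
      have hsupp : tsupport (fun t => b (y - t)) ⊆ Metric.closedBall y (r / (n + 1)) := by
        refine closure_minimal (fun t ht => ?_) Metric.isClosed_closedBall
        have : y - t ∈ Function.support b := ht
        rw [hbdef, (β n).support_normed_eq] at this
        rw [Metric.mem_ball, dist_zero_right] at this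
        rw [Metric.mem_closedBall, dist_comm, dist_eq_norm]
        exact this.le
      have hle : r / (n + 1) ≤ r := div_le_self hr.le (by linarith [n.cast_nonneg (α := ℝ)])
      have hsU : tsupport (fun t => b (y - t)) ⊆ U := hsupp.trans fun t ht => hb (by
        rw [Metric.mem_ball] at hy ⊢
        rw [Metric.mem_closedBall] at ht
        linarith [dist_triangle t y x])
      have hcs : HasCompactSupport fun t => b (y - t) :=
        (isCompact_closedBall y _).of_isClosed_subset (isClosed_tsupport _) hsupp
      have key := h i _ hφ hcs hsU
      simp only [Pi.zero_apply, zero_mul, integral_zero, neg_zero] at key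
      rw [← integral_indicator hU.measurableSet] at key
      have hd : ∀ t, fderiv ℝ (fun t => b (y - t)) t (EuclideanSpace.single i 1)
          = -fderiv ℝ b (y - t) (EuclideanSpace.single i 1) := by
        intro t
        have h1 : HasFDerivAt (fun t : Pt => y - t) (-ContinuousLinearMap.id ℝ Pt) t :=
          (hasFDerivAt_id t).const_sub y
        have h2 := (hbc.differentiable (by simp) (y - t)).hasFDerivAt.comp t h1
        rw [show (fun t => b (y - t)) = b ∘ fun t => y - t from rfl, h2.fderiv]
        simp
      rw [zero_apply, ← neg_eq_zero, ← integral_neg, ← key]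
      refine integral_congr_ae (Filter.Eventually.of_forall fun t => ?_)
      change -(fderiv ℝ b (y - t) (EuclideanSpace.single i 1) * U.indicator f t) = _
      by_cases htU : t ∈ U
      · rw [Set.indicator_of_mem htU, Set.indicator_of_mem htU, hd, mul_neg,
          mul_comm]
      · simp [htU]
    intro y hy z hz'
    exact Metric.isOpen_ball.is_const_of_fderiv_eq_zero (convex_ball x r).isPreconnected
      (fun y _ => (hder y).differentiableAt.differentiableWithinAt) hz hy hz'
  have hpos : volume (Metric.ball x r) ≠ 0 := (Metric.measure_ball_pos _ _ hr).ne'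
  have hgood : ∀ᵐ y ∂(volume.restrict (Metric.ball x r)), y ∈ Metric.ball x r ∧
      Filter.Tendsto (fun n => G n y) Filter.atTop (nhds (f y)) := by
    filter_upwards [ae_restrict_of_ae hconv, ae_restrict_mem Metric.isOpen_ball.measurableSet]
      with y hy hyb
    refine ⟨hyb, ?_⟩
    rwa [Set.indicator_of_mem (hb (Metric.ball_subset_ball (by linarith) hyb))] at hy
  have : (ae (volume.restrict (Metric.ball x r))).NeBot := by
    rw [ae_neBot, Ne, Measure.restrict_eq_zero]
    exact hpos
  obtain ⟨z, hz, hzt⟩ := hgood.exists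
  refine ⟨f z, ?_⟩
  filter_upwards [hgood] with y hy
  refine tendsto_nhds_unique hy.2 (hzt.congr fun n => hconst n z hz y hy.1)

/-- The local constants agree on overlaps of positive measure, hence everywhere by connectedness. -/
theorem IsWeakPartial.ae_const {U : Set Pt} (hU : IsOpen U) (hc : IsPreconnected U) {f : Pt → ℝ}
    (hf : MemLp f 2 (volume.restrict U)) (h : ∀ i, IsWeakPartial U i f 0) :
    ∃ c, f =ᵐ[volume.restrict U] fun _ => c := by
  rcases U.eq_empty_or_nonempty with rfl | ⟨x₀, hx₀⟩
  · exact ⟨0, by simp [Filter.EventuallyEq]⟩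
  have hloc : ∀ x ∈ U, ∃ r c, 0 < r ∧ Metric.ball x r ⊆ U ∧
      f =ᵐ[volume.restrict (Metric.ball x r)] fun _ => c := by
    intro x hx
    obtain ⟨ε, hε, hb⟩ := Metric.isOpen_iff.1 hU x hx
    obtain ⟨c, hc⟩ := IsWeakPartial.ae_const_ball hU hf h (half_pos hε)
      (x := x) (by rwa [mul_div_cancel₀ _ two_ne_zero])
    exact ⟨ε / 2, c, half_pos hε, (Metric.ball_subset_ball (by linarith)).trans hb, hc⟩
  choose! r c hr hb hrc using hloc
  have heq : ∀ x ∈ U, ∀ y ∈ U, c x = c y := by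
    intro x hx y hy
    refine hc.induction₂ (fun x y => c x = c y) (fun x hx => ?_)
      (fun _ _ _ _ _ _ => Eq.trans) (fun _ _ _ _ => Eq.symm) hx hy
    filter_upwards [mem_nhdsWithin_of_mem_nhds (Metric.ball_mem_nhds x (hr x hx)),
      self_mem_nhdsWithin] with y hy hyU
    have hV : IsOpen (Metric.ball x (r x) ∩ Metric.ball y (r y)) :=
      Metric.isOpen_ball.inter Metric.isOpen_ball
    have hpos : volume (Metric.ball x (r x) ∩ Metric.ball y (r y)) ≠ 0 :=
      (hV.measure_pos _ ⟨y, hy, Metric.mem_ball_self (hr y hyU)⟩).ne'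
    have h1 := ae_restrict_of_ae_restrict_of_subset
      (s := Metric.ball x (r x) ∩ Metric.ball y (r y)) Set.inter_subset_left (hrc x hx)
    have h2 := ae_restrict_of_ae_restrict_of_subset
      (s := Metric.ball x (r x) ∩ Metric.ball y (r y)) Set.inter_subset_right (hrc y hyU)
    have : (ae (volume.restrict (Metric.ball x (r x) ∩ Metric.ball y (r y)))).NeBot := by
      rwa [ae_neBot, Ne, Measure.restrict_eq_zero]
    obtain ⟨z, hz1, hz2⟩ := (h1.and h2).exists
    exact hz1.symm.trans hz2
  refine ⟨c x₀, ?_⟩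
  rw [Filter.EventuallyEq, ae_restrict_iff' hU.measurableSet, ae_iff]
  refine measure_null_of_locally_null _ fun x hx => ?_
  have hxU : x ∈ U := by
    by_contra h
    exact hx fun h' => absurd h' h
  refine ⟨_, Filter.inter_mem self_mem_nhdsWithin
    (mem_nhdsWithin_of_mem_nhds (Metric.ball_mem_nhds x (hr x hxU))), ?_⟩
  have := hrc x hxU
  rw [Filter.EventuallyEq, ae_restrict_iff' Metric.isOpen_ball.measurableSet, ae_iff] at this
  refine measure_mono_null (t := {a | ¬(a ∈ Metric.ball x (r x) → f a = c x)}) ?_ this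
  rintro z ⟨hz1, hz2⟩ hz'
  exact hz1 fun _ => by rw [hz' hz2, heq x hxU x₀ hx₀]

/-! ### Locally constant cocycles on simply connected spaces -/

/-- The reals with the discrete topology. -/
def DiscreteReal : Type := ℝ

instance : AddCommGroup DiscreteReal := inferInstanceAs (AddCommGroup ℝ)

instance : TopologicalSpace DiscreteReal := ⊥

instance : DiscreteTopology DiscreteReal := ⟨rfl⟩

/-- The bundle with discrete fibre whose transition functions are translations by a cocycle. -/
def cocycleBundle {X : Type*} [TopologicalSpace X] (B : X → Set X) (hB : ∀ i, IsOpen (B i))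
    (hm : ∀ i, i ∈ B i) (c : X → X → DiscreteReal)
    (hc : ∀ i j k, (B i ∩ B j ∩ B k).Nonempty → c i j + c j k = c i k) :
    FiberBundleCore X X DiscreteReal where
  baseSet := B
  isOpen_baseSet := hB
  indexAt := id
  mem_baseSet_at := hm
  coordChange i j _ v := v + c i j
  coordChange_self i x hx v := by
    have := hc i i i ⟨x, ⟨hx, hx⟩, hx⟩
    rw [add_eq_left.1 this, add_zero]
  continuousOn_coordChange i j := by
    have : Continuous fun v : DiscreteReal => v + c i j := continuous_of_discreteTopology
    exact (this.comp continuous_snd).continuousOn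
  coordChange_comp i j k x hx v := by
    rw [add_assoc, hc i j k ⟨x, hx⟩]

/-- The cocycle defines a bundle with discrete fibre, which is a covering space. Simple
connectedness lifts the identity to a global section, and the fibre coordinate of the section is the
desired 0-cochain. -/
theorem exists_coboundary {X : Type*} [TopologicalSpace X] [SimplyConnectedSpace X]
    [LocallyPathConnectedSpace X] (B : X → Set X) (hB : ∀ i, IsOpen (B i)) (hm : ∀ i, i ∈ B i)
    (hconn : ∀ i, IsPreconnected (B i)) (c : X → X → ℝ)
    (hc : ∀ i j k, (B i ∩ B j ∩ B k).Nonempty → c i j + c j k = c i k) :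
    ∃ a : X → ℝ, ∀ i j, (B i ∩ B j).Nonempty → a j - a i = c i j := by
  let c' : X → X → DiscreteReal := c
  let Z := cocycleBundle B hB hm c' hc
  have cov : IsCoveringMap (Bundle.TotalSpace.proj : Z.TotalSpace → X) :=
    FiberBundle.isCoveringMap (F := DiscreteReal) (E := Z.Fiber)
  obtain ⟨x₀⟩ : Nonempty X := inferInstance
  obtain ⟨s, ⟨-, hs⟩, -⟩ := cov.existsUnique_continuousMap_lifts (ContinuousMap.id X) x₀
    (⟨x₀, (0 : DiscreteReal)⟩ : Z.TotalSpace) rfl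
  have hs1 : ∀ x, (s x).1 = x := fun x => congrFun hs x
  let a : X → DiscreteReal := fun x => (s x).2
  -- In the chart `i` the section has coordinate `a x + c' x i`, continuous with discrete values on
  -- a preconnected set, hence equal to its value at `i`.
  have key : ∀ i, ∀ x ∈ B i, a x + c' x i = a i + c' i i := by
    intro i x hx
    have hcont : ContinuousOn (fun y => ((Z.localTriv i) (s y)).2) (B i) := by
      refine continuous_snd.comp_continuousOn
        ((Z.localTriv i).continuousOn.comp s.continuous.continuousOn fun y hy => ?_)
      rw [Z.mem_localTriv_source, ← Z.baseSet_at, hs1]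
      exact hy
    have hval : ∀ y, ((Z.localTriv i) (s y)).2 = a y + c' y i := fun y => by
      rw [Z.localTriv_apply]
      change a y + c' (s y).1 i = _
      rw [hs1]
    have := (hconn i).constant hcont hx (hm i)
    rwa [hval, hval] at this
  let a' : X → ℝ := a
  refine ⟨a', fun i j ⟨x, hi, hj⟩ => ?_⟩
  have hi' : a' x + c x i = a' i + c i i := key i x hi
  have hj' : a' x + c x j = a' j + c j j := key j x hj
  -- The sets are indexed by points and `x ∈ B x`, so `x` itself serves as third index.
  have h1 := hc x i j ⟨x, ⟨hm x, hi⟩, hj⟩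
  have h2 := hc i i i ⟨x, ⟨hi, hi⟩, hi⟩
  have h3 := hc j j j ⟨x, ⟨hj, hj⟩, hj⟩
  linarith

/-! ### Removing a point -/

/-- Points have zero capacity in dimension two. With a cutoff around `v` at scale `1/n`, the extra
term has integrand of size `n` on a set of area of order `1/n²`, since `f` and the test function are
bounded. -/
theorem IsWeakPartial.of_diff_singleton {U : Set Pt} {i : Fin 2} {f g : Pt → ℝ} {v : Pt} {C : ℝ}
    (hfm : MemLp f 2 (volume.restrict U)) (hf : ∀ᵐ x ∂(volume.restrict U), |f x| ≤ C)
    (hg : MemLp g 2 (volume.restrict U)) (h : IsWeakPartial (U \ {v}) i f g) :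
    IsWeakPartial U i f g := by
  intro φ h1 h2 h3
  let β : ContDiffBump (0 : Pt) := ⟨1, 2, one_pos, one_lt_two⟩
  -- `η n` is 1 on the ball of radius `1/(n+1)` about `v` and 0 outside that of radius `2/(n+1)`;
  -- the admissible test functions are `(1 - η n) φ`.
  let η : ℕ → Pt → ℝ := fun n x => β (((n : ℝ) + 1) • (x - v))
  have hη : ∀ n, ContDiff ℝ ∞ (η n) := fun n =>
    β.contDiff.comp (g := β) (f := fun x : Pt => ((n : ℝ) + 1) • (x - v)) (by fun_prop)
  have hη0 : ∀ n x, 0 ≤ η n x := fun n x => β.nonneg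
  have hη1 : ∀ n x, η n x ≤ 1 := fun n x => β.le_one
  have hηd : ∀ n x, fderiv ℝ (η n) x (EuclideanSpace.single i 1)
      = ((n : ℝ) + 1) * fderiv ℝ β (((n : ℝ) + 1) • (x - v)) (EuclideanSpace.single i 1) := by
    intro n x
    have d1 : HasFDerivAt (fun x : Pt => ((n : ℝ) + 1) • (x - v))
        (((n : ℝ) + 1) • ContinuousLinearMap.id ℝ Pt) x :=
      HasFDerivAt.fun_const_smul ((hasFDerivAt_id x).sub_const v) _
    have d2 := ((β.contDiff (n := 1)).differentiable one_ne_zero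
      (((n : ℝ) + 1) • (x - v))).hasFDerivAt.comp x d1
    rw [show η n = β ∘ fun x : Pt => ((n : ℝ) + 1) • (x - v) from rfl, d2.fderiv]
    simp
  have hcβ : Continuous fun x => fderiv ℝ β x (EuclideanSpace.single i 1) :=
    ((β.contDiff (n := 1)).continuous_fderiv one_ne_zero).clm_apply continuous_const
  have hsβ : HasCompactSupport fun x => fderiv ℝ β x (EuclideanSpace.single i 1) :=
    (β.hasCompactSupport.fderiv ℝ).comp_left
      (g := fun L : Pt →L[ℝ] ℝ => L (EuclideanSpace.single i 1)) rfl
  obtain ⟨K, hK⟩ := hcβ.bounded_above_of_compact_support hsβ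
  obtain ⟨K', hK'⟩ := h1.continuous.bounded_above_of_compact_support h2
  have hKβ : ∀ n x, |fderiv ℝ (η n) x (EuclideanSpace.single i 1)|
      ≤ (Metric.closedBall v (2 / ((n : ℝ) + 1))).indicator (fun _ => ((n : ℝ) + 1) * K) x := by
    intro n x
    have hn : (0 : ℝ) < n + 1 := by positivity
    rw [hηd]
    by_cases hx : x ∈ Metric.closedBall v (2 / ((n : ℝ) + 1))
    · rw [Set.indicator_of_mem hx, abs_mul, abs_of_pos hn]
      exact mul_le_mul_of_nonneg_left (hK _) hn.le
    · rw [Set.indicator_of_notMem hx]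
      have hnot : ((n : ℝ) + 1) • (x - v) ∉ tsupport β := by
        rw [β.tsupport_eq, Metric.mem_closedBall, dist_zero_right, norm_smul, Real.norm_of_nonneg
          hn.le, ← dist_eq_norm]
        rw [Metric.mem_closedBall, le_div_iff₀' hn] at hx
        exact hx
      have := image_eq_zero_of_notMem_tsupport fun h' => hnot (tsupport_partial β i h')
      rw [this]
      simp
  let ψ : ℕ → Pt → ℝ := fun n x => (1 - η n x) * φ x
  have hψ : ∀ n, ContDiff ℝ ∞ (ψ n) := fun n => (contDiff_const.sub (hη n)).mul h1
  have hψc : ∀ n, HasCompactSupport (ψ n) := fun n => h2.mul_left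
  have hψs : ∀ n, tsupport (ψ n) ⊆ U \ {v} := by
    intro n x hx
    refine ⟨h3 (tsupport_mul_subset_right hx), ?_⟩
    rintro rfl
    refine (notMem_tsupport_iff_eventuallyEq.2 ?_) hx
    have hn : (0 : ℝ) < n + 1 := by positivity
    filter_upwards [Metric.ball_mem_nhds x (by positivity : 0 < 1 / ((n : ℝ) + 1))] with y hy
    have : η n y = 1 := β.one_of_mem_closedBall (by
      rw [Metric.mem_closedBall, dist_zero_right, norm_smul, Real.norm_of_nonneg hn.le,
        ← dist_eq_norm]
      rw [Metric.mem_ball, lt_div_iff₀' hn] at hy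
      exact hy.le)
    simp [ψ, this]
  have hψd : ∀ n x, fderiv ℝ (ψ n) x (EuclideanSpace.single i 1)
      = (1 - η n x) * fderiv ℝ φ x (EuclideanSpace.single i 1)
        - fderiv ℝ (η n) x (EuclideanSpace.single i 1) * φ x := by
    intro n x
    have d1 : HasFDerivAt (fun x => 1 - η n x) (-fderiv ℝ (η n) x) x :=
      ((hη n).differentiable (by simp) x).hasFDerivAt.const_sub 1
    have d2 := d1.mul (h1.differentiable (by simp) x).hasFDerivAt
    rw [show ψ n = (fun x => 1 - η n x) * φ from rfl, d2.fderiv]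
    simp
    ring
  have hdφ : Continuous fun x => fderiv ℝ φ x (EuclideanSpace.single i 1) :=
    continuous_partial h1 i
  have I1 : ∀ n, Integrable (fun x => f x * ((1 - η n x) *
      fderiv ℝ φ x (EuclideanSpace.single i 1))) (volume.restrict U) :=
    fun n => integrable_mul_of_test hfm
    ((continuous_const.sub (hη n).continuous).mul hdφ)
    ((hasCompactSupport_partial h2 i).mul_left (f := fun x => 1 - η n x))
  have I2 : ∀ n, Integrable (fun x => f x * (fderiv ℝ (η n) x (EuclideanSpace.single i 1) * φ x))
      (volume.restrict U) := fun n => integrable_mul_of_test hfm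
    ((continuous_partial (hη n) i).mul h1.continuous)
    (h2.mul_left (f := fun x => fderiv ℝ (η n) x (EuclideanSpace.single i 1)))
  have key : ∀ n, (∫ x in U, f x * ((1 - η n x) * fderiv ℝ φ x (EuclideanSpace.single i 1)))
      - ∫ x in U, f x * (fderiv ℝ (η n) x (EuclideanSpace.single i 1) * φ x)
      = -∫ x in U, g x * ((1 - η n x) * φ x) := by
    intro n
    have := h (ψ n) (hψ n) (hψc n) (hψs n)
    have t1 := (tsupport_partial (ψ n) i).trans (hψs n)
    rw [setIntegral_mul_of_tsupport f t1, setIntegral_mul_of_tsupport g (hψs n),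
      ← setIntegral_mul_of_tsupport f (t1.trans Set.sdiff_subset),
      ← setIntegral_mul_of_tsupport g ((hψs n).trans Set.sdiff_subset)] at this
    rw [← this, ← integral_sub (I1 n) (I2 n)]
    simp only [hψd, mul_sub]
  have hlim1 : ∀ x, x ≠ v → Filter.Tendsto (fun n => 1 - η n x) Filter.atTop (nhds 1) := by
    intro x hx
    have hpos : 0 < dist x v := dist_pos.2 hx
    obtain ⟨N, hN⟩ := exists_nat_gt (2 / dist x v)
    refine tendsto_const_nhds.congr' ?_
    filter_upwards [Filter.eventually_ge_atTop N] with n hn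
    have hn' : (N : ℝ) ≤ n := by exact_mod_cast hn
    have : η n x = 0 := β.zero_of_le_dist (by
      rw [dist_zero_right, norm_smul, Real.norm_of_nonneg (by positivity), ← dist_eq_norm]
      rw [div_lt_iff₀ hpos] at hN
      change (2 : ℝ) ≤ _
      nlinarith)
    simp [this]
  have hae : ∀ᵐ x ∂(volume.restrict U), x ≠ v :=
    ae_restrict_of_ae (by simp [ae_iff])
  have hb1 : ∀ n x, |1 - η n x| ≤ 1 := fun n x => by
    rw [abs_le]
    constructor <;> linarith [hη0 n x, hη1 n x]
  have dom : ∀ {w θ : Pt → ℝ}, MemLp w 2 (volume.restrict U) → Continuous θ →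
      HasCompactSupport θ → Filter.Tendsto (fun n => ∫ x in U, w x * ((1 - η n x) * θ x))
        Filter.atTop (nhds (∫ x in U, w x * θ x)) := by
    intro w θ hw hθ hθc
    refine tendsto_integral_of_dominated_convergence (fun x => ‖w x * θ x‖)
      (fun n => (integrable_mul_of_test hw ((continuous_const.sub (hη n).continuous).mul hθ)
        hθc.mul_left).aestronglyMeasurable) (integrable_mul_of_test hw hθ hθc).norm
      (fun n => Filter.Eventually.of_forall fun x => ?_) ?_
    · rw [mul_left_comm, norm_mul]
      exact mul_le_of_le_one_left (norm_nonneg _) (hb1 n x)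
    · filter_upwards [hae] with x hx
      simpa using ((hlim1 x hx).mul_const (θ x)).const_mul (w x)
  have L1 := dom hfm hdφ (hasCompactSupport_partial h2 i)
  have L3 := (dom hg h1.continuous h2).neg
  have L2 : Filter.Tendsto (fun n => ∫ x in U,
      f x * (fderiv ℝ (η n) x (EuclideanSpace.single i 1) * φ x)) Filter.atTop (nhds 0) := by
    -- The factor 4 is the square of the outer radius 2 of the bump: area `(2/(n+1))²` times
    -- gradient of size `n+1`.
    have hbound : ∀ n : ℕ, ‖∫ x in U,
        f x * (fderiv ℝ (η n) x (EuclideanSpace.single i 1) * φ x)‖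
        ≤ (|C| * |K| * |K'| * 4 * volume.real (Metric.closedBall (0 : Pt) 1))
          * (1 / ((n : ℝ) + 1)) := by
      intro n
      have hn : (0 : ℝ) < n + 1 := by positivity
      set B := Metric.closedBall v (2 / ((n : ℝ) + 1)) with hB
      have hBf : volume B ≠ ⊤ := (isCompact_closedBall v _).measure_lt_top.ne
      have hint : Integrable (B.indicator fun _ => |C| * (((n : ℝ) + 1) * |K| * |K'|))
          (volume.restrict U) :=
        (IntegrableOn.integrable_indicator (integrableOn_const hBf)
          Metric.isClosed_closedBall.measurableSet).restrict
      refine (norm_integral_le_of_norm_le hint ?_).trans ?_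
      · filter_upwards [hf] with x hx
        rw [norm_mul, norm_mul, Real.norm_eq_abs, Real.norm_eq_abs]
        have e1 := hKβ n x
        by_cases hxB : x ∈ B
        · rw [Set.indicator_of_mem hxB] at e1 ⊢
          have e2 : ((n : ℝ) + 1) * K ≤ (n + 1) * |K| :=
            mul_le_mul_of_nonneg_left (le_abs_self K) hn.le
          exact mul_le_mul (hx.trans (le_abs_self C)) (mul_le_mul (e1.trans e2)
            ((hK' x).trans (le_abs_self K')) (norm_nonneg _) (by positivity)) (by positivity)
            (abs_nonneg C)
        · rw [Set.indicator_of_notMem hxB] at e1 ⊢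
          rw [le_antisymm e1 (abs_nonneg _)]
          simp
      · rw [integral_indicator Metric.isClosed_closedBall.measurableSet,
          Measure.restrict_restrict Metric.isClosed_closedBall.measurableSet, setIntegral_const,
          smul_eq_mul]
        have e1 : volume.real (B ∩ U) ≤ volume.real B :=
          measureReal_mono Set.inter_subset_left hBf
        have e2 : volume.real B
            = (2 / ((n : ℝ) + 1)) ^ 2 * volume.real (Metric.closedBall (0 : Pt) 1) := by
          rw [hB, Measure.addHaar_real_closedBall' _ _ (by positivity)]
          simp
        rw [e2] at e1
        refine (mul_le_mul_of_nonneg_right e1 (by positivity)).trans (le_of_eq ?_)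
        field_simp
        ring
    refine squeeze_zero_norm hbound ?_
    simpa using (tendsto_one_div_add_atTop_nhds_zero_nat (𝕜 := ℝ)).const_mul
      (|C| * |K| * |K'| * 4 * volume.real (Metric.closedBall (0 : Pt) 1))
  have := tendsto_nhds_unique ((L1.sub L2).congr key) L3
  simpa using this

theorem IsWeakPartial.of_diff_finite {U : Set Pt} {i : Fin 2} {f g : Pt → ℝ} {V : Set Pt} {C : ℝ}
    (hV : V.Finite) (hfm : MemLp f 2 (volume.restrict U))
    (hf : ∀ᵐ x ∂(volume.restrict U), |f x| ≤ C)
    (hg : MemLp g 2 (volume.restrict U)) (h : IsWeakPartial (U \ V) i f g) :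
    IsWeakPartial U i f g := by
  induction V, hV using Set.Finite.induction_on with
  | empty => simpa using h
  | @insert v V _ _ ih =>
    have hle : volume.restrict (U \ V) ≤ volume.restrict U :=
      Measure.restrict_mono Set.sdiff_subset le_rfl
    refine ih (IsWeakPartial.of_diff_singleton (v := v) (hfm.mono_measure hle)
      (ae_mono hle hf) (hg.mono_measure hle) ?_)
    rwa [Set.sdiff_sdiff, Set.union_singleton]

/-! ### Functions given by different polynomials on both sides of a line -/

/-- The affine function vanishing on the line through `a` and `b`, positive on its left. -/
def side (a b x : Pt) : ℝ := cross (b - a) (x - a)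

theorem side_apply (a b x : Pt) :
    side a b x = (b 0 - a 0) * (x 1 - a 1) - (b 1 - a 1) * (x 0 - a 0) := by
  simp [side, cross]

theorem contDiff_side (a b : Pt) {n : WithTop ℕ∞} : ContDiff ℝ n (side a b) := by
  have : side a b = fun x : Pt => (b 0 - a 0) * ((EuclideanSpace.proj 1 : Pt →L[ℝ] ℝ) x - a 1)
      - (b 1 - a 1) * ((EuclideanSpace.proj 0 : Pt →L[ℝ] ℝ) x - a 0) :=
    funext fun x => side_apply a b x
  rw [this]
  exact (contDiff_const.mul ((ContinuousLinearMap.contDiff _).sub contDiff_const)).sub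
    (contDiff_const.mul ((ContinuousLinearMap.contDiff _).sub contDiff_const))

theorem continuous_side (a b : Pt) : Continuous (side a b) :=
  (contDiff_side a b (n := 0)).continuous

theorem side_add_smul (a b x : Pt) (s : ℝ) :
    side a b (x + s • !₂[-(b - a) 1, (b - a) 0]) = side a b x + s * ‖b - a‖ ^ 2 := by
  rw [side_apply, side_apply, sq_norm_eq]
  simp
  ring

theorem exists_on_line_of_side_eq_zero {a b x : Pt} (hab : a ≠ b) (h : side a b x = 0) :
    ∃ t : ℝ, x = a + t • (b - a) := by
  have hn : ‖b - a‖ ^ 2 ≠ 0 := pow_ne_zero 2 (norm_ne_zero_iff.2 (sub_ne_zero.2 hab.symm))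
  rw [sq_norm_eq] at hn
  simp only [PiLp.sub_apply] at hn
  rw [side_apply] at h
  refine ⟨((x 0 - a 0) * (b 0 - a 0) + (x 1 - a 1) * (b 1 - a 1))
    / ((b 0 - a 0) ^ 2 + (b 1 - a 1) ^ 2), ?_⟩
  ext i
  fin_cases i
  · simp
    field_simp
    linear_combination (-(b 1 - a 1)) * h
  · simp
    field_simp
    linear_combination (b 0 - a 0) * h

theorem side_line (a b : Pt) (t : ℝ) : side a b (a + t • (b - a)) = 0 := by
  rw [side_apply]
  simp
  ring

theorem volume_side_eq_zero {a b : Pt} (hab : a ≠ b) : volume {x | side a b x = 0} = 0 := by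
  have hn : ‖b - a‖ ^ 2 ≠ 0 := pow_ne_zero 2 (norm_ne_zero_iff.2 (sub_ne_zero.2 hab.symm))
  refine measure_mono_null (fun x (hx : side a b x = 0) => ?_)
    (Measure.addHaar_affineSubspace volume (AffineSubspace.mk' a (ℝ ∙ (b - a))) fun h => ?_)
  · obtain ⟨t, rfl⟩ := exists_on_line_of_side_eq_zero hab hx
    rw [SetLike.mem_coe, AffineSubspace.mem_mk']
    simpa using Submodule.smul_mem _ t (Submodule.mem_span_singleton_self (b - a))
  · have hmem : a + (1 : ℝ) • !₂[-(b - a) 1, (b - a) 0] ∈ AffineSubspace.mk' a (ℝ ∙ (b - a)) := by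
      rw [h]
      trivial
    rw [AffineSubspace.mem_mk', vsub_eq_sub, add_sub_cancel_left] at hmem
    obtain ⟨t, ht⟩ := Submodule.mem_span_singleton.1 hmem
    have e := side_add_smul a b a 1
    rw [← ht, side_line] at e
    have : side a b a = 0 := by simp [side_apply]
    rw [this] at e
    apply hn
    linarith

/-- The divergence theorem on a half plane for functions vanishing on its boundary. -/
theorem integral_halfPlane_partial {a b : Pt} (hab : a ≠ b) {ψ : Pt → ℝ} (hψ : ContDiff ℝ 1 ψ)
    (hc : HasCompactSupport ψ) (h0 : ∀ x, side a b x = 0 → ψ x = 0) (v : Pt) :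
    ∫ x, {x | 0 < side a b x}.indicator (fun x => fderiv ℝ ψ x v) x = 0 := by
  have hn : 0 < ‖b - a‖ := norm_pos_iff.2 (sub_ne_zero.2 hab.symm)
  set χ : ℝ → ℝ := Real.smoothTransition with hχ
  have hχc : ContDiff ℝ ∞ χ := Real.smoothTransition.contDiff
  have hχd : ∀ s, HasDerivAt χ (deriv χ s) s := fun s =>
    (hχc.differentiable (by simp) s).hasDerivAt
  have hneg : ∀ s < 0, deriv χ s = 0 := fun s hs => by
    have : χ =ᶠ[nhds s] fun _ => 0 := by
      filter_upwards [eventually_lt_nhds hs] with t ht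
      exact Real.smoothTransition.zero_of_nonpos ht.le
    rw [this.deriv_eq, deriv_const]
  have hbig : ∀ s, 1 < s → deriv χ s = 0 := fun s hs => by
    have : χ =ᶠ[nhds s] fun _ => 1 := by
      filter_upwards [eventually_gt_nhds hs] with t ht
      exact Real.smoothTransition.one_of_one_le ht.le
    rw [this.deriv_eq, deriv_const]
  obtain ⟨K, hK⟩ := isCompact_Icc.exists_bound_of_continuousOn (s := Set.Icc (0 : ℝ) 1)
    (hχc.continuous_deriv (by simp)).continuousOn
  -- The derivative of the cutoff grows like `n+1`; the boundary condition supplies a factor of the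
  -- distance to the line, and this bounds the product uniformly in `n`.
  have hKs : ∀ s, |deriv χ s * s| ≤ |K| := fun s => by
    by_cases hs : s ∈ Set.Icc (0 : ℝ) 1
    · rw [abs_mul]
      have h1 : |deriv χ s| ≤ |K| := (hK s hs).trans (le_abs_self K)
      have h2 : |s| ≤ 1 := abs_le.2 ⟨by linarith [hs.1], hs.2⟩
      nlinarith [abs_nonneg s, abs_nonneg (deriv χ s)]
    · have : deriv χ s = 0 := by
        rw [Set.mem_Icc, not_and_or, not_le, not_le] at hs
        exact hs.elim (hneg s) (hbig s)
      simp [this]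
  obtain ⟨Lp, hLp⟩ : ∃ Lp, LipschitzWith Lp ψ := hψ.lipschitzWith_of_hasCompactSupport hc
    one_ne_zero
  set m : Pt := !₂[-(b - a) 1, (b - a) 0] with hm
  -- Lipschitz estimate between `x` and its orthogonal projection onto the line, where `ψ` vanishes.
  have hψl : ∀ x, |ψ x| ≤ Lp * (|side a b x| / ‖b - a‖ ^ 2 * ‖m‖) := by
    intro x
    have e : side a b (x + (-(side a b x / ‖b - a‖ ^ 2)) • m) = 0 := by
      rw [side_add_smul]
      field_simp
      ring
    have := hLp.dist_le_mul x (x + (-(side a b x / ‖b - a‖ ^ 2)) • m)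
    rw [h0 _ e, dist_self_add_right, norm_smul, norm_neg, Real.norm_eq_abs, abs_div,
      abs_of_pos (pow_pos hn 2), Real.dist_eq, sub_zero] at this
    exact this
  set D := fderiv ℝ (side a b) with hD
  have hDc : ∀ x, D x v = side a b (a + v) := by
    intro x
    have h1 : HasFDerivAt (side a b) ((b 0 - a 0) • (EuclideanSpace.proj 1 : Pt →L[ℝ] ℝ)
        - (b 1 - a 1) • (EuclideanSpace.proj 0 : Pt →L[ℝ] ℝ)) x := by
      have := ((((EuclideanSpace.proj 1 : Pt →L[ℝ] ℝ).hasFDerivAt (x := x)).sub_const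
        (a 1)).const_mul (b 0 - a 0)).sub
        ((((EuclideanSpace.proj 0 : Pt →L[ℝ] ℝ).hasFDerivAt (x := x)).sub_const
        (a 0)).const_mul (b 1 - a 1))
      exact this.congr_of_eventuallyEq (Filter.Eventually.of_forall fun y => side_apply a b y)
    rw [hD, h1.fderiv, side_apply]
    change (b 0 - a 0) * v 1 - (b 1 - a 1) * v 0 = _
    simp
  -- Smooth approximations of the indicator of the half plane. Integrating by parts against them
  -- leaves a term that tends to zero by dominated convergence.
  set X : ℕ → Pt → ℝ := fun n x => χ (((n : ℝ) + 1) * side a b x) with hX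
  have hXc : ∀ n, ContDiff ℝ 1 (X n) := fun n =>
    (hχc.of_le (by exact_mod_cast le_top)).comp (contDiff_const.mul (contDiff_side a b))
  have hXd : ∀ n x, fderiv ℝ (X n) x v
      = deriv χ (((n : ℝ) + 1) * side a b x) * (((n : ℝ) + 1) * side a b (a + v)) := by
    intro n x
    have h1 := ((contDiff_side a b (n := 1)).differentiable one_ne_zero x).hasFDerivAt.const_mul
      ((n : ℝ) + 1)
    have h2 := (hχd (((n : ℝ) + 1) * side a b x)).comp_hasFDerivAt x h1
    rw [show X n = χ ∘ fun x => ((n : ℝ) + 1) * side a b x from rfl, h2.fderiv, ← hDc x]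
    rfl
  have hdψ : Continuous fun x => fderiv ℝ ψ x v :=
    (hψ.continuous_fderiv one_ne_zero).clm_apply continuous_const
  have hdψc : HasCompactSupport fun x => fderiv ℝ ψ x v :=
    (hc.fderiv ℝ).comp_left (g := fun L : Pt →L[ℝ] ℝ => L v) rfl
  have hid : ∀ n, ∫ x, X n x * fderiv ℝ ψ x v = -∫ x, fderiv ℝ (X n) x v * ψ x := fun n =>
    integral_mul_partial (hXc n) hψ hc v
  have L1 : Filter.Tendsto (fun n => ∫ x, X n x * fderiv ℝ ψ x v) Filter.atTop
      (nhds (∫ x, {x | 0 < side a b x}.indicator (fun x => fderiv ℝ ψ x v) x)) := by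
    refine tendsto_integral_of_dominated_convergence (fun x => ‖fderiv ℝ ψ x v‖)
      (fun n => ((hXc n).continuous.mul hdψ).aestronglyMeasurable)
      (hdψ.integrable_of_hasCompactSupport hdψc).norm
      (fun n => Filter.Eventually.of_forall fun x => ?_)
      (Filter.Eventually.of_forall fun x => ?_)
    · rw [norm_mul]
      refine mul_le_of_le_one_left (norm_nonneg _) ?_
      rw [Real.norm_of_nonneg (Real.smoothTransition.nonneg _)]
      exact Real.smoothTransition.le_one _
    · by_cases hx : 0 < side a b x
      · rw [Set.indicator_of_mem (show x ∈ {x | 0 < side a b x} from hx)]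
        obtain ⟨N, hN⟩ := exists_nat_gt (1 / side a b x)
        refine tendsto_const_nhds.congr' ?_
        filter_upwards [Filter.eventually_ge_atTop N] with n hn'
        have : (N : ℝ) ≤ n := by exact_mod_cast hn'
        rw [div_lt_iff₀ hx] at hN
        have : X n x = 1 := Real.smoothTransition.one_of_one_le (by nlinarith)
        rw [this, one_mul]
      · rw [Set.indicator_of_notMem (show x ∉ {x | 0 < side a b x} from hx)]
        refine tendsto_const_nhds.congr fun n => ?_
        have : X n x = 0 := Real.smoothTransition.zero_of_nonpos
          (mul_nonpos_of_nonneg_of_nonpos (by positivity) (not_lt.1 hx))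
        rw [this, zero_mul]
  have L2 : Filter.Tendsto (fun n => ∫ x, fderiv ℝ (X n) x v * ψ x) Filter.atTop (nhds 0) := by
    have : Filter.Tendsto (fun n => ∫ x, fderiv ℝ (X n) x v * ψ x) Filter.atTop
        (nhds (∫ _ : Pt, (0 : ℝ))) := by
      refine tendsto_integral_of_dominated_convergence
        ((tsupport ψ).indicator fun _ => |K| * |side a b (a + v)| * (Lp / ‖b - a‖ ^ 2 * ‖m‖))
        (fun n => ((((hXc n).continuous_fderiv one_ne_zero).clm_apply continuous_const).mul
          hψ.continuous).aestronglyMeasurable)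
        ((integrableOn_const hc.isCompact.measure_lt_top.ne).integrable_indicator
          (isClosed_tsupport ψ).measurableSet)
        (fun n => Filter.Eventually.of_forall fun x => ?_)
        (Filter.Eventually.of_forall fun x => ?_)
      · by_cases hx : x ∈ tsupport ψ
        · rw [Set.indicator_of_mem hx, hXd, Real.norm_eq_abs]
          have e1 := hKs (((n : ℝ) + 1) * side a b x)
          have e2 := hψl x
          rw [abs_mul, abs_mul, abs_mul, abs_of_pos (by positivity : (0 : ℝ) < n + 1)]
          rw [abs_mul, abs_mul, abs_of_pos (by positivity : (0 : ℝ) < n + 1)] at e1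
          calc |deriv χ (((n : ℝ) + 1) * side a b x)| * (((n : ℝ) + 1) * |side a b (a + v)|)
                * |ψ x|
              ≤ |deriv χ (((n : ℝ) + 1) * side a b x)| * (((n : ℝ) + 1) * |side a b (a + v)|)
                * (Lp * (|side a b x| / ‖b - a‖ ^ 2 * ‖m‖)) :=
                mul_le_mul_of_nonneg_left e2 (by positivity)
            _ = |deriv χ (((n : ℝ) + 1) * side a b x)| * (((n : ℝ) + 1) * |side a b x|)
                * (|side a b (a + v)| * (Lp / ‖b - a‖ ^ 2 * ‖m‖)) := by ring
            _ ≤ |K| * (|side a b (a + v)| * (Lp / ‖b - a‖ ^ 2 * ‖m‖)) :=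
                mul_le_mul_of_nonneg_right e1 (by positivity)
            _ = _ := by ring
        · rw [Set.indicator_of_notMem hx, image_eq_zero_of_notMem_tsupport hx]
          simp
      · simp only [hXd]
        rcases lt_trichotomy (side a b x) 0 with hx | hx | hx
        · refine tendsto_const_nhds.congr fun n => ?_
          rw [hneg _ (mul_neg_of_pos_of_neg (by positivity) hx)]
          simp
        · simp [h0 x hx]
        · obtain ⟨N, hN⟩ := exists_nat_gt (1 / side a b x)
          refine tendsto_const_nhds.congr' ?_
          filter_upwards [Filter.eventually_ge_atTop N] with n hn'
          have : (N : ℝ) ≤ n := by exact_mod_cast hn'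
          rw [div_lt_iff₀ hx] at hN
          rw [hbig _ (by nlinarith)]
          simp
    simpa using this
  have := tendsto_nhds_unique (L1.congr hid) L2.neg
  simpa using this

theorem exists_bound_pval {U : Set Pt} (hU : Bornology.IsBounded U)
    (p : MvPolynomial (Fin 2) ℝ) : ∃ C, ∀ x ∈ U, |pval p x| ≤ C := by
  obtain ⟨C, hC⟩ := hU.isCompact_closure.exists_bound_of_continuousOn
    (continuous_pval p).continuousOn
  exact ⟨C, fun x hx => hC x (subset_closure hx)⟩

theorem memLp_of_bounded {U : Set Pt} (hU : Bornology.IsBounded U)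
    {f : Pt → ℝ} (hf : AEStronglyMeasurable f (volume.restrict U)) {C : ℝ}
    (hC : ∀ᵐ x ∂(volume.restrict U), |f x| ≤ C) : MemLp f 2 (volume.restrict U) := by
  have : IsFiniteMeasure (volume.restrict U) := ⟨by
    rw [Measure.restrict_apply_univ]
    exact hU.measure_lt_top⟩
  exact MemLp.of_bound hf C hC

theorem memLp_pval {U : Set Pt} (hU : Bornology.IsBounded U) (hm : MeasurableSet U)
    (p : MvPolynomial (Fin 2) ℝ) : MemLp (pval p) 2 (volume.restrict U) := by
  obtain ⟨C, hC⟩ := exists_bound_pval hU p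
  exact memLp_of_bounded hU (continuous_pval p).aestronglyMeasurable
    (ae_restrict_of_forall_mem hm hC)

theorem IsWeakPartial.eq_pderiv {U : Set Pt} (hU : IsOpen U) (hb : Bornology.IsBounded U)
    {i : Fin 2} {f g : Pt → ℝ} {p : MvPolynomial (Fin 2) ℝ} (h : IsWeakPartial U i f g)
    (hf : f =ᵐ[volume.restrict U] pval p) (hg : MemLp g 2 (volume.restrict U)) :
    g =ᵐ[volume.restrict U] pval (MvPolynomial.pderiv i p) :=
  (h.congr hf Filter.EventuallyEq.rfl).unique hU (isWeakPartial_pval U i p) hg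
    (memLp_pval hb hU.measurableSet _)

/-- `f` coincides on `W` with `p₁` to the left and with `p₂` to the right of the line `ab`. -/
def IsTwoSided (W : Set Pt) (a b : Pt) (p₁ p₂ : MvPolynomial (Fin 2) ℝ) (f : Pt → ℝ) : Prop :=
  ∀ᵐ x ∂(volume.restrict W), (0 < side a b x → f x = pval p₁ x) ∧
    (side a b x < 0 → f x = pval p₂ x)

/-- Write `f` as `p₂` plus `p₁ - p₂` on the left half plane. The part with `p₂` cancels by parts
over the whole plane, and only the contribution of the jump remains: the defect in the weak
derivative identity. -/
theorem integral_twoSided {W : Set Pt} {a b : Pt} (hab : a ≠ b) {i : Fin 2}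
    {p₁ p₂ : MvPolynomial (Fin 2) ℝ} {f g φ : Pt → ℝ} (hf : IsTwoSided W a b p₁ p₂ f)
    (hg : IsTwoSided W a b (MvPolynomial.pderiv i p₁) (MvPolynomial.pderiv i p₂) g)
    (h1 : ContDiff ℝ ∞ φ) (h2 : HasCompactSupport φ) (h3 : tsupport φ ⊆ W) :
    (∫ x in W, f x * fderiv ℝ φ x (EuclideanSpace.single i 1)) + ∫ x in W, g x * φ x
      = ∫ x, {x | 0 < side a b x}.indicator (fun x => fderiv ℝ
          (fun x => pval (p₁ - p₂) x * φ x) x (EuclideanSpace.single i 1)) x := by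
  have hH : MeasurableSet {x | 0 < side a b x} :=
    (isOpen_lt continuous_const (continuous_side a b)).measurableSet
  have hline : ∀ᵐ x ∂(volume.restrict W), side a b x ≠ 0 :=
    ae_restrict_of_ae (by simpa [ae_iff] using volume_side_eq_zero hab)
  have hdφ : Continuous fun x => fderiv ℝ φ x (EuclideanSpace.single i 1) :=
    continuous_partial h1 i
  have hdφc := hasCompactSupport_partial h2 i
  have split : ∀ {q₁ q₂ : MvPolynomial (Fin 2) ℝ} {w θ : Pt → ℝ}, IsTwoSided W a b q₁ q₂ w →
      Continuous θ → HasCompactSupport θ → tsupport θ ⊆ W →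
      ∫ x in W, w x * θ x = (∫ x, pval q₂ x * θ x)
        + ∫ x, {x | 0 < side a b x}.indicator (fun x => pval (q₁ - q₂) x * θ x) x := by
    intro q₁ q₂ w θ hw hθ hθc hθs
    rw [← integral_add]
    · have e : ∫ x in W, w x * θ x = ∫ x in W, (pval q₂ x
          + {x | 0 < side a b x}.indicator (pval (q₁ - q₂)) x) * θ x := by
        refine integral_congr_ae ?_
        filter_upwards [hw, hline] with x hx hx0
        rcases lt_or_gt_of_ne hx0 with h | h
        · rw [hx.2 h, Set.indicator_of_notMem (by simpa using h.le), add_zero]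
        · rw [hx.1 h, Set.indicator_of_mem (by exact h), pval_sub]
          ring
      rw [e, setIntegral_mul_of_tsupport _ hθs]
      refine integral_congr_ae (Filter.Eventually.of_forall fun x => ?_)
      by_cases hx : x ∈ {x | 0 < side a b x}
      · simp only [Set.indicator_of_mem hx]
        ring
      · simp only [Set.indicator_of_notMem hx]
        ring
    · exact ((continuous_pval _).mul hθ).integrable_of_hasCompactSupport hθc.mul_left
    · exact (((continuous_pval _).mul hθ).integrable_of_hasCompactSupport
        hθc.mul_left).indicator hH
  rw [split hf hdφ hdφc ((tsupport_partial φ i).trans h3), split hg h1.continuous h2 h3,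
    integral_mul_partial (contDiff_pval p₂) (h1.of_le (by exact_mod_cast le_top)) h2]
  simp only [fderiv_pval]
  rw [add_add_add_comm, neg_add_cancel, zero_add, ← integral_add]
  · refine integral_congr_ae (Filter.Eventually.of_forall fun x => ?_)
    by_cases hx : x ∈ {x | 0 < side a b x}
    · simp only [Set.indicator_of_mem hx]
      have d := ((contDiff_pval (p₁ - p₂) (n := 1)).differentiable one_ne_zero
        x).hasFDerivAt.fun_mul (h1.differentiable (by simp) x).hasFDerivAt
      rw [d.fderiv, ← map_sub, ← fderiv_pval]
      simp
      ring
    · simp only [Set.indicator_of_notMem hx, add_zero]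
  · exact (((continuous_pval _).mul hdφ).integrable_of_hasCompactSupport
      hdφc.mul_left).indicator hH
  · exact (((continuous_pval _).mul h1.continuous).integrable_of_hasCompactSupport
      h2.mul_left).indicator hH

theorem IsTwoSided.isWeakPartial {W : Set Pt} {a b : Pt} (hab : a ≠ b) {i : Fin 2}
    {p₁ p₂ : MvPolynomial (Fin 2) ℝ} {f g : Pt → ℝ} (hf : IsTwoSided W a b p₁ p₂ f)
    (hg : IsTwoSided W a b (MvPolynomial.pderiv i p₁) (MvPolynomial.pderiv i p₂) g)
    (h : ∀ x, side a b x = 0 → pval p₁ x = pval p₂ x) : IsWeakPartial W i f g := by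
  intro φ h1 h2 h3
  have := integral_twoSided hab hf hg h1 h2 h3
  rw [integral_halfPlane_partial hab ((contDiff_pval _).mul (h1.of_le (by exact_mod_cast le_top)))
    h2.mul_left (fun x hx => by rw [pval_sub, h x hx, sub_self, zero_mul])] at this
  linarith

theorem exists_side_near {a b y : Pt} (hab : a ≠ b) (hy : side a b y = 0) {r : ℝ} (hr : 0 < r) :
    (∃ x ∈ Metric.ball y r, 0 < side a b x) ∧ ∃ x ∈ Metric.ball y r, side a b x < 0 := by
  have hn : 0 < ‖b - a‖ ^ 2 := pow_pos (norm_pos_iff.2 (sub_ne_zero.2 hab.symm)) 2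
  set m : Pt := !₂[-(b - a) 1, (b - a) 0] with hm
  have hs : ∀ s, side a b (y + s • m) = s * ‖b - a‖ ^ 2 := fun s => by
    rw [side_add_smul, hy, zero_add]
  have hball : ∀ s, |s| * (‖m‖ + 1) < r → y + s • m ∈ Metric.ball y r := fun s hs => by
    rw [Metric.mem_ball, dist_self_add_left, norm_smul, Real.norm_eq_abs]
    nlinarith [abs_nonneg s]
  have hpos : 0 < r / 2 / (‖m‖ + 1) := by positivity
  have hlt : r / 2 / (‖m‖ + 1) * (‖m‖ + 1) < r := by
    rw [div_mul_cancel₀ _ (by positivity)]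
    linarith
  refine ⟨⟨_, hball _ (by rwa [abs_of_pos hpos]), ?_⟩,
    ⟨_, hball (-(r / 2 / (‖m‖ + 1))) (by rwa [abs_neg, abs_of_pos hpos]), ?_⟩⟩
  · rw [hs]
    positivity
  · rw [hs]
    nlinarith

/-- A function with weak gradient in `L²` does not jump across a line. -/
theorem IsTwoSided.no_jump {a b y : Pt} {r : ℝ} (hr : 0 < r) (hab : a ≠ b)
    (hy : side a b y = 0) {p₁ p₂ : MvPolynomial (Fin 2) ℝ} {f : Pt → ℝ} {g : Fin 2 → Pt → ℝ}
    (hf : IsTwoSided (Metric.ball y r) a b p₁ p₂ f)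
    (hg : ∀ i, MemLp (g i) 2 (volume.restrict (Metric.ball y r)))
    (h : ∀ i, IsWeakPartial (Metric.ball y r) i f (g i)) : pval p₁ y = pval p₂ y := by
  have hop : IsOpen {x | 0 < side a b x} := isOpen_lt continuous_const (continuous_side a b)
  have hon : IsOpen {x | side a b x < 0} := isOpen_lt (continuous_side a b) continuous_const
  -- On each open side the given weak derivative must be the classical derivative of the polynomial
  -- there, by uniqueness.
  have hgs : ∀ i, IsTwoSided (Metric.ball y r) a b (MvPolynomial.pderiv i p₁)
      (MvPolynomial.pderiv i p₂) (g i) := by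
    intro i
    have side_eq : ∀ {S : Set Pt} {p : MvPolynomial (Fin 2) ℝ}, IsOpen S →
        (∀ᵐ x ∂(volume.restrict (Metric.ball y r)), x ∈ S → f x = pval p x) →
        ∀ᵐ x ∂(volume.restrict (Metric.ball y r)), x ∈ S →
          g i x = pval (MvPolynomial.pderiv i p) x := by
      intro S p hS hp
      have hW : IsOpen (S ∩ Metric.ball y r) := hS.inter Metric.isOpen_ball
      have e := IsWeakPartial.eq_pderiv hW (Metric.isBounded_ball.subset Set.inter_subset_right)
        ((h i).mono Set.inter_subset_right) (p := p) ?_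
        ((hg i).mono_measure (Measure.restrict_mono Set.inter_subset_right le_rfl))
      · rw [Filter.EventuallyEq, ← Measure.restrict_restrict hS.measurableSet,
          ae_restrict_iff' hS.measurableSet] at e
        exact e
      · rw [Filter.EventuallyEq, ← Measure.restrict_restrict hS.measurableSet,
          ae_restrict_iff' hS.measurableSet]
        exact hp
    filter_upwards [side_eq hop (hf.mono fun x hx => hx.1),
      side_eq hon (hf.mono fun x hx => hx.2)] with x h1 h2 using ⟨h1, h2⟩
  by_contra hne
  have hd0 : pval (p₁ - p₂) y ≠ 0 := by
    rw [pval_sub]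
    exact sub_ne_zero.2 hne
  obtain ⟨ρ, hρ, hsub⟩ := Metric.isOpen_iff.1 (Metric.isOpen_ball.inter
    (isOpen_ne_fun (continuous_pval (p₁ - p₂)) continuous_const)) y
    ⟨Metric.mem_ball_self hr, hd0⟩
  -- Near a point with nonzero jump a test function `ψ` may be divided by `p₁ - p₂`. The defect
  -- formula then says that the indicator of the half disc has zero weak gradient, so it would be
  -- constant.
  have hweak : ∀ i, IsWeakPartial (Metric.ball y ρ) i ({x | 0 < side a b x}.indicator 1) 0 := by
    intro i ψ h1 h2 h3
    have hφ : ContDiff ℝ ∞ fun x => ψ x / pval (p₁ - p₂) x := by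
      rw [contDiff_iff_contDiffAt]
      intro x
      by_cases hx : x ∈ tsupport ψ
      · exact h1.contDiffAt.div (contDiff_pval _).contDiffAt (hsub (h3 hx)).2
      · refine contDiffAt_const (c := 0) |>.congr_of_eventuallyEq ?_
        filter_upwards [notMem_tsupport_iff_eventuallyEq.1 hx] with z hz
        rw [hz, Pi.zero_apply, zero_div]
    have hsup : tsupport (fun x => ψ x / pval (p₁ - p₂) x) ⊆ tsupport ψ :=
      closure_mono fun x hx => by
        rw [Function.mem_support] at hx ⊢
        exact fun h0 => hx (by rw [h0, zero_div])
    have hc : HasCompactSupport fun x => ψ x / pval (p₁ - p₂) x :=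
      h2.of_isClosed_subset (isClosed_tsupport _) hsup
    have hsr : tsupport (fun x => ψ x / pval (p₁ - p₂) x) ⊆ Metric.ball y r :=
      hsup.trans fun x hx => (hsub (h3 hx)).1
    have key := integral_twoSided hab hf (hgs i) hφ hc hsr
    rw [h i _ hφ hc hsr, neg_add_cancel] at key
    have hψ : (fun x => pval (p₁ - p₂) x * (ψ x / pval (p₁ - p₂) x)) = ψ := by
      funext x
      by_cases hx : x ∈ tsupport ψ
      · exact mul_div_cancel₀ _ (hsub (h3 hx)).2
      · rw [image_eq_zero_of_notMem_tsupport hx, zero_div, mul_zero]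
    rw [hψ] at key
    rw [setIntegral_mul_of_tsupport _ ((tsupport_partial ψ i).trans h3)]
    simp only [Pi.zero_apply, zero_mul, integral_zero, neg_zero]
    refine (integral_congr_ae (Filter.Eventually.of_forall fun x => ?_)).trans key.symm
    by_cases hx : x ∈ {x | 0 < side a b x}
    · simp only [Set.indicator_of_mem hx, Pi.one_apply, one_mul]
    · simp only [Set.indicator_of_notMem hx, zero_mul]
  obtain ⟨c, hc⟩ := IsWeakPartial.ae_const Metric.isOpen_ball (convex_ball y ρ).isPreconnected
    (memLp_of_bounded Metric.isBounded_ball (C := 1)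
      ((measurable_one.indicator hop.measurableSet).aestronglyMeasurable)
      (Filter.Eventually.of_forall fun x => by
        by_cases hx : x ∈ {x | 0 < side a b x}
        · simp [Set.indicator_of_mem hx]
        · simp [Set.indicator_of_notMem hx])) hweak
  have pick : ∀ S : Set Pt, IsOpen S → (∃ x ∈ Metric.ball y ρ, x ∈ S) →
      ∃ x ∈ S, {x | 0 < side a b x}.indicator (1 : Pt → ℝ) x = c := by
    rintro S hS ⟨x, hxb, hxS⟩
    have hpos : volume (Metric.ball y ρ ∩ S) ≠ 0 :=
      ((Metric.isOpen_ball.inter hS).measure_pos _ ⟨x, hxb, hxS⟩).ne'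
    have : (ae (volume.restrict (Metric.ball y ρ ∩ S))).NeBot := by
      rwa [ae_neBot, Ne, Measure.restrict_eq_zero]
    obtain ⟨z, hz, hzS⟩ := ((ae_restrict_of_ae_restrict_of_subset Set.inter_subset_left hc).and
      (ae_restrict_mem (Metric.isOpen_ball.inter hS).measurableSet)).exists
    exact ⟨z, hzS.2, hz⟩
  obtain ⟨hp, hn⟩ := exists_side_near hab hy hρ
  obtain ⟨x, hx, hxc⟩ := pick _ hop hp
  obtain ⟨z, hz, hzc⟩ := pick _ hon hn
  rw [Set.indicator_of_mem hx, Pi.one_apply] at hxc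
  rw [Set.indicator_of_notMem (by simpa using le_of_lt hz)] at hzc
  exact one_ne_zero (hxc.trans hzc.symm)

/-! ### Triangles and quadrilaterals as intersections of half planes -/

theorem side_affine (a b x y : Pt) (t : ℝ) :
    side a b (x + t • (y - x)) = (1 - t) * side a b x + t * side a b y := by
  simp only [side_apply, PiLp.add_apply, PiLp.smul_apply, PiLp.sub_apply, smul_eq_mul]
  ring

theorem side_cyc (a b c : Pt) : side b c a = side a b c := by
  simp only [side_apply]
  ring

theorem side_swap (a b x : Pt) : side b a x = -side a b x := by
  simp only [side_apply]
  ring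

theorem side_left (a b : Pt) : side a b a = 0 := by simp [side_apply]

theorem side_right (a b : Pt) : side a b b = 0 := by
  simp only [side_apply]
  ring

theorem cross_eq_side (a b c : Pt) : cross (b - a) (c - b) = side a b c := by
  simp only [cross, side_apply, PiLp.sub_apply]
  ring

theorem ne_of_side_pos {a b c : Pt} (h : 0 < side a b c) : a ≠ b := by
  rintro rfl
  simp [side_apply] at h

theorem convex_side_nonneg (a b : Pt) : Convex ℝ {x | 0 ≤ side a b x} := by
  intro x hx y hy s t hs ht hst
  have : s • x + t • y = x + t • (y - x) := by
    rw [← eq_sub_iff_add_eq] at hst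
    rw [hst]
    module
  rw [Set.mem_ofPred_eq, this, side_affine, ← hst, add_sub_cancel_right]
  exact add_nonneg (mul_nonneg hs hx) (mul_nonneg ht hy)

theorem interior_side_nonneg {a b : Pt} (hab : a ≠ b) :
    interior {x | 0 ≤ side a b x} = {x | 0 < side a b x} := by
  refine Set.Subset.antisymm (fun x hx => ?_)
    (interior_maximal (fun x (hx : 0 < side a b x) => hx.le)
      (isOpen_lt continuous_const (continuous_side a b)))
  have hx0 : x ∈ {x | 0 ≤ side a b x} := interior_subset hx
  refine lt_of_le_of_ne (a := (0 : ℝ)) (b := side a b x) hx0 fun h => ?_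
  obtain ⟨r, hr, hb⟩ := Metric.isOpen_iff.1 isOpen_interior x hx
  obtain ⟨y, hy, hy'⟩ := (exists_side_near hab h.symm hr).2
  exact absurd hy' (not_lt.2 (show y ∈ {x | 0 ≤ side a b x} from interior_subset (hb hy)))

/-- The values of `side`, divided by the doubled area, are the barycentric coordinates. -/
theorem convexHull_triangle {a b c : Pt} (h : 0 < side a b c) :
    convexHull ℝ {a, b, c} = {x | 0 ≤ side a b x} ∩ {x | 0 ≤ side b c x}
      ∩ {x | 0 ≤ side c a x} := by
  have h1 : 0 < side b c a := by rwa [side_cyc]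
  have h2 : 0 < side c a b := by rwa [side_cyc]
  refine Set.Subset.antisymm (convexHull_min ?_ (((convex_side_nonneg a b).inter
    (convex_side_nonneg b c)).inter (convex_side_nonneg c a))) ?_
  · rintro x (rfl | rfl | rfl)
    · exact ⟨⟨(side_left _ _).ge, h1.le⟩, (side_right _ _).ge⟩
    · exact ⟨⟨(side_right _ _).ge, (side_left _ _).ge⟩, h2.le⟩
    · exact ⟨⟨h.le, (side_right _ _).ge⟩, (side_left _ _).ge⟩
  · rintro x ⟨⟨ha, hb⟩, hc⟩
    have hsum : side b c x + side c a x + side a b x = side a b c := by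
      simp only [side_apply]
      ring
    have := (convex_convexHull ℝ {a, b, c}).sum_mem (t := Finset.univ)
      (w := ![side b c x / side a b c, side c a x / side a b c, side a b x / side a b c])
      (z := ![a, b, c]) ?_ ?_ ?_
    · convert! this using 1
      ext i
      have e : ∀ i, x i * side a b c = side b c x * a i + side c a x * b i + side a b x * c i := by
        intro i
        simp only [side_apply]
        fin_cases i <;> simp <;> ring
      have e' := e i
      simp [Fin.sum_univ_three]
      field_simp
      linarith
    · intro i _
      fin_cases i
      · exact div_nonneg hb h.le
      · exact div_nonneg hc h.le
      · exact div_nonneg ha h.le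
    · simp [Fin.sum_univ_three]
      rw [← add_div, ← add_div, hsum, div_self h.ne']
    · intro i _
      refine subset_convexHull ℝ _ ?_
      fin_cases i <;> simp

theorem interior_triangle {a b c : Pt} (h : 0 < side a b c) :
    interior (convexHull ℝ {a, b, c}) = {x | 0 < side a b x} ∩ {x | 0 < side b c x}
      ∩ {x | 0 < side c a x} := by
  rw [convexHull_triangle h, interior_inter, interior_inter,
    interior_side_nonneg (ne_of_side_pos h), interior_side_nonneg, interior_side_nonneg]
  · exact ne_of_side_pos (c := b) (by rwa [← side_cyc])
  · exact ne_of_side_pos (c := a) (by rwa [side_cyc])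

/-- The polygon turns strictly left at every vertex. -/
def TurnsLeft (v : Fin 4 → Pt) : Prop := ∀ j, 0 < side (v j) (v (j + 1)) (v (j + 2))

theorem QuadMesh.turnsLeft {ι : Type*} (M : QuadMesh ι) (Q : ι) : TurnsLeft (M.vert Q) :=
  fun j => by
    rw [← cross_eq_side]
    exact M.convex Q j

theorem fin4_idx (j : Fin 4) : j + 1 + 1 = j + 2 ∧ j + 1 + 2 = j + 3 ∧ j + 2 + 1 = j + 3 ∧
    j + 2 + 2 = j ∧ j + 3 + 1 = j ∧ j + 3 + 2 = j + 1 ∧ j + 1 + 3 = j ∧ j + 2 + 3 = j + 1 := by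
  fin_cases j <;> decide

theorem TurnsLeft.prev {v : Fin 4 → Pt} (hv : TurnsLeft v) (j : Fin 4) :
    0 < side (v j) (v (j + 1)) (v (j + 3)) := by
  have := hv (j + 3)
  rwa [(fin4_idx j).2.2.2.2.1, (fin4_idx j).2.2.2.2.2.1, ← side_cyc] at this

theorem TurnsLeft.ne {v : Fin 4 → Pt} (hv : TurnsLeft v) (j : Fin 4) : v j ≠ v (j + 1) :=
  ne_of_side_pos (hv j)

theorem TurnsLeft.side_vertex_nonneg {v : Fin 4 → Pt} (hv : TurnsLeft v) (i j : Fin 4) :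
    0 ≤ side (v j) (v (j + 1)) (v i) := by
  obtain rfl | rfl | rfl | rfl : i = j ∨ i = j + 1 ∨ i = j + 2 ∨ i = j + 3 := by
    revert i j
    decide
  · exact (side_left _ _).ge
  · exact (side_right _ _).ge
  · exact (hv j).le
  · exact (hv.prev j).le

/-- The diagonal from `v 0` to `v 2` cuts the intersection of half planes into two triangles spanned
by vertices. -/
theorem quad_eq {v : Fin 4 → Pt} (hv : TurnsLeft v) :
    quad v = ⋂ j, {x | 0 ≤ side (v j) (v (j + 1)) x} := by
  refine Set.Subset.antisymm (convexHull_min ?_ (convex_iInter fun j => convex_side_nonneg _ _)) ?_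
  · rintro _ ⟨i, rfl⟩
    exact Set.mem_iInter.2 fun j => hv.side_vertex_nonneg i j
  · intro x hx
    have hx' : ∀ j, 0 ≤ side (v j) (v (j + 1)) x := fun j => Set.mem_iInter.1 hx j
    rcases le_total 0 (side (v 2) (v 0) x) with h | h
    · refine convexHull_mono (s := {v 0, v 1, v 2}) ?_ ?_
      · rintro _ (rfl | rfl | rfl) <;> exact ⟨_, rfl⟩
      · rw [convexHull_triangle (show 0 < side (v 0) (v 1) (v 2) from hv 0)]
        exact ⟨⟨hx' 0, hx' 1⟩, h⟩
    · refine convexHull_mono (s := {v 2, v 3, v 0}) ?_ ?_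
      · rintro _ (rfl | rfl | rfl) <;> exact ⟨_, rfl⟩
      · rw [convexHull_triangle (show 0 < side (v 2) (v 3) (v 0) from hv 2)]
        refine ⟨⟨hx' 2, hx' 3⟩, ?_⟩
        rw [Set.mem_ofPred_eq, side_swap]
        linarith

theorem mem_quad {v : Fin 4 → Pt} (hv : TurnsLeft v) {x : Pt} :
    x ∈ quad v ↔ ∀ j, 0 ≤ side (v j) (v (j + 1)) x := by
  rw [quad_eq hv]
  exact Set.mem_iInter

theorem mem_interior_quad {v : Fin 4 → Pt} (hv : TurnsLeft v) {x : Pt} :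
    x ∈ interior (quad v) ↔ ∀ j, 0 < side (v j) (v (j + 1)) x := by
  rw [quad_eq hv, interior_iInter_of_finite, Set.mem_iInter]
  simp only [interior_side_nonneg (hv.ne _), Set.mem_ofPred_eq]

theorem vertex_mem_quad (v : Fin 4 → Pt) (j : Fin 4) : v j ∈ quad v :=
  subset_convexHull ℝ _ ⟨j, rfl⟩

theorem isClosed_quad {v : Fin 4 → Pt} (hv : TurnsLeft v) : IsClosed (quad v) := by
  rw [quad_eq hv]
  exact isClosed_iInter fun j => isClosed_le continuous_const (continuous_side _ _)

theorem isBounded_quad (v : Fin 4 → Pt) : Bornology.IsBounded (quad v) :=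
  isBounded_convexHull.2 (Set.finite_range v).isBounded

/-- The intersection point of the diagonals divides each of them properly. -/
theorem exists_center_eq {v : Fin 4 → Pt} (hv : TurnsLeft v) (j : Fin 4) :
    ∃ s : ℝ, 0 < s ∧ s < 1 ∧ quadCenter v = v j + s • (v (j + 2) - v j) := by
  have h0 : 0 < side (v 0) (v 1) (v 2) := hv 0
  have h1 : 0 < side (v 1) (v 2) (v 3) := hv 1
  have h2 : 0 < side (v 2) (v 3) (v 0) := hv 2
  have h3 : 0 < side (v 3) (v 0) (v 1) := hv 3
  -- The division ratios of the diagonals are quotients of signed areas of vertex triangles. Both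
  -- pairs of opposite triangles have the same total area (`hS'`), which serves as common
  -- denominator.
  have hS : cross (v 2 - v 0) (v 3 - v 1)
      = side (v 1) (v 2) (v 3) + side (v 3) (v 0) (v 1) := by
    simp only [cross, side_apply, PiLp.sub_apply]
    ring
  have hS' : side (v 1) (v 2) (v 3) + side (v 3) (v 0) (v 1)
      = side (v 0) (v 1) (v 2) + side (v 2) (v 3) (v 0) := by
    simp only [side_apply]
    ring
  have hN : cross (v 1 - v 0) (v 3 - v 1) = side (v 3) (v 0) (v 1) := by
    simp only [cross, side_apply, PiLp.sub_apply]
    ring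
  have hpos := add_pos h1 h3
  have e0 : quadCenter v = v 0 + (side (v 3) (v 0) (v 1)
      / (side (v 1) (v 2) (v 3) + side (v 3) (v 0) (v 1))) • (v 2 - v 0) := by
    rw [quadCenter, hS, hN]
  have e1 : quadCenter v = v 1 + (side (v 0) (v 1) (v 2)
      / (side (v 1) (v 2) (v 3) + side (v 3) (v 0) (v 1))) • (v 3 - v 1) := by
    have hne := hpos.ne'
    rw [e0]
    ext i
    simp only [PiLp.add_apply, PiLp.smul_apply, PiLp.sub_apply, smul_eq_mul]
    field_simp
    simp only [side_apply]
    fin_cases i <;> simp <;> ring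
  have l0 : side (v 3) (v 0) (v 1) / (side (v 1) (v 2) (v 3) + side (v 3) (v 0) (v 1)) < 1 := by
    rw [div_lt_one hpos]
    linarith
  have l1 : side (v 0) (v 1) (v 2) / (side (v 1) (v 2) (v 3) + side (v 3) (v 0) (v 1)) < 1 := by
    rw [div_lt_one hpos]
    linarith
  have p0 := div_pos h3 hpos
  have p1 := div_pos h0 hpos
  fin_cases j
  · exact ⟨_, p0, l0, e0⟩
  · exact ⟨_, p1, l1, e1⟩
  · refine ⟨_, sub_pos.2 l0, sub_lt_self 1 p0, ?_⟩
    change _ = v 2 + _ • (v 0 - v 2)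
    rw [e0]
    module
  · refine ⟨_, sub_pos.2 l1, sub_lt_self 1 p1, ?_⟩
    change _ = v 3 + _ • (v 1 - v 3)
    rw [e1]
    module

theorem side_center_pos {v : Fin 4 → Pt} (hv : TurnsLeft v) (j : Fin 4) :
    0 < side (v j) (v (j + 1)) (quadCenter v) := by
  obtain ⟨s, hs, -, e⟩ := exists_center_eq hv j
  rw [e, side_affine, side_left, mul_zero, zero_add]
  exact mul_pos hs (hv j)

/-- The centre lies strictly inside both diagonals, so the two inner sides of the triangle may be
replaced by the full diagonals up to a positive factor. -/
theorem mem_tri {v : Fin 4 → Pt} (hv : TurnsLeft v) {j : Fin 4} {x : Pt} :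
    x ∈ interior (convexHull ℝ {v j, v (j + 1), quadCenter v}) ↔
      0 < side (v j) (v (j + 1)) x ∧ 0 < side (v (j + 1)) (v (j + 3)) x ∧
        0 < side (v (j + 2)) (v j) x := by
  rw [interior_triangle (side_center_pos hv j)]
  obtain ⟨s, hs, -, e⟩ := exists_center_eq hv j
  obtain ⟨t, ht, -, e'⟩ := exists_center_eq hv (j + 1)
  rw [(fin4_idx j).2.1] at e'
  have h1 : side (v (j + 1)) (quadCenter v) x = t * side (v (j + 1)) (v (j + 3)) x := by
    rw [e']
    simp only [side_apply, PiLp.add_apply, PiLp.smul_apply, PiLp.sub_apply, smul_eq_mul]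
    ring
  have h2 : side (quadCenter v) (v j) x = s * side (v (j + 2)) (v j) x := by
    rw [e]
    simp only [side_apply, PiLp.add_apply, PiLp.smul_apply, PiLp.sub_apply, smul_eq_mul]
    ring
  simp only [Set.mem_inter_iff, Set.mem_ofPred_eq, h1, h2, mul_pos_iff_of_pos_left hs,
    mul_pos_iff_of_pos_left ht, and_assoc]

theorem center_mem_quad {v : Fin 4 → Pt} (hv : TurnsLeft v) : quadCenter v ∈ quad v :=
  (mem_quad hv).2 fun j => (side_center_pos hv j).le

theorem tri_subset_interior_quad {v : Fin 4 → Pt} (hv : TurnsLeft v) (j : Fin 4) :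
    interior (convexHull ℝ {v j, v (j + 1), quadCenter v}) ⊆ interior (quad v) := by
  refine interior_mono (convexHull_min ?_ (convex_convexHull ℝ _))
  rintro _ (rfl | rfl | rfl)
  · exact vertex_mem_quad v _
  · exact vertex_mem_quad v _
  · exact center_mem_quad hv

/-- The signs of the two diagonal functions tell the four triangles apart. -/
theorem tri_disjoint {v : Fin 4 → Pt} (hv : TurnsLeft v) {i j : Fin 4} {x : Pt}
    (hi : x ∈ interior (convexHull ℝ {v i, v (i + 1), quadCenter v}))
    (hj : x ∈ interior (convexHull ℝ {v j, v (j + 1), quadCenter v})) : i = j := by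
  rw [mem_tri hv] at hi hj
  obtain ⟨-, hi1, hi2⟩ := hi
  obtain ⟨-, hj1, hj2⟩ := hj
  have s02 := side_swap (v 0) (v 2) x
  have s13 := side_swap (v 1) (v 3) x
  fin_cases i <;> fin_cases j <;> simp at hi1 hi2 hj1 hj2 ⊢ <;> linarith

/-- `y` lies in the relative interior of the `j`-th edge. -/
def OnEdge (v : Fin 4 → Pt) (j : Fin 4) (y : Pt) : Prop :=
  ∃ t : ℝ, 0 < t ∧ t < 1 ∧ y = v j + t • (v (j + 1) - v j)

theorem OnEdge.side_eq_zero {v : Fin 4 → Pt} {j : Fin 4} {y : Pt} (h : OnEdge v j y) :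
    side (v j) (v (j + 1)) y = 0 := by
  obtain ⟨t, -, -, rfl⟩ := h
  exact side_line _ _ _

theorem OnEdge.eventually_mem_tri {v : Fin 4 → Pt} (hv : TurnsLeft v) {j : Fin 4} {y : Pt}
    (h : OnEdge v j y) : ∀ᶠ x in nhds y, 0 < side (v j) (v (j + 1)) x →
      x ∈ interior (convexHull ℝ {v j, v (j + 1), quadCenter v}) := by
  obtain ⟨t, ht0, ht1, rfl⟩ := h
  have e1 : 0 < side (v (j + 1)) (v (j + 3)) (v j + t • (v (j + 1) - v j)) := by
    rw [side_affine, side_left, mul_zero, add_zero, side_cyc]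
    exact mul_pos (sub_pos.2 ht1) (hv.prev j)
  have e2 : 0 < side (v (j + 2)) (v j) (v j + t • (v (j + 1) - v j)) := by
    rw [side_affine, side_right, mul_zero, zero_add, ← side_cyc]
    exact mul_pos ht0 (hv j)
  filter_upwards [(continuous_side _ _).continuousAt.eventually (lt_mem_nhds e1),
    (continuous_side _ _).continuousAt.eventually (lt_mem_nhds e2)] with x h1 h2 h0
  exact (mem_tri hv).2 ⟨h0, h1, h2⟩

theorem OnEdge.side_pos {v : Fin 4 → Pt} (hv : TurnsLeft v) {i j : Fin 4} {y : Pt}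
    (h : OnEdge v j y) (hij : i ≠ j) : 0 < side (v i) (v (i + 1)) y := by
  obtain ⟨t, ht0, ht1, rfl⟩ := h
  obtain ⟨i1, i2, i3, i4, i5, i6, i7, i8⟩ := fin4_idx j
  obtain rfl | rfl | rfl : i = j + 1 ∨ i = j + 2 ∨ i = j + 3 := by
    clear * - hij
    revert i j
    decide
  · rw [i1, side_affine, side_left, mul_zero, add_zero, side_cyc]
    exact mul_pos (sub_pos.2 ht1) (hv j)
  · have k1 := hv (j + 2)
    have k2 := hv (j + 1)
    rw [i3, i4] at k1
    rw [i1, i2, ← side_cyc] at k2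
    rw [i3, side_affine]
    exact add_pos (mul_pos (sub_pos.2 ht1) k1) (mul_pos ht0 k2)
  · have k := hv (j + 3)
    rw [i5, i6] at k
    rw [i5, side_affine, side_right, mul_zero, zero_add]
    exact mul_pos ht0 k

theorem OnEdge.eventually_mem_quad {v : Fin 4 → Pt} (hv : TurnsLeft v) {j : Fin 4} {y : Pt}
    (h : OnEdge v j y) : ∀ᶠ x in nhds y, 0 ≤ side (v j) (v (j + 1)) x → x ∈ quad v := by
  have : ∀ i, ∀ᶠ x in nhds y, i ≠ j → 0 < side (v i) (v (i + 1)) x := fun i => by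
    by_cases hi : i = j
    · simp [hi]
    · simpa [hi] using (continuous_side _ _).continuousAt.eventually (lt_mem_nhds (h.side_pos hv hi))
  filter_upwards [Filter.eventually_all.2 this] with x hx h0
  refine (mem_quad hv).2 fun i => ?_
  by_cases hi : i = j
  · rwa [hi]
  · exact (hx i hi).le

theorem onEdge_of_mem_quad {v : Fin 4 → Pt} (hv : TurnsLeft v) {j : Fin 4} {y : Pt}
    (hy : y ∈ quad v) (h0 : side (v j) (v (j + 1)) y = 0) (hne : ∀ i, y ≠ v i) :
    OnEdge v j y := by
  obtain ⟨i1, i2, i3, i4, i5, i6, i7, i8⟩ := fin4_idx j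
  obtain ⟨t, rfl⟩ := exists_on_line_of_side_eq_zero (hv.ne j) h0
  have h1 := (mem_quad hv).1 hy (j + 1)
  have h3 := (mem_quad hv).1 hy (j + 3)
  rw [i1, side_affine, side_left, mul_zero, add_zero, side_cyc] at h1
  rw [i5, side_affine, side_right, mul_zero, zero_add] at h3
  have k := hv (j + 3)
  rw [i5, i6] at k
  have ht0 := nonneg_of_mul_nonneg_left h3 k
  have ht1 := nonneg_of_mul_nonneg_left h1 (hv j)
  refine ⟨t, lt_of_le_of_ne ht0 ?_, lt_of_le_of_ne (by linarith) ?_, rfl⟩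
  · rintro rfl
    exact hne j (by simp)
  · rintro rfl
    exact hne (j + 1) (by simp)

theorem OnEdge.eq_of_side_eq_zero {v : Fin 4 → Pt} (hv : TurnsLeft v) {i j : Fin 4} {y : Pt}
    (h : OnEdge v j y) (hi : side (v i) (v (i + 1)) y = 0) : i = j := by
  by_contra hij
  exact (h.side_pos hv hij).ne' hi

theorem eq_center_of_side_eq_zero {v : Fin 4 → Pt} (hv : TurnsLeft v) {y : Pt}
    (h0 : side (v 0) (v 2) y = 0) (h1 : side (v 1) (v 3) y = 0) : y = quadCenter v := by
  have k0 : 0 < side (v 0) (v 1) (v 3) := hv.prev 0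
  have k1 : 0 < side (v 1) (v 2) (v 3) := hv 1
  have hne : v 0 ≠ v 2 := ne_of_side_pos (c := v 3) (by
    rw [← side_cyc]
    exact hv 2)
  obtain ⟨t, rfl⟩ := exists_on_line_of_side_eq_zero hne h0
  obtain ⟨s, -, -, es⟩ := exists_center_eq hv 0
  obtain ⟨s', -, -, es'⟩ := exists_center_eq hv 1
  have hc : side (v 1) (v 3) (quadCenter v) = 0 := by
    rw [es']
    exact side_line _ _ _
  rw [es] at hc ⊢
  change side (v 1) (v 3) (v 0 + s • (v 2 - v 0)) = 0 at hc
  change _ = v 0 + s • (v 2 - v 0)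
  have hA : side (v 1) (v 3) (v 0) = side (v 0) (v 1) (v 3) := side_cyc _ _ _
  have hB : side (v 1) (v 3) (v 2) = -side (v 1) (v 2) (v 3) := by
    simp only [side_apply]
    ring
  rw [side_affine, hA, hB] at hc h1
  have : (t - s) * (side (v 0) (v 1) (v 3) + side (v 1) (v 2) (v 3)) = 0 := by linarith
  rw [sub_eq_zero.1 ((mul_eq_zero.1 this).resolve_right (add_pos k0 k1).ne')]

namespace QuadMesh

/-! ### Local structure of a criss-cross mesh -/

variable {ι : Type*} (M : QuadMesh ι)

/-- The vertices and centres of all cells. -/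
def nodes : Set Pt := ⋃ Q, (Set.range (M.vert Q) ∪ {quadCenter (M.vert Q)})

theorem finite_nodes [Finite ι] : M.nodes.Finite :=
  Set.finite_iUnion fun _ => (Set.finite_range _).union (Set.finite_singleton _)

theorem vert_mem_nodes (Q : ι) (j : Fin 4) : M.vert Q j ∈ M.nodes :=
  Set.mem_iUnion.2 ⟨Q, Or.inl ⟨j, rfl⟩⟩

theorem center_mem_nodes (Q : ι) : quadCenter (M.vert Q) ∈ M.nodes :=
  Set.mem_iUnion.2 ⟨Q, Or.inr rfl⟩

theorem isOpen_domain : IsOpen M.domain := isOpen_interior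

theorem isOpen_cell (Q : ι) : IsOpen (M.cell Q) := isOpen_interior

theorem isOpen_tri (Q : ι) (j : Fin 4) : IsOpen (M.tri Q j) := isOpen_interior

theorem isBounded_domain [Finite ι] : Bornology.IsBounded M.domain :=
  (Bornology.isBounded_iUnion.2 fun _ => isBounded_quad _).subset interior_subset

theorem tri_subset_cell (Q : ι) (j : Fin 4) : M.tri Q j ⊆ M.cell Q :=
  tri_subset_interior_quad (M.turnsLeft Q) j

theorem tri_subset_domain (Q : ι) (j : Fin 4) : M.tri Q j ⊆ M.domain :=
  (M.tri_subset_cell Q j).trans (M.cell_subset_domain Q)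

theorem convex_tri (Q : ι) (j : Fin 4) : Convex ℝ (M.tri Q j) :=
  (convex_convexHull ℝ _).interior

theorem vert_mem_closure_tri (Q : ι) (j : Fin 4) : M.vert Q j ∈ closure (M.tri Q j) := by
  have hne : (M.tri Q j).Nonempty := by
    have h : OnEdge (M.vert Q) j (M.vert Q j + (1 / 2 : ℝ) • (M.vert Q (j + 1) - M.vert Q j)) :=
      ⟨1 / 2, by norm_num, by norm_num, rfl⟩
    obtain ⟨r, hr, hb⟩ := Metric.eventually_nhds_iff_ball.1
      (h.eventually_mem_tri (M.turnsLeft Q))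
    obtain ⟨x, hx, hx'⟩ := (exists_side_near ((M.turnsLeft Q).ne j) h.side_eq_zero hr).1
    exact ⟨x, hb x hx hx'⟩
  rw [tri, (convex_convexHull ℝ _).closure_interior_eq_closure_of_nonempty_interior hne]
  exact subset_closure (subset_convexHull ℝ _ (by simp))

theorem tri_nonempty (Q : ι) (j : Fin 4) : (M.tri Q j).Nonempty :=
  closure_nonempty_iff.1 ⟨_, M.vert_mem_closure_tri Q j⟩

/-- All side functions are positive in an open cell, whereas a shared vertex or edge lies on the
zero set of one of them. -/
theorem cell_disjoint {Q Q' : ι} (h : Q ≠ Q') {x : Pt} (hx : x ∈ M.cell Q)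
    (hx' : x ∈ M.cell Q') : False := by
  have hq := (mem_interior_quad (M.turnsLeft Q)).1 hx
  have hmem : x ∈ quad (M.vert Q) ∩ quad (M.vert Q') :=
    ⟨interior_subset hx, interior_subset hx'⟩
  rcases M.conforming Q Q' h with e | ⟨j, -, -, e⟩ | ⟨j, -, -, e⟩
  · rw [e] at hmem
    exact hmem
  · rw [e, Set.mem_singleton_iff] at hmem
    have := hq j
    rw [hmem, side_left] at this
    exact this.false
  · rw [e, segment_eq_image'] at hmem
    obtain ⟨t, -, rfl⟩ := hmem
    have := hq j
    rw [side_line] at this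
    exact this.false

theorem tri_eq_of_mem {Q Q' : ι} {j j' : Fin 4} {x : Pt} (hx : x ∈ M.tri Q j)
    (hx' : x ∈ M.tri Q' j') : Q = Q' ∧ j = j' := by
  by_cases h : Q = Q'
  · subst h
    exact ⟨rfl, tri_disjoint (M.turnsLeft Q) hx hx'⟩
  · exact (M.cell_disjoint h (M.tri_subset_cell _ _ hx) (M.tri_subset_cell _ _ hx')).elim

/-- Cells on both sides of a common edge run through it in opposite directions. -/
theorem opposite_of_quadEdge_eq {Q Q' : ι} (h : Q ≠ Q') {j j' : Fin 4}
    (he : quadEdge (M.vert Q) j = quadEdge (M.vert Q') j') :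
    M.vert Q' j' = M.vert Q (j + 1) ∧ M.vert Q' (j' + 1) = M.vert Q j := by
  rcases Sym2.eq_iff.1 he with ⟨h1, h2⟩ | ⟨h1, h2⟩
  · exfalso
    -- With equal orientation both triangles would lie to the left of the edge and overlap near its
    -- midpoint.
    have e : OnEdge (M.vert Q) j (M.vert Q j + (1 / 2 : ℝ) • (M.vert Q (j + 1) - M.vert Q j)) :=
      ⟨1 / 2, by norm_num, by norm_num, rfl⟩
    have e' : OnEdge (M.vert Q') j'
        (M.vert Q j + (1 / 2 : ℝ) • (M.vert Q (j + 1) - M.vert Q j)) :=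
      ⟨1 / 2, by norm_num, by norm_num, by rw [h1, h2]⟩
    obtain ⟨r, hr, hb⟩ := Metric.eventually_nhds_iff_ball.1
      ((e.eventually_mem_tri (M.turnsLeft Q)).and (e'.eventually_mem_tri (M.turnsLeft Q')))
    obtain ⟨x, hx, hx'⟩ := (exists_side_near ((M.turnsLeft Q).ne j) e.side_eq_zero hr).1
    have := hb x hx
    exact h (M.tri_eq_of_mem (this.1 hx') (this.2 (by rwa [← h1, ← h2]))).1
  · exact ⟨h2.symm, h1.symm⟩

/-- A point in two cells which is not a vertex lies on a common edge. -/
theorem exists_common_edge {Q Q' : ι} (h : Q ≠ Q') {y : Pt} (hy : y ∈ quad (M.vert Q))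
    (hy' : y ∈ quad (M.vert Q')) (hne : ∀ i, y ≠ M.vert Q i) :
    ∃ j j', OnEdge (M.vert Q) j y ∧ quadEdge (M.vert Q) j = quadEdge (M.vert Q') j' := by
  have hmem : y ∈ quad (M.vert Q) ∩ quad (M.vert Q') := ⟨hy, hy'⟩
  rcases M.conforming Q Q' h with e | ⟨j, -, -, e⟩ | ⟨j, j', he, e⟩
  · rw [e] at hmem
    exact hmem.elim
  · rw [e, Set.mem_singleton_iff] at hmem
    exact (hne j hmem).elim
  · rw [e, segment_eq_image'] at hmem
    obtain ⟨t, -, rfl⟩ := hmem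
    exact ⟨j, j', onEdge_of_mem_quad (M.turnsLeft Q) hy (side_line _ _ _) hne, he⟩

/-- In the ball of radius `r` about `y` the mesh consists of the two triangles `S` and `T`,
separated by the line through the nodes `a` and `b`; either both lie in a cell containing the
ball, or `ab` is a common edge of two cells. -/
structure IsInterface (y : Pt) (r : ℝ) (S T : ι × Fin 4) (a b : Pt) : Prop where
  pos : 0 < r
  ne : a ≠ b
  on_line : side a b y = 0
  left : ∀ x ∈ Metric.ball y r, 0 < side a b x → x ∈ M.tri S.1 S.2
  right : ∀ x ∈ Metric.ball y r, side a b x < 0 → x ∈ M.tri T.1 T.2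
  ball_subset : Metric.ball y r ⊆ M.domain
  left_mem : a ∈ M.nodes
  right_mem : b ∈ M.nodes
  kind : (S.1 = T.1 ∧ Metric.ball y r ⊆ M.cell S.1) ∨
    (S.1 ≠ T.1 ∧ quadEdge (M.vert S.1) S.2 = quadEdge (M.vert T.1) T.2 ∧
      a = M.vert S.1 S.2 ∧ b = M.vert S.1 (S.2 + 1))

theorem exists_isInterface_of_onEdge {Q Q' : ι} (h : Q ≠ Q') {j j' : Fin 4}
    (he : quadEdge (M.vert Q) j = quadEdge (M.vert Q') j') {y : Pt}
    (hy : OnEdge (M.vert Q) j y) :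
    ∃ r, M.IsInterface y r (Q, j) (Q', j') (M.vert Q j) (M.vert Q (j + 1)) := by
  obtain ⟨h1, h2⟩ := M.opposite_of_quadEdge_eq h he
  have hy' : OnEdge (M.vert Q') j' y := by
    obtain ⟨t, ht0, ht1, rfl⟩ := hy
    refine ⟨1 - t, by linarith, by linarith, ?_⟩
    rw [h1, h2]
    module
  have hs : ∀ x, side (M.vert Q' j') (M.vert Q' (j' + 1)) x
      = -side (M.vert Q j) (M.vert Q (j + 1)) x := fun x => by rw [h1, h2, side_swap]
  obtain ⟨r, hr, hb⟩ := Metric.eventually_nhds_iff_ball.1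
    (((hy.eventually_mem_tri (M.turnsLeft Q)).and (hy'.eventually_mem_tri (M.turnsLeft Q'))).and
      ((hy.eventually_mem_quad (M.turnsLeft Q)).and (hy'.eventually_mem_quad (M.turnsLeft Q'))))
  refine ⟨r, hr, (M.turnsLeft Q).ne j, hy.side_eq_zero, fun x hx hx' => (hb x hx).1.1 hx',
    fun x hx hx' => (hb x hx).1.2 (by rw [hs]; linarith), interior_maximal (fun x hx => ?_)
      Metric.isOpen_ball, M.vert_mem_nodes _ _, M.vert_mem_nodes _ _, Or.inr ⟨h, he, rfl, rfl⟩⟩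
  rcases le_total 0 (side (M.vert Q j) (M.vert Q (j + 1)) x) with h0 | h0
  · exact Set.mem_iUnion.2 ⟨Q, (hb x hx).2.1 h0⟩
  · exact Set.mem_iUnion.2 ⟨Q', (hb x hx).2.2 (by rw [hs]; linarith)⟩

theorem mem_tri_of_mem_cell {Q : ι} {x : Pt} (hx : x ∈ M.cell Q) {j : Fin 4}
    (h1 : 0 < side (M.vert Q (j + 1)) (M.vert Q (j + 3)) x)
    (h2 : 0 < side (M.vert Q (j + 2)) (M.vert Q j) x) : x ∈ M.tri Q j :=
  (mem_tri (M.turnsLeft Q)).2 ⟨(mem_interior_quad (M.turnsLeft Q)).1 hx j, h1, h2⟩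

/-- `h1` places `y` on the half of the diagonal towards vertex `j`, where the triangles `j + 3`
(left) and `j` (right) meet. -/
theorem exists_isInterface_of_diagonal {Q : ι} {y : Pt} (hy : y ∈ M.cell Q) {j : Fin 4}
    (h0 : side (M.vert Q j) (M.vert Q (j + 2)) y = 0)
    (h1 : 0 < side (M.vert Q (j + 1)) (M.vert Q (j + 3)) y) :
    ∃ r, M.IsInterface y r (Q, j + 3) (Q, j) (M.vert Q j) (M.vert Q (j + 2)) := by
  obtain ⟨i1, i2, i3, i4, i5, i6, i7, i8⟩ := fin4_idx j
  have i9 : j + 3 + 3 = j + 2 := by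
    clear * -
    revert j
    decide
  have hne : M.vert Q j ≠ M.vert Q (j + 2) := fun h => by
    have := M.turnsLeft Q j
    rw [← h, side_apply] at this
    nlinarith
  obtain ⟨r, hr, hb⟩ := Metric.eventually_nhds_iff_ball.1
    (((M.isOpen_cell Q).eventually_mem hy).and
      ((continuous_side _ _).continuousAt.eventually (lt_mem_nhds h1)))
  have hsub : Metric.ball y r ⊆ M.cell Q := fun x hx => (hb x hx).1
  refine ⟨r, hr, hne, h0, fun x hx hx' => M.mem_tri_of_mem_cell (hsub hx) ?_ ?_,
    fun x hx hx' => M.mem_tri_of_mem_cell (hsub hx) (hb x hx).2 ?_,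
    hsub.trans (M.cell_subset_domain Q), M.vert_mem_nodes _ _, M.vert_mem_nodes _ _,
    Or.inl ⟨rfl, hsub⟩⟩
  · rw [i5, i9]
    exact hx'
  · rw [i6]
    exact (hb x hx).2
  · rw [side_swap]
    linarith

/-- The nine sign patterns of the two diagonal functions are four triangles, four half diagonals and
the centre. -/
theorem mem_tri_or_isInterface_of_mem_cell {Q : ι} {y : Pt} (hy : y ∈ M.cell Q)
    (hc : y ≠ quadCenter (M.vert Q)) :
    (∃ j, y ∈ M.tri Q j) ∨ ∃ r S T a b, M.IsInterface y r S T a b := by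
  set v := M.vert Q with hv
  have s02 := side_swap (v 0) (v 2) y
  have s13 := side_swap (v 1) (v 3) y
  rcases lt_trichotomy (side (v 0) (v 2) y) 0 with h0 | h0 | h0 <;>
    rcases lt_trichotomy (side (v 1) (v 3) y) 0 with h1 | h1 | h1
  · exact Or.inl ⟨1, M.mem_tri_of_mem_cell hy (by change 0 < side (v 2) (v 0) y; linarith)
      (by change 0 < side (v 3) (v 1) y; linarith)⟩
  · obtain ⟨r, h⟩ := M.exists_isInterface_of_diagonal hy (j := 1) h1
      (by change 0 < side (v 2) (v 0) y; linarith)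
    exact Or.inr ⟨r, _, _, _, _, h⟩
  · exact Or.inl ⟨0, M.mem_tri_of_mem_cell hy h1 (by change 0 < side (v 2) (v 0) y; linarith)⟩
  · obtain ⟨r, h⟩ := M.exists_isInterface_of_diagonal hy (j := 2)
      (by change side (v 2) (v 0) y = 0; linarith) (by change 0 < side (v 3) (v 1) y; linarith)
    exact Or.inr ⟨r, _, _, _, _, h⟩
  · exact (hc (eq_center_of_side_eq_zero (M.turnsLeft Q) h0 h1)).elim
  · obtain ⟨r, h⟩ := M.exists_isInterface_of_diagonal hy (j := 0) h0 h1
    exact Or.inr ⟨r, _, _, _, _, h⟩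
  · exact Or.inl ⟨2, M.mem_tri_of_mem_cell hy (by change 0 < side (v 3) (v 1) y; linarith) h0⟩
  · obtain ⟨r, h⟩ := M.exists_isInterface_of_diagonal hy (j := 3)
      (by change side (v 3) (v 1) y = 0; linarith) h0
    exact Or.inr ⟨r, _, _, _, _, h⟩
  · exact Or.inl ⟨3, M.mem_tri_of_mem_cell hy h0 h1⟩

theorem mem_tri_or_isInterface [Finite ι] {y : Pt} (hy : y ∈ M.domain) (hn : y ∉ M.nodes) :
    (∃ Q j, y ∈ M.tri Q j) ∨ ∃ r S T a b, M.IsInterface y r S T a b := by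
  obtain ⟨Q, hQ⟩ := Set.mem_iUnion.1 (interior_subset hy)
  have hvert : ∀ Q i, y ≠ M.vert Q i := fun Q i h => hn (h ▸ M.vert_mem_nodes Q i)
  by_cases hc : y ∈ M.cell Q
  · exact (M.mem_tri_or_isInterface_of_mem_cell hc fun h => hn (h ▸ M.center_mem_nodes Q)).imp
      (fun ⟨j, hj⟩ => ⟨Q, j, hj⟩) id
  · right
    obtain ⟨Q', hne, hQ'⟩ : ∃ Q', Q' ≠ Q ∧ y ∈ quad (M.vert Q') := by
      by_contra! hno
      -- If no other cell contained `y`, a neighbourhood of `y` in the domain would avoid the closed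
      -- union of the others and so lie in `Q`.
      refine hc (mem_interior_iff_mem_nhds.2 ?_)
      have hcl : IsClosed (⋃ Q' ∈ {Q' | Q' ≠ Q}, quad (M.vert Q')) :=
        (Set.toFinite _).isClosed_biUnion fun Q' _ => isClosed_quad (M.turnsLeft Q')
      have hnot : y ∉ ⋃ Q' ∈ {Q' | Q' ≠ Q}, quad (M.vert Q') := fun h => by
        obtain ⟨Q', h1, h2⟩ := Set.mem_iUnion₂.1 h
        exact hno Q' h1 h2
      filter_upwards [M.isOpen_domain.mem_nhds hy, hcl.isOpen_compl.mem_nhds hnot] with x hx hx'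
      obtain ⟨Q', hQ'⟩ := Set.mem_iUnion.1 (interior_subset hx)
      by_cases h : Q' = Q
      · rwa [h] at hQ'
      · exact (hx' (Set.mem_iUnion₂.2 ⟨Q', h, hQ'⟩)).elim
    obtain ⟨j, j', he, hq⟩ := M.exists_common_edge hne.symm hQ hQ' (hvert Q)
    obtain ⟨r, hr⟩ := M.exists_isInterface_of_onEdge hne.symm hq he
    exact ⟨r, _, _, _, _, hr⟩

/-- The triangles cover the domain up to a null set. -/
theorem ae_mem_tri [Finite ι] : ∀ᵐ x ∂(volume.restrict M.domain), ∃ Q j, x ∈ M.tri Q j := by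
  rw [ae_restrict_iff' M.isOpen_domain.measurableSet, ae_iff]
  -- Every exceptional point is a node or lies on one of finitely many lines through two distinct
  -- nodes.
  refine measure_mono_null (t := M.nodes ∪ ⋃ p ∈ (M.nodes ×ˢ M.nodes) \ {p | p.1 = p.2},
    {x | side p.1 p.2 x = 0}) (fun x hx => ?_) (measure_union_null ?_ ?_)
  · rw [Set.mem_ofPred_eq, Classical.not_imp] at hx
    by_cases hn : x ∈ M.nodes
    · exact Or.inl hn
    · obtain ⟨r, S, T, a, b, h⟩ := (M.mem_tri_or_isInterface hx.1 hn).resolve_left hx.2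
      exact Or.inr (Set.mem_iUnion₂.2 ⟨(a, b), ⟨⟨h.left_mem, h.right_mem⟩, h.ne⟩, h.on_line⟩)
  · exact M.finite_nodes.measure_zero _
  · refine (measure_biUnion_null_iff (((M.finite_nodes.prod M.finite_nodes).subset
      Set.sdiff_subset).countable)).2 fun p hp => volume_side_eq_zero hp.2

end QuadMesh

/-! ### Connected neighbourhoods in Lipschitz domains -/

/-- At a boundary point, `O` is a thin strip above the Lipschitz graph, the continuous image of a
rectangle. This rules out a domain that is pinched at `v`. -/
theorem HasLipschitzBoundary.exists_isPreconnected {U : Set Pt} (hU : IsOpen U)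
    (h : HasLipschitzBoundary U) {v : Pt} (hv : v ∈ closure U) {r : ℝ} (hr : 0 < r) :
    ∃ O s, 0 < s ∧ IsOpen O ∧ IsPreconnected O ∧ O ⊆ U ∧ O ⊆ Metric.ball v r ∧
      U ∩ Metric.ball v s ⊆ O := by
  by_cases hvU : v ∈ U
  · obtain ⟨s, hs, hb⟩ := Metric.isOpen_iff.1 hU v hvU
    refine ⟨Metric.ball v (min r s), min r s, lt_min hr hs, Metric.isOpen_ball,
      (convex_ball _ _).isPreconnected, (Metric.ball_subset_ball (min_le_right _ _)).trans hb,
      Metric.ball_subset_ball (min_le_left _ _), Set.inter_subset_right⟩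
  obtain ⟨R, γ, L, r₀, hr₀, hγ, hloc⟩ := h v (by
    rw [hU.frontier_eq]
    exact ⟨hv, hvU⟩)
  set w : Pt := R v with hw
  have hR : Continuous R := R.continuous
  have hR0 : Continuous fun y => R y 0 := (EuclideanSpace.proj 0 : Pt →L[ℝ] ℝ).continuous.comp hR
  have hR1 : Continuous fun y => R y 1 := (EuclideanSpace.proj 1 : Pt →L[ℝ] ℝ).continuous.comp hR
  have hγc : Continuous fun y => γ (R y 0) := hγ.continuous.comp hR0
  have hγL : ∀ s t, |γ s - γ t| ≤ L * |s - t| := fun s t => by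
    simpa [Real.dist_eq] using hγ.dist_le_mul s t
  have hw1 : w 1 = γ (w 0) := by
    refine le_antisymm (not_lt.1 fun h' => hvU ((hloc v (Metric.mem_ball_self hr₀)).2 h'))
      (not_lt.1 fun h' => ?_)
    have hopen : IsOpen ({y | R y 1 < γ (R y 0)} ∩ Metric.ball v r₀) :=
      (isOpen_lt hR1 hγc).inter Metric.isOpen_ball
    obtain ⟨y, ⟨hy1, hy2⟩, hyU⟩ :=
      mem_closure_iff.1 hv _ hopen ⟨h', Metric.mem_ball_self hr₀⟩
    exact lt_asymm hy1 ((hloc y hy2).1 hyU)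
  set ρ := min r r₀ with hρ
  have hρ0 : 0 < ρ := lt_min hr hr₀
  -- With `δ (L + 1) = ρ/4` the strip stays within `δ + ρ/2 + Lδ = 3ρ/4 < ρ` of `v`, and points of
  -- `U` within `δ` of `v` lie less than `ρ/2` above the graph.
  set δ : ℝ := ρ / (4 * (L + 1)) with hδ
  have hL : (0 : ℝ) ≤ L := L.2
  have hδ0 : 0 < δ := by positivity
  have hδL : δ * (L + 1) = ρ / 4 := by
    rw [hδ]
    field_simp
  have hLδ : 0 ≤ L * δ := mul_nonneg hL hδ0.le
  set O : Set Pt := {y | |R y 0 - w 0| < δ ∧ γ (R y 0) < R y 1 ∧ R y 1 < γ (R y 0) + ρ / 2}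
  have hOball : O ⊆ Metric.ball v ρ := by
    rintro y ⟨h1, h2, h3⟩
    rw [Metric.mem_ball, ← R.dist_map, dist_eq_norm]
    have e : ‖R y - w‖ ≤ |R y 0 - w 0| + |R y 1 - w 1| := by
      refine abs_le_of_sq_le_sq' ?_ (by positivity) |>.2
      rw [sq_norm_eq, add_sq, sq_abs, sq_abs]
      simp only [PiLp.sub_apply]
      nlinarith [mul_nonneg (abs_nonneg (R y 0 - w 0)) (abs_nonneg (R y 1 - w 1))]
    have e1 : |R y 1 - w 1| ≤ ρ / 2 + L * δ := by
      have := (hγL (R y 0) (w 0)).trans (mul_le_mul_of_nonneg_left h1.le hL)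
      rw [abs_le] at this ⊢
      rw [hw1]
      constructor <;> linarith [this.1, this.2]
    linarith
  refine ⟨O, δ, hδ0, ?_, ?_, fun y hy => ?_, hOball.trans
    (Metric.ball_subset_ball (min_le_left _ _)), ?_⟩
  · exact (isOpen_lt (hR0.sub continuous_const).abs continuous_const).inter
      ((isOpen_lt hγc hR1).inter (isOpen_lt hR1 (hγc.add continuous_const)))
  · let F : ℝ × ℝ → Pt := fun p => R.symm !₂[p.1, γ p.1 + p.2]
    have hF : Continuous F := by
      refine R.symm.continuous.comp ((PiLp.continuous_toLp 2 _).comp (continuous_pi fun i => ?_))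
      fin_cases i
      · exact continuous_fst
      · exact (hγ.continuous.comp continuous_fst).add continuous_snd
    have hO : O = F '' (Set.Ioo (w 0 - δ) (w 0 + δ) ×ˢ Set.Ioo 0 (ρ / 2)) := by
      ext y
      constructor
      · rintro ⟨h1, h2, h3⟩
        rw [abs_lt] at h1
        refine ⟨(R y 0, R y 1 - γ (R y 0)), ⟨⟨?_, ?_⟩, ?_, ?_⟩, ?_⟩
        · change _ < R y 0
          linarith
        · change R y 0 < _
          linarith
        · exact sub_pos.2 h2
        · change R y 1 - γ (R y 0) < _
          linarith
        · rw [R.symm_apply_eq]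
          ext i
          fin_cases i <;> simp
      · rintro ⟨⟨s, t⟩, ⟨⟨h1, h2⟩, h3, h4⟩, rfl⟩
        simp only at h1 h2 h3 h4
        have e0 : R (F (s, t)) 0 = s := by simp [F]
        have e1 : R (F (s, t)) 1 = γ s + t := by simp [F]
        refine ⟨?_, ?_, ?_⟩
        · rw [e0, abs_lt]
          constructor <;> linarith
        · rw [e0, e1]
          linarith
        · rw [e0, e1]
          linarith
    rw [hO]
    exact (((convex_Ioo _ _).prod (convex_Ioo _ _)).isPreconnected).image _ hF.continuousOn
  · exact (hloc y (Metric.ball_subset_ball (min_le_right _ _) (hOball hy))).2 hy.2.1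
  · rintro y ⟨hyU, hy⟩
    have hδρ : δ ≤ ρ := by nlinarith
    have hyn : ‖R y - w‖ < δ := by
      rwa [← dist_eq_norm, R.dist_map]
    have e0 : |R y 0 - w 0| < δ := (PiLp.norm_apply_le (R y - w) 0).trans_lt hyn
    have e1 : |R y 1 - w 1| < δ := (PiLp.norm_apply_le (R y - w) 1).trans_lt hyn
    refine ⟨e0, (hloc y (Metric.ball_subset_ball (hδρ.trans (min_le_right _ _)) hy)).1 hyU, ?_⟩
    have := (hγL (R y 0) (w 0)).trans (mul_le_mul_of_nonneg_left e0.le hL)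
    rw [abs_le] at this
    rw [abs_lt] at e1
    linarith [this.1]

/-! ### Auxiliary facts on polynomials, Sobolev membership and null sets -/

theorem pderiv_comm (i j : Fin 2) (p : MvPolynomial (Fin 2) ℝ) :
    MvPolynomial.pderiv i (MvPolynomial.pderiv j p)
      = MvPolynomial.pderiv j (MvPolynomial.pderiv i p) := by
  rcases eq_or_ne i j with rfl | hij
  · rfl
  ext m
  simp only [MvPolynomial.coeff_pderiv]
  rw [add_right_comm]
  simp [hij, hij.symm]
  ring

theorem MemH1.mono {U V : Set Pt} {f : Pt → ℝ} (h : MemH1 U f) (hVU : V ⊆ U) : MemH1 V f := by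
  have hle := Measure.restrict_mono hVU (le_refl (volume : Measure Pt))
  refine ⟨h.1.mono_measure hle, fun i => ?_⟩
  obtain ⟨g, hg, hw⟩ := h.2 i
  exact ⟨g, hg.mono_measure hle, hw.mono hVU⟩

theorem MemH2.memH1 {U : Set Pt} {f : Pt → ℝ} (h : MemH2 U f) : MemH1 U f :=
  ⟨h.1, fun i => (h.2 i).imp fun _ hg => ⟨hg.1.1, hg.2⟩⟩

theorem memH1_pval {U : Set Pt} (hU : Bornology.IsBounded U) (hm : MeasurableSet U)
    (p : MvPolynomial (Fin 2) ℝ) : MemH1 U (pval p) :=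
  ⟨memLp_pval hU hm p, fun i => ⟨_, memLp_pval hU hm _, isWeakPartial_pval U i p⟩⟩

theorem memH2_pval {U : Set Pt} (hU : Bornology.IsBounded U) (hm : MeasurableSet U)
    (p : MvPolynomial (Fin 2) ℝ) : MemH2 U (pval p) :=
  ⟨memLp_pval hU hm p, fun i => ⟨_, memH1_pval hU hm _, isWeakPartial_pval U i p⟩⟩

/-- A polynomial with vanishing gradient along a line is constant there. -/
theorem pval_eq_of_line {a b : Pt} (hab : a ≠ b) {d : MvPolynomial (Fin 2) ℝ}
    (h : ∀ x, side a b x = 0 → ∀ i, pval (MvPolynomial.pderiv i d) x = 0) {x y : Pt}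
    (hx : side a b x = 0) (hy : side a b y = 0) : pval d x = pval d y := by
  obtain ⟨s, rfl⟩ := exists_on_line_of_side_eq_zero hab hx
  obtain ⟨t, rfl⟩ := exists_on_line_of_side_eq_zero hab hy
  refine is_const_of_deriv_eq_zero (f := fun t : ℝ => pval d (a + t • (b - a)))
    (fun t => (hasDerivAt_pval_line a b d t).differentiableAt) (fun t => ?_) s t
  rw [(hasDerivAt_pval_line a b d t).deriv, h _ (side_line _ _ _), h _ (side_line _ _ _)]
  simp

theorem exists_mem_of_ae {V : Set Pt} (hV : IsOpen V) (hne : V.Nonempty) {P : Pt → Prop}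
    (h : ∀ᵐ x ∂(volume.restrict V), P x) : ∃ x ∈ V, P x := by
  have : (ae (volume.restrict V)).NeBot := by
    rw [ae_neBot, Ne, Measure.restrict_eq_zero]
    exact (hV.measure_pos _ hne).ne'
  obtain ⟨x, hx, hxV⟩ := (h.and (ae_restrict_mem hV.measurableSet)).exists
  exact ⟨x, hxV, hx⟩

namespace QuadMesh

variable {ι : Type*} (M : QuadMesh ι)

/-! ### Piecewise polynomial functions -/

/-- The function equal to `p Q j` on the triangle `tri Q j`, and to zero off all triangles. -/
def piecewise (p : PolyFamily ι) (x : Pt) : ℝ :=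
  ∑ᶠ T : ι × Fin 4, (M.tri T.1 T.2).indicator (pval (p T.1 T.2)) x

theorem piecewise_eq (p : PolyFamily ι) {Q : ι} {j : Fin 4} {x : Pt} (hx : x ∈ M.tri Q j) :
    M.piecewise p x = pval (p Q j) x := by
  rw [piecewise, finsum_eq_single _ (Q, j), Set.indicator_of_mem hx]
  rintro ⟨Q', j'⟩ hne
  refine Set.indicator_of_notMem (fun hx' => hne ?_) _
  obtain ⟨rfl, rfl⟩ := M.tri_eq_of_mem hx hx'
  rfl

theorem piecewise_eq_zero (p : PolyFamily ι) {x : Pt} (hx : ∀ Q j, x ∉ M.tri Q j) :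
    M.piecewise p x = 0 := by
  rw [piecewise]
  simp only [Set.indicator_of_notMem (hx _ _), finsum_zero]

theorem measurable_piecewise [Finite ι] (p : PolyFamily ι) : Measurable (M.piecewise p) := by
  have := Fintype.ofFinite ι
  have e : M.piecewise p = fun x => ∑ T : ι × Fin 4,
      (M.tri T.1 T.2).indicator (pval (p T.1 T.2)) x :=
    funext fun x => finsum_eq_sum_of_fintype _
  rw [e]
  exact Finset.measurable_sum _ fun T _ =>
    (continuous_pval _).measurable.indicator (M.isOpen_tri _ _).measurableSet

theorem exists_bound_piecewise [Finite ι] (p : PolyFamily ι) :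
    ∃ C, ∀ x, |M.piecewise p x| ≤ C := by
  choose C hC using fun T : ι × Fin 4 => exists_bound_pval (M.isBounded_domain.subset
    (M.tri_subset_domain T.1 T.2)) (p T.1 T.2)
  obtain ⟨K, hK⟩ := (Set.finite_range C).bddAbove
  refine ⟨max K 0, fun x => ?_⟩
  by_cases h : ∃ T : ι × Fin 4, x ∈ M.tri T.1 T.2
  · obtain ⟨T, hT⟩ := h
    rw [M.piecewise_eq p hT]
    exact ((hC T x hT).trans (hK ⟨T, rfl⟩)).trans (le_max_left _ _)
  · rw [M.piecewise_eq_zero p fun Q j hx => h ⟨(Q, j), hx⟩, abs_zero]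
    exact le_max_right _ _

theorem memLp_piecewise [Finite ι] (p : PolyFamily ι) {U : Set Pt} (hU : Bornology.IsBounded U) :
    MemLp (M.piecewise p) 2 (volume.restrict U) := by
  obtain ⟨C, hC⟩ := M.exists_bound_piecewise p
  exact memLp_of_bounded hU (M.measurable_piecewise p).aestronglyMeasurable
    (Filter.Eventually.of_forall hC)

theorem IsPiecewise.ae_eq [Finite ι] {m : ℕ} {f : Pt → ℝ} {p : PolyFamily ι}
    (h : M.IsPiecewise m f p) : f =ᵐ[volume.restrict M.domain] M.piecewise p := by
  filter_upwards [M.ae_mem_tri, ae_all_iff.2 fun Q => ae_all_iff.2 fun j => (h Q j).2]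
    with x ⟨Q, j, hx⟩ hf
  rw [hf Q j hx, M.piecewise_eq p hx]

theorem isPiecewise_of_ae_eq {m : ℕ} {f : Pt → ℝ} {p : PolyFamily ι}
    (h : f =ᵐ[volume.restrict M.domain] M.piecewise p)
    (hp : ∀ Q j, (p Q j).totalDegree ≤ m) : M.IsPiecewise m f p := fun Q j => ⟨hp Q j, by
  filter_upwards [h] with x hx hxT
  rw [hx, M.piecewise_eq p hxT]⟩

/-- The gradient component of a family of polynomials. -/
def partialFamily (i : Fin 2) (p : PolyFamily ι) : PolyFamily ι :=
  fun Q j => MvPolynomial.pderiv i (p Q j)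

/-- The polynomials agree across all interfaces at points of `O`. -/
def Matched (O : Set Pt) (p : PolyFamily ι) : Prop :=
  ∀ y ∈ O, ∀ r S T a b, M.IsInterface y r S T a b → ∀ x, side a b x = 0 →
    pval (p S.1 S.2) x = pval (p T.1 T.2) x

theorem IsInterface.isTwoSided {M : QuadMesh ι} {y : Pt} {r : ℝ} {S T : ι × Fin 4} {a b : Pt}
    (h : M.IsInterface y r S T a b) (p : PolyFamily ι) :
    IsTwoSided (Metric.ball y r) a b (p S.1 S.2) (p T.1 T.2) (M.piecewise p) := by
  filter_upwards [ae_restrict_mem Metric.isOpen_ball.measurableSet] with x hx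
  exact ⟨fun h' => M.piecewise_eq p (h.left x hx h'), fun h' => M.piecewise_eq p (h.right x hx h')⟩

/-- Nodes are discarded first. Around any other point the function is either one polynomial or two
polynomials agreeing on the separating line. -/
theorem Matched.isWeakPartial [Finite ι] {O : Set Pt} (hOd : O ⊆ M.domain)
    {p : PolyFamily ι} (h : M.Matched O p) (i : Fin 2) :
    IsWeakPartial O i (M.piecewise p) (M.piecewise (partialFamily i p)) := by
  have hb : Bornology.IsBounded O := M.isBounded_domain.subset hOd
  obtain ⟨C, hC⟩ := M.exists_bound_piecewise p
  refine IsWeakPartial.of_diff_finite M.finite_nodes (M.memLp_piecewise p hb)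
    (Filter.Eventually.of_forall hC) (M.memLp_piecewise _ hb) ?_
  have hb' : Bornology.IsBounded (O \ M.nodes) := hb.subset Set.sdiff_subset
  refine IsWeakPartial.of_local (M.memLp_piecewise p hb') (M.memLp_piecewise _ hb')
    fun y ⟨hy, hyn⟩ => ?_
  rcases M.mem_tri_or_isInterface (hOd hy) hyn with ⟨Q, j, hT⟩ | ⟨r, S, T, a, b, hI⟩
  · refine ⟨M.tri Q j, M.isOpen_tri Q j, hT, (isWeakPartial_pval _ i (p Q j)).congr ?_ ?_⟩
    all_goals
      filter_upwards [ae_restrict_mem (M.isOpen_tri Q j).measurableSet] with x hx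
      rw [M.piecewise_eq _ hx]
    rfl
  · exact ⟨Metric.ball y r, Metric.isOpen_ball, Metric.mem_ball_self hI.pos,
      (hI.isTwoSided p).isWeakPartial hI.ne (hI.isTwoSided (partialFamily i p))
        (h y hy r S T a b hI)⟩

/-- The numbers `κ` define a piecewise constant function without jumps in `O`; its weak gradient
vanishes, so it is constant. This replaces a combinatorial walk through adjacent triangles. -/
theorem const_of_matched [Finite ι] {O : Set Pt} (hO : IsOpen O) (hc : IsPreconnected O)
    (hOd : O ⊆ M.domain) {κ : ι → Fin 4 → ℝ}
    (h : ∀ y ∈ O, ∀ r S T a b, M.IsInterface y r S T a b → κ S.1 S.2 = κ T.1 T.2)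
    {Q Q' : ι} {j j' : Fin 4} (h1 : (O ∩ M.tri Q j).Nonempty)
    (h2 : (O ∩ M.tri Q' j').Nonempty) : κ Q j = κ Q' j' := by
  let p : PolyFamily ι := fun Q j => MvPolynomial.C (κ Q j)
  have hm : M.Matched O p := fun y hy r S T a b hI x _ => by
    simp only [p, pval_C]
    exact h y hy r S T a b hI
  have h0 : ∀ i, M.piecewise (partialFamily i p) = 0 := fun i => by
    funext x
    have h0 : pval 0 = 0 := funext pval_zero
    simp [piecewise, partialFamily, p, h0]
  obtain ⟨c, hc⟩ := IsWeakPartial.ae_const hO hc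
    (M.memLp_piecewise p (M.isBounded_domain.subset hOd)) fun i => by
      have := Matched.isWeakPartial M hOd hm i
      rwa [h0 i] at this
  have key : ∀ {Q j}, (O ∩ M.tri Q j).Nonempty → κ Q j = c := by
    intro Q j hne
    obtain ⟨x, hx, hxc⟩ := exists_mem_of_ae (hO.inter (M.isOpen_tri Q j)) hne
      (ae_restrict_of_ae_restrict_of_subset Set.inter_subset_left hc)
    rw [M.piecewise_eq p hx.2, pval_C] at hxc
    exact hxc
  rw [key h1, key h2]

/-- A piecewise polynomial function in `H¹` has no jump at an interface. -/
theorem IsInterface.eq_of_memH1 {M : QuadMesh ι} {y : Pt} {r : ℝ} {S T : ι × Fin 4} {a b : Pt}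
    (h : M.IsInterface y r S T a b) {U : Set Pt} (hU : Metric.ball y r ⊆ U) {f : Pt → ℝ}
    (hf : MemH1 U f) {p : PolyFamily ι}
    (hp : ∀ Q j, ∀ᵐ x ∂(volume.restrict U), x ∈ M.tri Q j → f x = pval (p Q j) x)
    {x : Pt} (hx : side a b x = 0) : pval (p S.1 S.2) x = pval (p T.1 T.2) x := by
  have hball : ∀ z ∈ Metric.ball y r, side a b z = 0 →
      pval (p S.1 S.2) z = pval (p T.1 T.2) z := by
    intro z hz hz0
    obtain ⟨s, hs, hsub⟩ := Metric.isOpen_iff.1 Metric.isOpen_ball z hz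
    have hf' := hf.mono (hsub.trans hU)
    choose g hg hw using hf'.2
    refine IsTwoSided.no_jump hs h.ne hz0 (f := f) (g := g) ?_ hg hw
    filter_upwards [ae_restrict_of_ae_restrict_of_subset (hsub.trans hU) (hp S.1 S.2),
      ae_restrict_of_ae_restrict_of_subset (hsub.trans hU) (hp T.1 T.2),
      ae_restrict_mem Metric.isOpen_ball.measurableSet] with w h1 h2 h3
    exact ⟨fun hw => h1 (h.left w (hsub h3) hw), fun hw => h2 (h.right w (hsub h3) hw)⟩
  obtain ⟨t₀, ht₀⟩ := exists_on_line_of_side_eq_zero h.ne h.on_line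
  have hcont : Continuous fun t : ℝ => a + t • (b - a) := by fun_prop
  have hopen : IsOpen ((fun t : ℝ => a + t • (b - a)) ⁻¹' Metric.ball y r) :=
    Metric.isOpen_ball.preimage hcont
  have hmem : t₀ ∈ (fun t : ℝ => a + t • (b - a)) ⁻¹' Metric.ball y r := by
    rw [Set.mem_preimage, ← ht₀]
    exact Metric.mem_ball_self h.pos
  -- Agreement is known only inside the ball, but a polynomial in one variable with infinitely many
  -- zeros vanishes, so it extends to the whole line, including its nodes.
  have hzero : lineRestr a b (p S.1 S.2 - p T.1 T.2) = 0 := by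
    refine Polynomial.eq_zero_of_infinite_isRoot _
      ((infinite_of_mem_nhds t₀ (hopen.mem_nhds hmem)).mono fun t ht => ?_)
    change Polynomial.eval t _ = 0
    rw [eval_lineRestr, pval_sub, hball _ ht (side_line _ _ _), sub_self]
  obtain ⟨t, rfl⟩ := exists_on_line_of_side_eq_zero h.ne hx
  have := eval_lineRestr a b (p S.1 S.2 - p T.1 T.2) t
  rw [hzero, Polynomial.eval_zero, pval_sub] at this
  exact (sub_eq_zero.1 this.symm)

/-! ### Potentials on simply connected meshes -/

/-- Only finitely many lines join two nodes, so a small ball about `x` meets just those through `x`.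
-/
theorem exists_radius [Finite ι] (x : Pt) : ∃ r > 0, ∀ a ∈ M.nodes, ∀ b ∈ M.nodes,
    ∀ y ∈ Metric.ball x r, side a b y = 0 → side a b x = 0 := by
  have : ∀ p ∈ M.nodes ×ˢ M.nodes, ∀ᶠ y in nhds x, side p.1 p.2 y = 0 → side p.1 p.2 x = 0 := by
    intro p _
    by_cases h : side p.1 p.2 x = 0
    · exact Filter.Eventually.of_forall fun _ _ => h
    · filter_upwards [(continuous_side p.1 p.2).continuousAt.eventually_ne h] with y hy hy0
      exact (hy hy0).elim
  obtain ⟨r, hr, hb⟩ := Metric.eventually_nhds_iff_ball.1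
    ((Filter.eventually_all_finite (M.finite_nodes.prod M.finite_nodes)).2 this)
  exact ⟨r, hr, fun a ha b hb' y hy => hb y hy (a, b) ⟨ha, hb'⟩⟩

theorem exists_tri_inter [Finite ι] {V : Set Pt} (hV : IsOpen V) (hVd : V ⊆ M.domain)
    (hne : V.Nonempty) : ∃ T : ι × Fin 4, (V ∩ M.tri T.1 T.2).Nonempty := by
  obtain ⟨x, hx, Q, j, hT⟩ := exists_mem_of_ae hV hne
    (ae_restrict_of_ae_restrict_of_subset hVd M.ae_mem_tri)
  exact ⟨(Q, j), x, hx, hT⟩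

/-- On a simply connected domain a family of polynomials with matching gradients can be made
matching by adding constants. -/
theorem exists_matched_add_const [Finite ι] (hcontr : ContractibleSpace M.domain)
    {P : PolyFamily ι} (h : ∀ i, M.Matched M.domain (partialFamily i P)) :
    ∃ κ : ι → Fin 4 → ℝ, M.Matched M.domain fun Q j => P Q j + MvPolynomial.C (κ Q j) := by
  -- The gradient of the jump vanishes on the interface line, so the jump is a single constant
  -- there.
  have hconst : ∀ {y r S T a b}, M.IsInterface y r S T a b → ∀ {x z}, side a b x = 0 →
      side a b z = 0 → pval (P S.1 S.2) x - pval (P T.1 T.2) x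
        = pval (P S.1 S.2) z - pval (P T.1 T.2) z := by
    intro y r S T a b hI x z hx hz
    rw [← pval_sub, ← pval_sub]
    refine pval_eq_of_line hI.ne (fun w hw i => ?_) hx hz
    rw [map_sub, pval_sub, sub_eq_zero]
    exact h i y (hI.ball_subset (Metric.mem_ball_self hI.pos)) r S T a b hI w hw
  have hrad : ∀ x : M.domain, ∃ r > 0, Metric.ball (x : Pt) r ⊆ M.domain ∧
      ∀ a ∈ M.nodes, ∀ b ∈ M.nodes, ∀ y ∈ Metric.ball (x : Pt) r, side a b y = 0 →
        side a b x = 0 := by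
    intro x
    obtain ⟨r, hr, h1⟩ := M.exists_radius x
    obtain ⟨s, hs, h2⟩ := Metric.isOpen_iff.1 M.isOpen_domain x x.2
    exact ⟨min r s, lt_min hr hs, (Metric.ball_subset_ball (min_le_right _ _)).trans h2,
      fun a ha b hb y hy => h1 a ha b hb y (Metric.ball_subset_ball (min_le_left _ _) hy)⟩
  choose r hr hrd hrn using hrad
  let D : M.domain → Set Pt := fun x => Metric.ball (x : Pt) (r x)
  have hD : ∀ x, IsOpen (D x) := fun x => Metric.isOpen_ball
  have hDm : ∀ x : M.domain, (x : Pt) ∈ D x := fun x => Metric.mem_ball_self (hr x)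
  -- The increment of `P` from `i` to `j` is the same for every triangle meeting the overlap: an
  -- interface there lies on a line through both `i` and `j`, along which the jump is constant.
  have hc : ∀ i j : M.domain, ∃ c : ℝ, ∀ T : ι × Fin 4,
      ((D i ∩ D j) ∩ M.tri T.1 T.2).Nonempty → c = pval (P T.1 T.2) j - pval (P T.1 T.2) i := by
    intro i j
    by_cases hex : ∃ T : ι × Fin 4, ((D i ∩ D j) ∩ M.tri T.1 T.2).Nonempty
    · obtain ⟨T₀, hT₀⟩ := hex
      refine ⟨pval (P T₀.1 T₀.2) j - pval (P T₀.1 T₀.2) i, fun T hT => ?_⟩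
      refine M.const_of_matched (κ := fun Q l => pval (P Q l) j - pval (P Q l) i)
        ((hD i).inter (hD j)) ((convex_ball _ _).inter (convex_ball _ _)).isPreconnected
        (Set.inter_subset_left.trans (hrd i)) ?_ hT₀ hT
      intro y hy s S T a b hI
      have := hconst hI (hrn i a hI.left_mem b hI.right_mem y hy.1 hI.on_line)
        (hrn j a hI.left_mem b hI.right_mem y hy.2 hI.on_line)
      linarith
    · exact ⟨0, fun T hT => (hex ⟨T, hT⟩).elim⟩
  choose c hcT using hc
  have hloc : LocallyPathConnectedSpace M.domain := M.isOpen_domain.locallyPathConnectedSpace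
  -- The cocycle identity is read off on one triangle that meets the triple intersection. The
  -- cochain `α` plays the role of the values of the global potential.
  obtain ⟨α, hα⟩ := exists_coboundary (fun x : M.domain => Subtype.val ⁻¹' D x)
    (fun x => (hD x).preimage continuous_subtype_val) hDm (fun x => by
      rw [← Topology.IsInducing.subtypeVal.isPreconnected_image, Subtype.image_preimage_coe,
        Set.inter_eq_right.2 (hrd x)]
      exact (convex_ball _ _).isPreconnected) c (fun i j k ⟨x, ⟨hi, hj⟩, hk⟩ => by
      obtain ⟨T, z, ⟨⟨h1, h2⟩, h3⟩, h4⟩ := M.exists_tri_inter (((hD i).inter (hD j)).inter (hD k))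
        (fun z hz => hrd i hz.1.1) ⟨x, ⟨hi, hj⟩, hk⟩
      rw [hcT i j T ⟨z, ⟨h1, h2⟩, h4⟩, hcT j k T ⟨z, ⟨h2, h3⟩, h4⟩,
        hcT i k T ⟨z, ⟨h1, h3⟩, h4⟩]
      ring)
  have hstep : ∀ {i j : M.domain} {T : ι × Fin 4}, ((D i ∩ D j) ∩ M.tri T.1 T.2).Nonempty →
      α i - pval (P T.1 T.2) i = α j - pval (P T.1 T.2) j := by
    rintro i j T ⟨z, hz, hzT⟩
    have := hα i j ⟨⟨z, hrd i hz.1⟩, hz⟩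
    rw [hcT i j T ⟨z, hz, hzT⟩] at this
    linarith
  have htri : ∀ (T : ι × Fin 4) (i j : M.domain), (i : Pt) ∈ M.tri T.1 T.2 →
      (j : Pt) ∈ M.tri T.1 T.2 → α i - pval (P T.1 T.2) i = α j - pval (P T.1 T.2) j := by
    intro T i j hi hj
    have hpre : IsPreconnected (Subtype.val ⁻¹' M.tri T.1 T.2 : Set M.domain) := by
      rw [← Topology.IsInducing.subtypeVal.isPreconnected_image, Subtype.image_preimage_coe,
        Set.inter_eq_right.2 (M.tri_subset_domain _ _)]
      exact (M.convex_tri _ _).isPreconnected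
    refine hpre.induction₂ (fun i j => α i - pval (P T.1 T.2) i = α j - pval (P T.1 T.2) j)
      (fun x hx => ?_) (fun _ _ _ _ _ _ => Eq.trans) (fun _ _ _ _ => Eq.symm) hi hj
    filter_upwards [mem_nhdsWithin_of_mem_nhds (((hD x).preimage continuous_subtype_val).mem_nhds
      (hDm x)), self_mem_nhdsWithin] with z hz hzT
    exact hstep ⟨z, ⟨hz, hDm z⟩, hzT⟩
  choose e he using fun T : ι × Fin 4 => M.tri_nonempty T.1 T.2
  -- The constant that turns `P Q j` into `α`, computed at an arbitrary point of the triangle. By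
  -- `htri` the choice of point is immaterial, and by `hκ` any ball meeting the triangle gives the
  -- same value.
  let κ : ι → Fin 4 → ℝ := fun Q j =>
    α ⟨e (Q, j), M.tri_subset_domain _ _ (he (Q, j))⟩ - pval (P Q j) (e (Q, j))
  have hκ : ∀ (i : M.domain) (T : ι × Fin 4), (D i ∩ M.tri T.1 T.2).Nonempty →
      κ T.1 T.2 = α i - pval (P T.1 T.2) i := by
    rintro i T ⟨z, hz, hzT⟩
    have hzd := hrd i hz
    have h1 := hstep (i := i) (j := ⟨z, hzd⟩) (T := T) ⟨z, ⟨hz, hDm ⟨z, hzd⟩⟩, hzT⟩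
    have h2 := htri T ⟨e T, M.tri_subset_domain _ _ (he T)⟩ ⟨z, hzd⟩ (he T) hzT
    exact h2.trans h1.symm
  refine ⟨κ, fun y hy s S T a b hI x hx => ?_⟩
  have hs : 0 < min s (r ⟨y, hy⟩) := lt_min hI.pos (hr _)
  -- The ball around `y` meets both triangles, so both corrected polynomials take the value `α y` at
  -- `y`; the jump, constant along the line, is therefore zero.
  obtain ⟨⟨z, hz, hz0⟩, ⟨w, hw, hw0⟩⟩ := exists_side_near hI.ne hI.on_line hs
  have hS := hκ ⟨y, hy⟩ S ⟨z, Metric.ball_subset_ball (min_le_right _ _) hz,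
    hI.left z (Metric.ball_subset_ball (min_le_left _ _) hz) hz0⟩
  have hT := hκ ⟨y, hy⟩ T ⟨w, Metric.ball_subset_ball (min_le_right _ _) hw,
    hI.right w (Metric.ball_subset_ball (min_le_left _ _) hw) hw0⟩
  have := hconst hI hx hI.on_line
  rw [pval_add, pval_add, pval_C, pval_C, hS, hT]
  simp only
  linarith

/-! ### Smoothness across interfaces of functions in the space `Σ` -/

/-- Adjacent triangles of a cell meet along a half diagonal; the witness is the midpoint between
`vert Q (j + 1)` and the centre. -/
theorem exists_diagonal_interface (Q : ι) (j : Fin 4) :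
    ∃ y r, y ∈ M.domain ∧
      M.IsInterface y r (Q, j) (Q, j + 1) (M.vert Q (j + 1)) (M.vert Q (j + 3)) := by
  have hv := M.turnsLeft Q
  obtain ⟨i1, i2, i3, i4, i5, i6, i7, i8⟩ := fin4_idx j
  obtain ⟨s, hs0, hs1, hs⟩ := exists_center_eq hv (j + 1)
  rw [i2] at hs
  set y := M.vert Q (j + 1) + (s / 2) • (M.vert Q (j + 3) - M.vert Q (j + 1)) with hy
  have hmid : y = M.vert Q (j + 1) + (1 / 2 : ℝ) • (quadCenter (M.vert Q) - M.vert Q (j + 1)) := by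
    rw [hs, hy]
    module
  have hcell : y ∈ M.cell Q := (mem_interior_quad hv).2 fun i => by
    rw [hmid, side_affine]
    have h1 := hv.side_vertex_nonneg (j + 1) i
    have h2 := side_center_pos hv i
    linarith
  have hpos : 0 < side (M.vert Q (j + 2)) (M.vert Q j) y := by
    obtain ⟨t, -, -, ht⟩ := exists_center_eq hv (j + 2)
    rw [i4] at ht
    rw [hmid, side_affine, ht, side_line]
    have h3 := hv j
    have h4 : side (M.vert Q (j + 2)) (M.vert Q j) (M.vert Q (j + 1))
      = side (M.vert Q j) (M.vert Q (j + 1)) (M.vert Q (j + 2)) := by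
      simp only [side_apply]
      ring
    linarith
  obtain ⟨r, hr⟩ := M.exists_isInterface_of_diagonal hcell (j := j + 1)
    (by rw [i2]; exact side_line _ _ _)
    (by rw [i1, show j + 1 + 3 = j from i7]; exact hpos)
  rw [i7, i2] at hr
  exact ⟨y, r, M.cell_subset_domain Q hcell, hr⟩

/-- Inside a cell `H²` excludes jumps of the value and of the gradient; across a common edge the
difference of the polynomials is killed by `edge_dofs_unisolvent`. -/
theorem matched_of_mem_sigmaSpace {k : ℕ} (hk : k = 2 ∨ k = 3) {f : Pt → ℝ}
    (hf : ∀ Q, MemH2 (M.cell Q) f) {p : PolyFamily ι} (hp : M.IsPiecewise (k + 1) f p)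
    (hdof : M.SingleValuedDOFs k p) :
    M.Matched M.domain p ∧ ∀ i, M.Matched M.domain (partialFamily i p) := by
  have hcellp : ∀ Q, ∀ Q' j, ∀ᵐ x ∂(volume.restrict (M.cell Q)), x ∈ M.tri Q' j →
      f x = pval (p Q' j) x := fun Q Q' j =>
    ae_restrict_of_ae_restrict_of_subset (M.cell_subset_domain Q) (hp Q' j).2
  -- The weak derivative supplied by `H²` lies in `H¹` and is piecewise the derivative of `p`, so
  -- the no-jump argument applies to it as well.
  have hcellg : ∀ Q i, ∃ g, MemH1 (M.cell Q) g ∧ ∀ Q' j, ∀ᵐ x ∂(volume.restrict (M.cell Q)),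
      x ∈ M.tri Q' j → g x = pval (partialFamily i p Q' j) x := by
    intro Q i
    obtain ⟨g, hg, hw⟩ := (hf Q).2 i
    refine ⟨g, hg, fun Q' j => ?_⟩
    have hT := (M.isOpen_tri Q' j).measurableSet
    have hV : IsOpen (M.tri Q' j ∩ M.cell Q) := (M.isOpen_tri Q' j).inter (M.isOpen_cell Q)
    have hle := Measure.restrict_mono (Set.inter_subset_right : M.tri Q' j ∩ M.cell Q ⊆ _)
      (le_refl (volume : Measure Pt))
    have := (hw.mono Set.inter_subset_right).eq_pderiv hV
      ((isBounded_quad _).subset (Set.inter_subset_right.trans interior_subset)) (p := p Q' j)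
      (by
        rw [Filter.EventuallyEq, ← Measure.restrict_restrict hT, ae_restrict_iff' hT]
        exact hcellp Q Q' j) (hg.1.mono_measure hle)
    rwa [Filter.EventuallyEq, ← Measure.restrict_restrict hT, ae_restrict_iff' hT] at this
  have hin : ∀ {y r S T a b}, M.IsInterface y r S T a b → S.1 = T.1 →
      Metric.ball y r ⊆ M.cell S.1 → ∀ {x}, side a b x = 0 →
      pval (p S.1 S.2) x = pval (p T.1 T.2) x ∧
        ∀ i, pval (partialFamily i p S.1 S.2) x = pval (partialFamily i p T.1 T.2) x := by
    intro y r S T a b hI _ hb x hx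
    refine ⟨hI.eq_of_memH1 hb (hf S.1).memH1 (hcellp S.1) hx, fun i => ?_⟩
    obtain ⟨g, hg, hgp⟩ := hcellg S.1 i
    exact hI.eq_of_memH1 hb hg hgp hx
  -- The degrees of freedom read a vertex through only one of its two triangles in each cell. The
  -- diagonal line passes through the vertex, so the other triangle gives the same data there.
  have hvert : ∀ Q j, pval (p Q j) (M.vert Q (j + 1)) = pval (p Q (j + 1)) (M.vert Q (j + 1)) ∧
      ∀ i, pval (partialFamily i p Q j) (M.vert Q (j + 1))
        = pval (partialFamily i p Q (j + 1)) (M.vert Q (j + 1)) := by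
    intro Q j
    obtain ⟨y, r, -, hI⟩ := M.exists_diagonal_interface Q j
    rcases hI.kind with ⟨h1, h2⟩ | ⟨h1, -⟩
    · exact hin hI h1 h2 (side_left _ _)
    · exact (h1 rfl).elim
  have hall : ∀ {y r S T a b}, M.IsInterface y r S T a b → ∀ {x}, side a b x = 0 →
      pval (p S.1 S.2) x = pval (p T.1 T.2) x ∧
        ∀ i, pval (partialFamily i p S.1 S.2) x = pval (partialFamily i p T.1 T.2) x := by
    intro y r S T a b hI x hx
    rcases hI.kind with ⟨h1, h2⟩ | ⟨hne, he, rfl, rfl⟩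
    · exact hin hI h1 h2 hx
    obtain ⟨o1, o2⟩ := M.opposite_of_quadEdge_eq hne he
    have ha : pval (p S.1 S.2) (M.vert S.1 S.2) = pval (p T.1 T.2) (M.vert S.1 S.2) ∧
        ∀ i, pval (partialFamily i p S.1 S.2) (M.vert S.1 S.2)
          = pval (partialFamily i p T.1 T.2) (M.vert S.1 S.2) := by
      have e1 := hdof.1 S.1 T.1 S.2 (T.2 + 1) o2.symm
      have e2 := hvert T.1 T.2
      rw [o2] at e2
      exact ⟨e1.1.trans e2.1.symm, fun i => (e1.2 i).trans (e2.2 i).symm⟩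
    have hb : pval (p S.1 S.2) (M.vert S.1 (S.2 + 1)) = pval (p T.1 T.2) (M.vert S.1 (S.2 + 1)) ∧
        ∀ i, pval (partialFamily i p S.1 S.2) (M.vert S.1 (S.2 + 1))
          = pval (partialFamily i p T.1 T.2) (M.vert S.1 (S.2 + 1)) := by
      have e1 := hdof.1 S.1 T.1 (S.2 + 1) T.2 o1.symm
      have e2 := hvert S.1 S.2
      exact ⟨e2.1.trans e1.1, fun i => (e2.2 i).trans (e1.2 i)⟩
    obtain ⟨t, rfl⟩ := exists_on_line_of_side_eq_zero hI.ne hx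
    have hsub : p S.1 S.2 = (p S.1 S.2 - p T.1 T.2) + p T.1 T.2 := by ring
    have hm := hdof.2 S.1 T.1 S.2 T.2 he
    have key := edge_dofs_unisolvent hk hI.ne (d := p S.1 S.2 - p T.1 T.2)
      ((MvPolynomial.totalDegree_sub _ _).trans (max_le (hp _ _).1 (hp _ _).1))
      (by rw [pval_sub, ha.1, sub_self]) (by rw [pval_sub, hb.1, sub_self])
      (fun i => by
        rw [map_sub, pval_sub, sub_eq_zero]
        exact ha.2 i)
      (fun i => by
        rw [map_sub, pval_sub, sub_eq_zero]
        exact hb.2 i)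
      (fun q hq => by
        have := hm.1 q hq
        rw [hsub, normalMoment_add] at this
        linarith)
      (fun q hq => by
        have := hm.2 q hq
        rw [hsub, valueMoment_add] at this
        linarith) t
    refine ⟨sub_eq_zero.1 (by rw [← pval_sub]; exact key.1), fun i => sub_eq_zero.1 ?_⟩
    rw [partialFamily, partialFamily, ← pval_sub, ← map_sub]
    exact key.2 i
  exact ⟨fun y _ r S T a b hI x hx => (hall hI hx).1,
    fun i y _ r S T a b hI x hx => (hall hI hx).2 i⟩

theorem matched_of_memH1 {f : Pt → ℝ} (hf : MemH1 M.domain f) {m : ℕ} {p : PolyFamily ι}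
    (hp : M.IsPiecewise m f p) : M.Matched M.domain p := fun _ _ _ _ _ _ _ hI _ hx =>
  hI.eq_of_memH1 hI.ball_subset hf (fun Q j => (hp Q j).2) hx

theorem Matched.memH1 [Finite ι] {p : PolyFamily ι} (h : M.Matched M.domain p) {f : Pt → ℝ}
    (hf : f =ᵐ[volume.restrict M.domain] M.piecewise p) : MemH1 M.domain f :=
  MemH1.congr ⟨M.memLp_piecewise p M.isBounded_domain, fun i =>
    ⟨_, M.memLp_piecewise _ M.isBounded_domain, h.isWeakPartial M subset_rfl i⟩⟩ hf.symm

/-! ### Matching families are single valued at vertices and edges -/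

/-- Freeze the evaluation point at the vertex. Near it every interface line passes through it, so `p
Q j v` does not change across interfaces and is constant on a connected piece of the domain touching
both triangles. -/
theorem Matched.eq_at_vertex [Finite ι] (hLip : HasLipschitzBoundary M.domain)
    {p : PolyFamily ι} (h : M.Matched M.domain p) {Q Q' : ι} {j j' : Fin 4}
    (he : M.vert Q j = M.vert Q' j') :
    pval (p Q j) (M.vert Q j) = pval (p Q' j') (M.vert Q j) := by
  set v := M.vert Q j with hv
  obtain ⟨r, hr, hrad⟩ := M.exists_radius v
  have hcl := M.vert_mem_closure_tri Q j
  have hcl' := M.vert_mem_closure_tri Q' j'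
  rw [← he] at hcl'
  obtain ⟨O, s, hs, hO, hOc, hOd, hOr, hsO⟩ := hLip.exists_isPreconnected M.isOpen_domain
    (closure_mono (M.tri_subset_domain Q j) hcl) hr
  have hmeet : ∀ {Q j}, v ∈ closure (M.tri Q j) → (O ∩ M.tri Q j).Nonempty := by
    intro Q j hcl
    obtain ⟨x, hx, hd⟩ := Metric.mem_closure_iff.1 hcl s hs
    exact ⟨x, hsO ⟨M.tri_subset_domain Q j hx, by rwa [Metric.mem_ball, dist_comm]⟩, hx⟩
  exact M.const_of_matched (κ := fun Q j => pval (p Q j) v) hO hOc hOd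
    (fun y hy r S T a b hI => h y (hOd hy) r S T a b hI v
      (hrad a hI.left_mem b hI.right_mem y (hOr hy) hI.on_line)) (hmeet hcl) (hmeet hcl')

theorem Matched.eq_on_edge {p : PolyFamily ι} (h : M.Matched M.domain p) {Q Q' : ι}
    {j j' : Fin 4} (he : quadEdge (M.vert Q) j = quadEdge (M.vert Q') j') (t : ℝ) :
    pval (p Q j) (M.vert Q j + t • (M.vert Q (j + 1) - M.vert Q j))
      = pval (p Q' j') (M.vert Q j + t • (M.vert Q (j + 1) - M.vert Q j)) := by
  have hy : OnEdge (M.vert Q) j (M.vert Q j + (1 / 2 : ℝ) • (M.vert Q (j + 1) - M.vert Q j)) :=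
    ⟨1 / 2, by norm_num, by norm_num, rfl⟩
  by_cases hQ : Q = Q'
  · subst hQ
    -- Within one cell the midpoint of an edge lies on no other edge line.
    have : j' = j := hy.eq_of_side_eq_zero (M.turnsLeft Q) (by
      rcases Sym2.eq_iff.1 he with ⟨h1, h2⟩ | ⟨h1, h2⟩
      · rw [← h1, ← h2]
        exact side_line _ _ _
      · rw [← h1, ← h2, side_swap, side_line, neg_zero])
    rw [this]
  · obtain ⟨r, hI⟩ := M.exists_isInterface_of_onEdge hQ he hy
    exact h _ (hI.ball_subset (Metric.mem_ball_self hI.pos)) r _ _ _ _ hI _ (side_line _ _ _)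

theorem Matched.singleValuedDOFs [Finite ι] (hLip : HasLipschitzBoundary M.domain)
    {p : PolyFamily ι} (h : M.Matched M.domain p)
    (h' : ∀ i, M.Matched M.domain (partialFamily i p)) (k : ℕ) : M.SingleValuedDOFs k p := by
  refine ⟨fun Q Q' j j' he => ⟨h.eq_at_vertex M hLip he, fun i =>
    (h' i).eq_at_vertex M hLip he⟩, fun Q Q' j j' he => ⟨fun q _ => ?_, fun q _ => ?_⟩⟩
  · simp only [normalMoment, edgeIntegral, normalDeriv]
    have e0 := (h' 0).eq_on_edge M he
    have e1 := (h' 1).eq_on_edge M he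
    simp only [partialFamily] at e0 e1
    simp only [e0, e1]
  · simp only [valueMoment, edgeIntegral, h.eq_on_edge M he]

end QuadMesh

/-! ### Weak curl and divergence -/

theorem IsWeakPartial.lp_unique {U : Set Pt} (hU : IsOpen U) {i : Fin 2} {f : Pt → ℝ}
    {g g' : L2 U} (h : IsWeakPartial U i f g) (h' : IsWeakPartial U i f g') : g = g' :=
  Lp.ext (h.unique hU h' (Lp.memLp g) (Lp.memLp g'))

theorem IsCurl.unique {U : Set Pt} (hU : IsOpen U) {φ : L2 U} {u u' : L2 U × L2 U}
    (h : IsCurl φ u) (h' : IsCurl φ u') : u = u' :=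
  Prod.ext (h.1.lp_unique hU h'.1) (neg_injective (h.2.lp_unique hU h'.2))

theorem IsDiv.unique {U : Set Pt} (hU : IsOpen U) {u : L2 U × L2 U} {w w' : L2 U}
    (h : IsDiv u w) (h' : IsDiv u w') : w = w' := by
  obtain ⟨a, b, ha, hb, rfl⟩ := h
  obtain ⟨a', b', ha', hb', rfl⟩ := h'
  rw [ha.lp_unique hU ha', hb.lp_unique hU hb']

theorem IsWeakPartial.lp_add {U : Set Pt} {i : Fin 2} {f f' g g' : L2 U}
    (h : IsWeakPartial U i f g) (h' : IsWeakPartial U i f' g') :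
    IsWeakPartial U i (f + f' : L2 U) (g + g' : L2 U) :=
  (h.add h' (Lp.memLp _) (Lp.memLp _) (Lp.memLp _) (Lp.memLp _)).congr
    (Lp.coeFn_add _ _).symm (Lp.coeFn_add _ _).symm

theorem IsWeakPartial.lp_smul {U : Set Pt} {i : Fin 2} {f g : L2 U} (c : ℝ)
    (h : IsWeakPartial U i f g) : IsWeakPartial U i (c • f : L2 U) (c • g : L2 U) :=
  (h.smul c).congr (Lp.coeFn_smul _ _).symm (Lp.coeFn_smul _ _).symm

theorem IsCurl.add {U : Set Pt} {φ φ' : L2 U} {u u' : L2 U × L2 U} (h : IsCurl φ u)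
    (h' : IsCurl φ' u') : IsCurl (φ + φ') (u + u') :=
  ⟨h.1.lp_add h'.1, by
    have := h.2.lp_add h'.2
    rwa [← neg_add] at this⟩

theorem IsCurl.smul {U : Set Pt} {φ : L2 U} {u : L2 U × L2 U} (c : ℝ) (h : IsCurl φ u) :
    IsCurl (c • φ) (c • u) :=
  ⟨h.1.lp_smul c, by
    have := h.2.lp_smul c
    rwa [smul_neg] at this⟩

theorem IsDiv.add {U : Set Pt} {u u' : L2 U × L2 U} {w w' : L2 U} (h : IsDiv u w)
    (h' : IsDiv u' w') : IsDiv (u + u') (w + w') := by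
  obtain ⟨a, b, ha, hb, rfl⟩ := h
  obtain ⟨a', b', ha', hb', rfl⟩ := h'
  exact ⟨a + a', b + b', ha.lp_add ha', hb.lp_add hb', add_add_add_comm _ _ _ _⟩

theorem IsDiv.smul {U : Set Pt} {u : L2 U × L2 U} {w : L2 U} (c : ℝ) (h : IsDiv u w) :
    IsDiv (c • u) (c • w) := by
  obtain ⟨a, b, ha, hb, rfl⟩ := h
  exact ⟨c • a, c • b, ha.lp_smul c, hb.lp_smul c, smul_add _ _ _⟩

/-- Weak `curl` and `div` are relations; uniqueness of weak derivatives makes them linear maps. -/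
theorem exists_linearMap_of_functional_relation {A B : Type*} [AddCommGroup A] [Module ℝ A]
    [AddCommGroup B] [Module ℝ B] (R : A → B → Prop) (hex : ∀ a, ∃ b, R a b)
    (huniq : ∀ a b b', R a b → R a b' → b = b')
    (hadd : ∀ a a' b b', R a b → R a' b' → R (a + a') (b + b'))
    (hsmul : ∀ (c : ℝ) a b, R a b → R (c • a) (c • b)) : ∃ f : A →ₗ[ℝ] B, ∀ a, R a (f a) := by
  choose f hf using hex
  exact ⟨{ toFun := f
           map_add' := fun a a' => huniq _ _ _ (hf _) (hadd _ _ _ _ (hf a) (hf a'))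
           map_smul' := fun c a => huniq _ _ _ (hf _) (hsmul c _ _ (hf a)) }, hf⟩

namespace QuadMesh

variable {ι : Type*} (M : QuadMesh ι)

/-! ### Exactness -/

theorem pval_neg (p : MvPolynomial (Fin 2) ℝ) (x : Pt) : pval (-p) x = -pval p x := by
  simp [pval]

theorem exists_const_mem_sigmaSpace [Finite ι] (k : ℕ) (c : ℝ) :
    ∃ φ : M.sigmaSpace k, ((φ : L2 M.domain) : Pt → ℝ)
      =ᵐ[volume.restrict M.domain] fun _ => c := by
  have e : (fun _ : Pt => c) = pval (MvPolynomial.C c) := funext fun x => (pval_C c x).symm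
  have hm : MemLp (fun _ : Pt => c) 2 (volume.restrict M.domain) := by
    rw [e]
    exact memLp_pval M.isBounded_domain M.isOpen_domain.measurableSet _
  refine ⟨⟨hm.toLp _, fun Q => ?_, fun _ _ => MvPolynomial.C c, fun Q j => ⟨by simp, ?_⟩,
    fun Q Q' j j' _ => by simp [pval_C], fun Q Q' j j' _ => by simp⟩, hm.coeFn_toLp⟩
  · refine MemH2.congr ?_ (M.ae_cell Q hm.coeFn_toLp.symm)
    rw [e]
    exact memH2_pval ((isBounded_quad _).subset interior_subset)
      (M.isOpen_cell Q).measurableSet _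
  · filter_upwards [hm.coeFn_toLp] with x hx _
    rw [hx, pval_C]

/-- Since `φ` and its gradient match, first derivatives are matched families of degree at most `k`
and second derivatives can again be taken piece by piece. They commute, so the divergence is zero.
-/
theorem exists_curl [Finite ι] {k : ℕ} (hk : k = 2 ∨ k = 3) (φ : M.sigmaSpace k) :
    ∃ u : M.velocitySpace k, IsCurl (φ : L2 M.domain) u.1 ∧ IsDiv u.1 0 := by
  obtain ⟨φ, hφ, p, hp, hdof⟩ := φ
  obtain ⟨hm, hm'⟩ := M.matched_of_mem_sigmaSpace hk hφ hp hdof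
  have hL : ∀ q : PolyFamily ι, MemLp (M.piecewise q) 2 (volume.restrict M.domain) :=
    fun q => M.memLp_piecewise q M.isBounded_domain
  have hmem : ∀ i, (hL (partialFamily i p)).toLp _ ∈ M.lagrangeSpace k := fun i =>
    ⟨(hm' i).memH1 M (hL _).coeFn_toLp, _, M.isPiecewise_of_ae_eq (hL _).coeFn_toLp
      fun Q j => totalDegree_pderiv_le (hp Q j).1 i⟩
  have hw : ∀ i, IsWeakPartial M.domain i φ ((hL (partialFamily i p)).toLp _) := fun i =>
    (hm.isWeakPartial M subset_rfl i).congr (IsPiecewise.ae_eq M hp).symm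
      (hL (partialFamily i p)).coeFn_toLp.symm
  have hw2 : ∀ i j, IsWeakPartial M.domain i ((hL (partialFamily j p)).toLp _)
      ((hL (partialFamily i (partialFamily j p))).toLp _) := fun i j =>
    ((hm' j).isWeakPartial M subset_rfl i).congr (hL _).coeFn_toLp.symm (hL _).coeFn_toLp.symm
  refine ⟨⟨((hL (partialFamily 1 p)).toLp _, -(hL (partialFamily 0 p)).toLp _),
    hmem 1, (M.lagrangeSpace k).neg_mem (hmem 0)⟩, ⟨hw 1, ?_⟩, _,
    -((hL (partialFamily 1 (partialFamily 0 p))).toLp _), hw2 0 1, ?_, ?_⟩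
  · simpa using hw 0
  · simpa using (hw2 1 0).lp_smul (-1)
  · have : partialFamily 0 (partialFamily 1 p) = partialFamily 1 (partialFamily 0 p) :=
      funext fun Q => funext fun j => pderiv_comm 0 1 _
    simp only [this, add_neg_cancel]

/-- Primitives on the triangles are corrected by constants until they match. The gradient `(-u₂,
u₁)` is in `H¹`, which gives the `H²` condition on cells, and the Lipschitz boundary gives the
vertex conditions. -/
theorem exists_potential [Finite ι] (hLip : HasLipschitzBoundary M.domain)
    (hcontr : ContractibleSpace M.domain) {k : ℕ} (u : M.velocitySpace k)
    (hu : IsDiv u.1 0) : ∃ φ : M.sigmaSpace k, IsCurl (φ : L2 M.domain) u.1 := by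
  obtain ⟨⟨u₁, u₂⟩, ⟨hu₁, p₁, hp₁⟩, ⟨hu₂, p₂, hp₂⟩⟩ := u
  obtain ⟨a, b, ha, hb, hab⟩ := hu
  have hm₁ := M.matched_of_memH1 hu₁ hp₁
  have hm₂ := M.matched_of_memH1 hu₂ hp₂
  -- Closedness as an identity of polynomials: the weak divergence vanishes almost everywhere on an
  -- open triangle, where it is the classical one.
  have hdiv : ∀ Q j, MvPolynomial.pderiv 1 (-p₂ Q j) = MvPolynomial.pderiv 0 (p₁ Q j) := by
    intro Q j
    have hT := M.tri_subset_domain Q j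
    have hTm := (M.isOpen_tri Q j).measurableSet
    have hb' := M.isBounded_domain.subset hT
    have hle := Measure.restrict_mono hT (le_refl (volume : Measure Pt))
    have e : ∀ {i f g} {p : PolyFamily ι}, IsWeakPartial M.domain i f g →
        M.IsPiecewise k f p → MemLp g 2 (volume.restrict M.domain) →
        g =ᵐ[volume.restrict (M.tri Q j)] pval (MvPolynomial.pderiv i (p Q j)) :=
      fun h hp hg => (h.mono hT).eq_pderiv (M.isOpen_tri Q j) hb' (by
        filter_upwards [ae_restrict_of_ae_restrict_of_subset hT (hp Q j).2,
          ae_restrict_mem hTm] with x h1 h2 using h1 h2) (hg.mono_measure hle)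
    have e1 := e ha hp₁ (Lp.memLp a)
    have e2 := e hb hp₂ (Lp.memLp b)
    refine eq_of_pval_ae_eq (M.isOpen_tri Q j) (M.tri_nonempty Q j) ?_
    have e3 := ae_restrict_of_ae_restrict_of_subset hT (Lp.coeFn_add a b)
    rw [← hab] at e3
    filter_upwards [e1, e2, e3, ae_restrict_of_ae_restrict_of_subset hT
      (Lp.coeFn_zero ℝ 2 (volume.restrict M.domain))] with x h1 h2 h3 h4
    rw [h4, Pi.zero_apply, Pi.add_apply, h1, h2] at h3
    rw [map_neg, pval_neg]
    linarith
  choose P hPd hP0 hP1 using fun Q j => exists_primitive (m := k) (w₀ := -p₂ Q j)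
    (by rw [MvPolynomial.totalDegree_neg]; exact (hp₂ Q j).1) (hp₁ Q j).1 (hdiv Q j)
  have hP0' : partialFamily 0 P = fun Q j => -p₂ Q j := funext fun Q => funext fun j => hP0 Q j
  have hP1' : partialFamily 1 P = p₁ := funext fun Q => funext fun j => hP1 Q j
  have hPm : ∀ i, M.Matched M.domain (partialFamily i P) := by
    intro i
    fin_cases i
    · change M.Matched M.domain (partialFamily 0 P)
      rw [hP0']
      intro y hy r S T a b hI x hx
      rw [pval_neg, pval_neg, hm₂ y hy r S T a b hI x hx]
    · change M.Matched M.domain (partialFamily 1 P)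
      rwa [hP1']
  obtain ⟨κ, hκ⟩ := M.exists_matched_add_const hcontr hPm
  set p : PolyFamily ι := fun Q j => P Q j + MvPolynomial.C (κ Q j) with hpdef
  -- The added constants do not affect the gradient.
  have hpd : ∀ i, partialFamily i p = partialFamily i P := fun i =>
    funext fun Q => funext fun j => by simp [partialFamily, hpdef]
  have hL : MemLp (M.piecewise p) 2 (volume.restrict M.domain) :=
    M.memLp_piecewise p M.isBounded_domain
  have hw : ∀ i, IsWeakPartial M.domain i (hL.toLp _) (M.piecewise (partialFamily i p)) :=
    fun i => (hκ.isWeakPartial M subset_rfl i).congr hL.coeFn_toLp.symm Filter.EventuallyEq.rfl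
  have hw1 : IsWeakPartial M.domain 1 (hL.toLp _) u₁ := by
    refine (hw 1).congr Filter.EventuallyEq.rfl ?_
    rw [hpd, hP1']
    exact (IsPiecewise.ae_eq M hp₁).symm
  have hw0 : IsWeakPartial M.domain 0 (hL.toLp _) (-u₂ : L2 M.domain) := by
    refine (hw 0).congr Filter.EventuallyEq.rfl ?_
    rw [hpd, hP0']
    filter_upwards [IsPiecewise.ae_eq M hp₂, Lp.coeFn_neg u₂, M.ae_mem_tri] with x h1 h2 ⟨Q, j, hx⟩
    rw [h2, Pi.neg_apply, h1, M.piecewise_eq _ hx, M.piecewise_eq _ hx, pval_neg]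
  have hu₂' : MemH1 M.domain (-u₂ : L2 M.domain) :=
    ((M.lagrangeSpace k).neg_mem (show u₂ ∈ M.lagrangeSpace k from ⟨hu₂, p₂, hp₂⟩)).1
  refine ⟨⟨hL.toLp _, fun Q => ⟨?_, fun i => ?_⟩, p,
    M.isPiecewise_of_ae_eq hL.coeFn_toLp fun Q j => ?_, ?_⟩, hw1, hw0⟩
  · exact (Lp.memLp (hL.toLp _)).mono_measure (Measure.restrict_mono (M.cell_subset_domain Q) le_rfl)
  · fin_cases i
    · exact ⟨_, hu₂'.mono (M.cell_subset_domain Q), hw0.mono (M.cell_subset_domain Q)⟩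
    · exact ⟨_, hu₁.mono (M.cell_subset_domain Q), hw1.mono (M.cell_subset_domain Q)⟩
  · refine (MvPolynomial.totalDegree_add _ _).trans (max_le (hPd Q j) ?_)
    rw [MvPolynomial.totalDegree_C]
    exact Nat.zero_le _
  · exact hκ.singleValuedDOFs M hLip (fun i => by rw [hpd]; exact hPm i) k

/-! ### The operators as linear maps and the kernel of the curl -/

theorem exists_inclusion [Finite ι] (k : ℕ) : ∃ incl : ℝ →ₗ[ℝ] M.sigmaSpace k,
    ∀ c : ℝ, ((incl c : L2 M.domain) : Pt → ℝ) =ᵐ[volume.restrict M.domain] fun _ => c := by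
  refine exists_linearMap_of_functional_relation
    (fun (c : ℝ) (φ : M.sigmaSpace k) =>
      ((φ : L2 M.domain) : Pt → ℝ) =ᵐ[volume.restrict M.domain] fun _ => c)
    (M.exists_const_mem_sigmaSpace k) ?_ ?_ ?_
  · exact fun c φ φ' h h' => Subtype.ext (Lp.ext (h.trans h'.symm))
  · intro c c' φ φ' h h'
    filter_upwards [h, h', Lp.coeFn_add (φ : L2 M.domain) (φ' : L2 M.domain)] with x h1 h2 h3
    rw [Submodule.coe_add, h3, Pi.add_apply, h1, h2]
  · intro d c φ h
    filter_upwards [h, Lp.coeFn_smul d (φ : L2 M.domain)] with x h1 h2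
    rw [Submodule.coe_smul, h2, Pi.smul_apply, h1]

theorem exists_curlMap [Finite ι] {k : ℕ} (hk : k = 2 ∨ k = 3) :
    ∃ curl : M.sigmaSpace k →ₗ[ℝ] M.velocitySpace k,
      ∀ φ : M.sigmaSpace k, IsCurl (φ : L2 M.domain) (curl φ).1 := by
  refine exists_linearMap_of_functional_relation
    (fun (φ : M.sigmaSpace k) (u : M.velocitySpace k) => IsCurl (φ : L2 M.domain) u.1)
    (fun φ => (M.exists_curl hk φ).imp fun _ h => h.1) ?_ ?_ ?_
  · exact fun φ u u' h h' => Subtype.ext (h.unique M.isOpen_domain h')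
  · exact fun φ φ' u u' h h' => h.add h'
  · exact fun c φ u h => h.smul c

theorem exists_isDiv {k : ℕ} (u : M.velocitySpace k) : ∃ w : M.divSpace k,
    IsDiv u.1 (w : L2 M.domain) := by
  obtain ⟨g, hg, hwg⟩ := u.2.1.1.2 0
  obtain ⟨g', hg', hwg'⟩ := u.2.2.1.2 1
  have h : IsDiv u.1 (hg.toLp g + hg'.toLp g') :=
    ⟨_, _, hwg.congr Filter.EventuallyEq.rfl hg.coeFn_toLp.symm,
      hwg'.congr Filter.EventuallyEq.rfl hg'.coeFn_toLp.symm, rfl⟩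
  exact ⟨⟨_, u.1, u.2, h⟩, h⟩

theorem exists_divMap (k : ℕ) : ∃ div : M.velocitySpace k →ₗ[ℝ] M.divSpace k,
    ∀ u : M.velocitySpace k, IsDiv u.1 (div u : L2 M.domain) := by
  refine exists_linearMap_of_functional_relation
    (fun (u : M.velocitySpace k) (w : M.divSpace k) => IsDiv u.1 (w : L2 M.domain))
    M.exists_isDiv ?_ ?_ ?_
  · exact fun u w w' h h' => Subtype.ext (h.unique M.isOpen_domain h')
  · exact fun u u' w w' h h' => h.add h'
  · exact fun c u w h => h.smul c

theorem isCurl_zero_of_const {φ : L2 M.domain} {c : ℝ}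
    (h : (φ : Pt → ℝ) =ᵐ[volume.restrict M.domain] fun _ => c) : IsCurl φ 0 := by
  have hz : (0 : Pt → ℝ) =ᵐ[volume.restrict M.domain] ((0 : L2 M.domain) : Pt → ℝ) :=
    (Lp.coeFn_zero ℝ 2 (volume.restrict M.domain)).symm
  have hw : ∀ i, IsWeakPartial M.domain i φ (0 : L2 M.domain) := fun i => by
    refine (isWeakPartial_pval M.domain i (MvPolynomial.C c)).congr ?_ ?_
    · filter_upwards [h] with x hx
      rw [hx, pval_C]
    · filter_upwards [hz] with x hx
      rw [← hx]
      simp [pval]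
  refine ⟨hw 1, ?_⟩
  have : (-(0 : L2 M.domain × L2 M.domain).2 : L2 M.domain) = 0 := neg_zero
  rw [this]
  exact hw 0

theorem ae_const_of_isCurl_zero (hcontr : ContractibleSpace M.domain) {φ : L2 M.domain}
    (h : IsCurl φ 0) :
    ∃ c : ℝ, (φ : Pt → ℝ) =ᵐ[volume.restrict M.domain] fun _ => c := by
  have hz : ((0 : L2 M.domain) : Pt → ℝ) =ᵐ[volume.restrict M.domain] 0 :=
    Lp.coeFn_zero ℝ 2 (volume.restrict M.domain)
  have h0 : IsWeakPartial M.domain 0 φ (0 : L2 M.domain) := by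
    have := h.2
    rwa [show (-(0 : L2 M.domain × L2 M.domain).2 : L2 M.domain) = 0 from neg_zero] at this
  refine IsWeakPartial.ae_const M.isOpen_domain
    (isPreconnected_iff_preconnectedSpace.2 inferInstance) (Lp.memLp φ) fun i => ?_
  fin_cases i
  · exact h0.congr Filter.EventuallyEq.rfl hz
  · exact h.1.congr Filter.EventuallyEq.rfl hz

end QuadMesh

end CrissCross

end

/-! ### Assembly of the exact complex -/

theorem mainTheorem2 {ι : Type*} [Finite ι] (M : CrissCross.QuadMesh ι)
    (hLip : CrissCross.HasLipschitzBoundary M.domain) (hcontr : ContractibleSpace M.domain)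
    (k : ℕ) (hk : k = 2 ∨ k = 3) :
    ∃ (incl : ℝ →ₗ[ℝ] M.sigmaSpace k) (curl : M.sigmaSpace k →ₗ[ℝ] M.velocitySpace k)
      (div : M.velocitySpace k →ₗ[ℝ] M.divSpace k),
      (∀ c : ℝ, ((incl c : CrissCross.L2 M.domain) : CrissCross.Pt → ℝ)
        =ᵐ[MeasureTheory.volume.restrict M.domain] fun _ => c) ∧
      (∀ φ : M.sigmaSpace k, CrissCross.IsCurl (φ : CrissCross.L2 M.domain) (curl φ).1) ∧
      (∀ u : M.velocitySpace k, CrissCross.IsDiv u.1 (div u : CrissCross.L2 M.domain)) ∧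
      Function.Injective incl ∧ Function.Exact incl curl ∧ Function.Exact curl div ∧
      Function.Surjective div := by
  have hU := M.isOpen_domain
  -- A contractible space is nonempty, so the domain has positive measure and distinct constants
  -- differ in `L²`.
  have x₀ : M.domain := Classical.choice inferInstance
  refine (M.exists_inclusion k).elim fun incl hincl => ?_
  refine (M.exists_curlMap hk).elim fun curl hcurl => ?_
  refine (M.exists_divMap k).elim fun div hdiv => ?_
  refine ⟨incl, curl, div, hincl, hcurl, hdiv, ?_, fun φ => ⟨?_, ?_⟩, fun u => ⟨?_, ?_⟩, ?_⟩
  · intro c c' h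
    have hcc := hincl c
    rw [h] at hcc
    obtain ⟨x, -, hx⟩ := CrissCross.exists_mem_of_ae hU ⟨_, x₀.2⟩ (hcc.symm.trans (hincl c'))
    exact hx
  · intro h0
    have hφ := hcurl φ
    rw [h0] at hφ
    obtain ⟨c, hc⟩ := M.ae_const_of_isCurl_zero hcontr hφ
    exact ⟨c, Subtype.ext (MeasureTheory.Lp.ext ((hincl c).trans hc.symm))⟩
  · rintro ⟨c, rfl⟩
    exact Subtype.ext ((hcurl (incl c)).unique hU (M.isCurl_zero_of_const (hincl c)))
  · intro h0
    have hu := hdiv u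
    rw [h0] at hu
    obtain ⟨φ, hφ⟩ := M.exists_potential hLip hcontr u hu
    exact ⟨φ, Subtype.ext ((hcurl φ).unique hU hφ)⟩
  · rintro ⟨φ, rfl⟩
    -- The divergence-free curl given by this lemma coincides with `curl φ` by uniqueness of the
    -- weak curl.
    obtain ⟨u, hu, hu0⟩ := M.exists_curl hk φ
    have e : curl φ = u := Subtype.ext ((hcurl φ).unique hU hu)
    have hd := hdiv (curl φ)
    rw [e] at hd ⊢
    exact Subtype.ext (hd.unique hU hu0)
  · rintro ⟨w, u, hu, hw⟩
    exact ⟨⟨u, hu⟩, Subtype.ext ((hdiv ⟨u, hu⟩).unique hU hw)⟩
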